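/- Let $r\ge 3$, $n=2r+1$, and let $P_+$ be the set of level $2$ integrable highest weights of the affine algebra $B_r^{(1)}$, i.e. the tuples $\lambda=(\lambda_0,\dots,\lambda_r)$ of nonnegative integers with $\lambda_0+\lambda_1+2\lambda_2+\cdots+2\lambda_{r-1}+\lambda_r=2$. Write $\Lambda_i$ for the fundamental weights, omit the redundant $\Lambda_0$-component, and write $0$ for $2\Lambda_0$. A *physical invariant* of $B_{r,2}$ is a matrix $M=(M_{\mu\nu})_{\mu,\nu\in P_+}$ with nonnegative integer entries and $M_{00}=1$ that commutes with the Kac–Peterson matrices $$S_{\mu\nu}=\frac{i^{r^2}}{2\,n^{r/2}}\sum_{w\in W}\det(w)\,e^{-2\pi i\,(w(\mu+\rho)\,|\,\nu+\rho)/n},\qquad T_{\mu\nu}=\delta_{\mu\nu}\,e^{2\pi i\left(\frac{(\mu+\rho)^2}{2n}-\frac{\rho^2}{2(2r-1)}\right)},$$ where $W$ and $\rho$ are the Weyl group and the Weyl vector of $B_r$, and long roots have norm $2$. Put $J\lambda=(\lambda_1,\lambda_0,\lambda_2,\dots,\lambda_r)$, $\gamma^0=0$, $\gamma^i=\Lambda_i$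 for $1\le i<r$, and $\gamma^r=2\Lambda_r$; then $P_+$ consists of the $\gamma^a$ ($0\le a\le r$), $J0$, $\Lambda_r$ and $J\Lambda_r$. Let $\mathcal I$ be the matrix with $\mathcal I_{\mu\nu}=\delta_{\mu,\nu}+\delta_{J\mu,\nu}$ if $\mu_r$ is even and $\mathcal I_{\mu\nu}=0$ if $\mu_r$ is odd. For integers $d\ge1$ and $\ell\ge0$ define $\mathcal B(d,\ell)$ by $$\mathcal B(d,\ell)_{J^i\gamma^a,J^i\gamma^b}=\begin{cases}2&\text{if } d\mid a,\ d\mid b,\ a\ne0 \text{ and } b\ne0,\\ 0&\text{if } n\nmid da \text{ or } b\not\equiv\pm a\ell \pmod d,\\ 1&\text{otherwise,}\end{cases}\qquad \mathcal B(d,\ell)_{J^i\Lambda_r,J^i\Lambda_r}=1,$$ for $a,b\in\{0,\dots,r\}$ and $i\in\{0,1\}$, all other entries being $0$, and put $$\mathcal B(d_1,\ell_1\mid d_2,\ell_2)=\tfrac12\bigl(\mathcal B(d_1,\ell_1)+\mathcal B(d_2,\ell_2)\bigr)\,\mathcal I .$$ Call $(d,\ell)$ *admissible* if $d\mid n$,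 $n\mid d^2$, $0\le\ell<\frac{d^2}{2n}$ and $\ell^2\equiv1\pmod{d^2/n}$. If $n$ is a perfect square (so that $4\mid r$), let $\mathcal C=\{\gamma^a : 1\le a\le r,\ \sqrt n\mid a\}$, and let $(\lambda^r,\mu^r)=(\Lambda_r,J\Lambda_r)$ if $8\mid r$ and $(\lambda^r,\mu^r)=(J\Lambda_r,\Lambda_r)$ otherwise. Define $\mathcal B^{i}$ and $\mathcal B^{ii}$ by $$\mathcal B^{i}_{00}=\mathcal B^{i}_{0\gamma}=\mathcal B^{i}_{\gamma0}=\mathcal B^{i}_{\gamma\gamma'}=\mathcal B^{i}_{\lambda^r\gamma}=\mathcal B^{i}_{\gamma\lambda^r}=\mathcal B^{i}_{\mu^r\mu^r}=\mathcal B^{i}_{\lambda^r,J0}=\mathcal B^{i}_{J0,\lambda^r}=1,$$ $$\mathcal B^{ii}_{00}=\mathcal B^{ii}_{0\gamma}=\mathcal B^{ii}_{\gamma0}=\mathcal B^{ii}_{\gamma\gamma'}=\mathcal B^{ii}_{0\lambda^r}=\mathcal B^{ii}_{\lambda^r0}=\mathcal B^{ii}_{\lambda^r\lambda^r}=\mathcal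 B^{ii}_{\lambda^r\gamma}=\mathcal B^{ii}_{\gamma\lambda^r}=1$$ for all $\gamma,\gamma'\in\mathcal C$, all other entries being $0$, and put $\mathcal B^{iii}=\mathcal B^{i}\,\mathcal I$ and $\mathcal B^{iv}=\mathcal I\,\mathcal B^{i}$. **Theorem 2.1.** The physical invariants of $B_{r,2}$ are precisely the following matrices: (a) $\mathcal B(d,\ell)$ for admissible $(d,\ell)$; (b) $\mathcal B(d_1,\ell_1\mid d_2,\ell_2)$ for admissible $(d_1,\ell_1)$ and $(d_2,\ell_2)$; (c) when $n$ is a perfect square, four remaining ones, $\mathcal B^{i}$, $\mathcal B^{ii}$, $\mathcal B^{iii}$ and $\mathcal B^{iv}$, which are pairwise distinct and do not occur in (a) or (b). -/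

import Mathlib

namespace AffineB

noncomputable section

/-! ### Integrable highest weights of the affine algebra of type `B_r` at level `k` -/

/-- The colabels of the affine algebra of type `B_r` (`r ≥ 3`): `1, 1, 2, …, 2, 1`. -/
def colabel (r : ℕ) (i : Fin (r + 1)) : ℕ :=
  if i = 0 ∨ i = 1 ∨ i = Fin.last r then 1 else 2

/-- `P_+` at level `k`: the tuples `(λ_0, …, λ_r)` of Dynkin labels in `ℕ` with
`k = λ_0 + λ_1 + 2 λ_2 + ⋯ + 2 λ_{r-1} + λ_r`. -/
abbrev PPlus (r k : ℕ) : Type :=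
  {lam : Fin (r + 1) → ℕ // ∑ i, colabel r i * lam i = k}

lemma colabel_pos (r : ℕ) (i : Fin (r + 1)) : 0 < colabel r i := by
  unfold colabel; split_ifs <;> norm_num

lemma label_le {r k : ℕ} (lam : PPlus r k) (i : Fin (r + 1)) : lam.1 i ≤ k := by
  have h : colabel r i * lam.1 i ≤ ∑ j, colabel r j * lam.1 j :=
    Finset.single_le_sum (f := fun j => colabel r j * lam.1 j)
      (fun j _ => Nat.zero_le _) (Finset.mem_univ i)
  rw [lam.2] at h
  exact (Nat.le_mul_of_pos_left _ (colabel_pos r i)).trans h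

instance instFinitePPlus (r k : ℕ) : Finite (PPlus r k) := by
  refine Finite.of_injective
    (fun (lam : PPlus r k) (i : Fin (r + 1)) =>
      (⟨lam.1 i, Nat.lt_succ_of_le (label_le lam i)⟩ : Fin (k + 1))) ?_
  intro a b h
  apply Subtype.ext
  funext i
  simpa using congrFun h i

instance instFintypePPlus (r k : ℕ) : Fintype (PPlus r k) := Fintype.ofFinite _

/-! ### Kac–Peterson matrices -/

/-- The finite part of the fundamental weight `Λ_i`, in the orthonormal basis `e_1, …, e_r`
(with index `j : Fin r` standing for `e_{j+1}`): `Λ_0` has finite part `0`,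
`Λ_i = e_1 + ⋯ + e_i` for `1 ≤ i < r`, and `Λ_r = (e_1 + ⋯ + e_r) / 2`. -/
def fundamentalWeight (r : ℕ) (i : Fin (r + 1)) : Fin r → ℝ :=
  fun j => if i = Fin.last r then 1 / 2 else if j.val < i.val then 1 else 0

/-- The Weyl vector `ρ = ∑ Λ_i` (finite part). -/
def weylVector (r : ℕ) : Fin r → ℝ := ∑ i, fundamentalWeight r i

/-- The finite part of `λ + ρ`, in orthonormal coordinates. -/
def shifted {r k : ℕ} (lam : PPlus r k) : Fin r → ℝ :=
  ∑ i, (lam.1 i : ℝ) • fundamentalWeight r i + weylVector r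

/-- The height `k + h^∨ = k + 2r - 1`. -/
def height (r k : ℕ) : ℝ := (k : ℝ) + 2 * r - 1

/-- The Kac–Peterson matrix
`S_{μν} = i^{|Δ_+|} |M^*/(k+h^∨)M|^{-1/2} ∑_{w ∈ W} det(w) exp(-2πi (w(μ+ρ) | ν+ρ)/(k+h^∨))`.
For `B_r`, `|Δ_+| = r^2`, the Weyl group `W` consists of the signed permutations
`(w x)_j = ε_j x_{σ j}`, with `det w = sign(σ) ∏ ε_j`, and the lattice `M` spanned by the long
roots `±e_i ± e_j` has discriminant `4`, so that `|M^*/nM| = 4 n^r`. -/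
def kpS (r k : ℕ) : Matrix (PPlus r k) (PPlus r k) ℂ :=
  fun mu nu =>
    Complex.I ^ (r ^ 2) / ((Real.sqrt (4 * height r k ^ r) : ℝ) : ℂ) *
      ∑ σ : Equiv.Perm (Fin r), ∑ ε : Fin r → ℤˣ,
        (((Equiv.Perm.sign σ * ∏ j, ε j : ℤˣ) : ℤ) : ℂ) *
          Complex.exp (-2 * Real.pi * Complex.I *
            ((∑ j, ((ε j : ℤ) : ℝ) * shifted mu (σ j) * shifted nu j : ℝ) : ℂ) /
              (height r k : ℂ))

/-- The Kac–Peterson matrix `T`, diagonal with entries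
`exp(2πi ((λ+ρ)^2 / (2(k+h^∨)) - ρ^2 / (2h^∨)))`, where `h^∨ = 2r - 1`. -/
def kpT (r k : ℕ) : Matrix (PPlus r k) (PPlus r k) ℂ :=
  Matrix.diagonal fun lam =>
    Complex.exp (2 * Real.pi * Complex.I *
      (((∑ j, shifted lam j ^ 2) / (2 * height r k)
        - (∑ j, weylVector r j ^ 2) / (2 * (2 * r - 1)) : ℝ) : ℂ))

/-! ### Physical invariants -/

/-- The weight `k Λ_0` (the vacuum, written `0`). -/
def vacuum (r k : ℕ) : PPlus r k :=
  ⟨Pi.single 0 k, by simp [Pi.single_apply, colabel]⟩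

/-- A physical invariant of `B_{r,k}`: a matrix commuting with `S` and `T`, all of whose entries
are nonnegative integers, and with `M_{00} = 1`. -/
structure IsPhysicalInvariant {r k : ℕ} (M : Matrix (PPlus r k) (PPlus r k) ℂ) : Prop where
  comm_S : M * kpS r k = kpS r k * M
  comm_T : M * kpT r k = kpT r k * M
  nonneg_int : ∀ mu nu, ∃ m : ℕ, M mu nu = m
  vacuum_one : M (vacuum r k) (vacuum r k) = 1

/-! ### The simple current -/

lemma colabel_swap (r : ℕ) (i : Fin (r + 1)) :
    colabel r (Equiv.swap 0 1 i) = colabel r i := by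
  by_cases h0 : i = 0
  · subst h0; simp [colabel]
  by_cases h1 : i = 1
  · subst h1; simp [colabel]
  rw [Equiv.swap_apply_of_ne_of_ne h0 h1]

/-- The simple current `J_b (λ_0, λ_1, λ_2, …, λ_r) = (λ_1, λ_0, λ_2, …, λ_r)`. -/
def simpleCurrent {r k : ℕ} (lam : PPlus r k) : PPlus r k :=
  ⟨fun i => lam.1 (Equiv.swap 0 1 i), by
    have h := Equiv.sum_comp (Equiv.swap (0 : Fin (r + 1)) 1) (fun i => colabel r i * lam.1 i)
    simp only [colabel_swap] at h
    exact h.trans lam.2⟩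

/-- The simple current invariant
`I[J]_{μν} = ∑_{ℓ=1}^{N} δ_{J^ℓ μ, ν} δ^1(Q_J(μ) + ℓ R(J) / (2N))` for `J = J_b`, where `N = 2`,
`Q_J(μ) = μ_r / 2`, `R(J) = 2k`, and `δ^1(x)` is `1` if `x ∈ ℤ` and `0` otherwise. -/
def currentInvariant (r k : ℕ) : Matrix (PPlus r k) (PPlus r k) ℂ :=
  open Classical in
  fun mu nu => ∑ l ∈ Finset.Icc 1 2,
    if simpleCurrent^[l] mu = nu ∧
      ∃ m : ℤ, (mu.1 (Fin.last r) : ℚ) / 2 + (l : ℚ) / (2 * 2) * (2 * k) = m then 1 else 0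

/-! ### The weights at level `2` -/

/-- `γ^0 = 0 = 2Λ_0`, `γ^1 = Λ_1` (that is `Λ_0 + Λ_1` with the redundant component included),
`γ^a = Λ_a` for `2 ≤ a < r`, and `γ^r = 2Λ_r`. -/
def gam (r : ℕ) (a : Fin (r + 1)) : PPlus r 2 :=
  ⟨if a = 0 then Pi.single 0 2
    else if a = 1 then Pi.single 0 1 + Pi.single 1 1
    else if a = Fin.last r then Pi.single (Fin.last r) 2
    else Pi.single a 1, by
    split_ifs with h0 h1 hl
    · simp [Pi.single_apply, colabel]
    · simp [Pi.single_apply, colabel, mul_add, Finset.sum_add_distrib]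
    · simp [Pi.single_apply, colabel]
    · simp [Pi.single_apply, colabel, h0, h1, hl]⟩

/-- The spinor `Λ_r` (that is `Λ_0 + Λ_r`). -/
def spinor (r : ℕ) : PPlus r 2 :=
  ⟨Pi.single 0 1 + Pi.single (Fin.last r) 1, by
    simp [Pi.single_apply, colabel, mul_add, Finset.sum_add_distrib]⟩

/-- The weight `λ^r`: it is `Λ_r` when `8 ∣ r`, and `J Λ_r` otherwise. -/
def lamSpinor (r : ℕ) : PPlus r 2 := if 8 ∣ r then spinor r else simpleCurrent (spinor r)

/-- The weight `μ^r`: it is `J Λ_r` when `8 ∣ r`, and `Λ_r` otherwise. -/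
def muSpinor (r : ℕ) : PPlus r 2 := if 8 ∣ r then simpleCurrent (spinor r) else spinor r

/-- `C = {γ^a ≠ 0 | √n divides a}`, used only when `n = 2r + 1` is a perfect square. -/
def calC (r : ℕ) : Set (PPlus r 2) :=
  {nu | ∃ a : Fin (r + 1), a ≠ 0 ∧ Nat.sqrt (2 * r + 1) ∣ a.val ∧ nu = gam r a}

/-! ### The list of matrices -/

/-- The matrix `B(d, ℓ)`. Its entry at `(J^i γ^a, J^i γ^b)` is `2` if `d ∣ a`, `d ∣ b` and
`a, b ≠ 0`; it is `0` if `n ∤ d a` or `b ≢ ± a ℓ (mod d)`; and it is `1` otherwise. Its entry at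
`(J^i Λ_r, J^i Λ_r)` is `1`, and all other entries are `0`. -/
def calB (r d l : ℕ) : Matrix (PPlus r 2) (PPlus r 2) ℂ :=
  open Classical in
  fun mu nu =>
    if ∃ (i : Fin 2) (a b : Fin (r + 1)),
        mu = simpleCurrent^[i.val] (gam r a) ∧ nu = simpleCurrent^[i.val] (gam r b) ∧
        d ∣ a.val ∧ d ∣ b.val ∧ a ≠ 0 ∧ b ≠ 0 then 2
    else if ∃ (i : Fin 2) (a b : Fin (r + 1)),
        mu = simpleCurrent^[i.val] (gam r a) ∧ nu = simpleCurrent^[i.val] (gam r b) ∧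
        (2 * r + 1) ∣ d * a.val ∧
        ((b.val : ℤ) ≡ a.val * l [ZMOD d] ∨ (b.val : ℤ) ≡ -(a.val * l) [ZMOD d]) then 1
    else if ∃ i : Fin 2,
        mu = simpleCurrent^[i.val] (spinor r) ∧ nu = simpleCurrent^[i.val] (spinor r) then 1
    else 0

/-- `B(d₁, ℓ₁ | d₂, ℓ₂) = ½ (B(d₁, ℓ₁) + B(d₂, ℓ₂)) I[J_b]`. -/
def calBPair (r d₁ l₁ d₂ l₂ : ℕ) : Matrix (PPlus r 2) (PPlus r 2) ℂ :=
  (1 / 2 : ℂ) • ((calB r d₁ l₁ + calB r d₂ l₂) * currentInvariant r 2)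

/-- The matrix `B^i`. -/
def calBi (r : ℕ) : Matrix (PPlus r 2) (PPlus r 2) ℂ :=
  open Classical in
  fun mu nu =>
    if (mu = vacuum r 2 ∧ nu = vacuum r 2) ∨
      (mu = vacuum r 2 ∧ nu ∈ calC r) ∨
      (mu ∈ calC r ∧ nu = vacuum r 2) ∨
      (mu ∈ calC r ∧ nu ∈ calC r) ∨
      (mu = lamSpinor r ∧ nu ∈ calC r) ∨
      (mu ∈ calC r ∧ nu = lamSpinor r) ∨
      (mu = muSpinor r ∧ nu = muSpinor r) ∨
      (mu = lamSpinor r ∧ nu = simpleCurrent (vacuum r 2)) ∨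
      (mu = simpleCurrent (vacuum r 2) ∧ nu = lamSpinor r) then 1 else 0

/-- The matrix `B^{ii}`. -/
def calBii (r : ℕ) : Matrix (PPlus r 2) (PPlus r 2) ℂ :=
  open Classical in
  fun mu nu =>
    if (mu = vacuum r 2 ∧ nu = vacuum r 2) ∨
      (mu = vacuum r 2 ∧ nu ∈ calC r) ∨
      (mu ∈ calC r ∧ nu = vacuum r 2) ∨
      (mu ∈ calC r ∧ nu ∈ calC r) ∨
      (mu = vacuum r 2 ∧ nu = lamSpinor r) ∨
      (mu = lamSpinor r ∧ nu = vacuum r 2) ∨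
      (mu = lamSpinor r ∧ nu = lamSpinor r) ∨
      (mu = lamSpinor r ∧ nu ∈ calC r) ∨
      (mu ∈ calC r ∧ nu = lamSpinor r) then 1 else 0

/-- The matrix `B^{iii} = B^i I[J_b]`. -/
def calBiii (r : ℕ) : Matrix (PPlus r 2) (PPlus r 2) ℂ := calBi r * currentInvariant r 2

/-- The matrix `B^{iv} = I[J_b] B^i`. -/
def calBiv (r : ℕ) : Matrix (PPlus r 2) (PPlus r 2) ℂ := currentInvariant r 2 * calBi r

/-- The parameters allowed in the list, with `n = 2r + 1`: `d ∣ n`, `n ∣ d^2`,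
`0 ≤ ℓ < d^2 / (2n)` and `ℓ^2 ≡ 1 (mod d^2 / n)`. -/
def Admissible (r d l : ℕ) : Prop :=
  d ∣ 2 * r + 1 ∧ 2 * r + 1 ∣ d ^ 2 ∧ (l : ℝ) < (d : ℝ) ^ 2 / (2 * (2 * r + 1)) ∧
    l ^ 2 ≡ 1 [MOD d ^ 2 / (2 * r + 1)]

/-- The matrices `B(d, ℓ)` with admissible parameters. -/
def familyA (r : ℕ) : Set (Matrix (PPlus r 2) (PPlus r 2) ℂ) :=
  {M | ∃ d l : ℕ, Admissible r d l ∧ M = calB r d l}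

/-- The matrices `B(d₁, ℓ₁ | d₂, ℓ₂)` with admissible parameters. -/
def familyB (r : ℕ) : Set (Matrix (PPlus r 2) (PPlus r 2) ℂ) :=
  {M | ∃ d₁ l₁ d₂ l₂ : ℕ, Admissible r d₁ l₁ ∧ Admissible r d₂ l₂ ∧ M = calBPair r d₁ l₁ d₂ l₂}

end

end AffineB

namespace AffineB

/-! Put n = 2r + 1. Both S and T can be computed, and away from the spinors S is the Fourier
transform of ℤ/n folded along x ↦ -x. The invariants are then read off from the commutant of the
Weil representation of ℤ/n.

The sum over the Weyl group is a determinant of sines. The coordinates of γ^a + ρ are the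
half-integers 1/2, …, r + 1/2 with one left out, so S at two γ's is, up to signs and a constant, a
minor of the matrix cos(2πkl/n). That matrix is inverse to itself up to scaling, so the minor is
again a cosine. The spinor entries come from the matrix of sines in the same way (`kpS_wt`). The γ^a
have conformal weight a(n - a)/(2n), so T lets γ^a and γ^b couple only if a² ≡ b² mod n
(`confWt_sub_iff`).

Adding up the rows and the columns of 0 and J0 in an invariant M cancels the spinors and leaves an
even function N on (ℤ/n)² that commutes with the Fourier transform and is supported on a² = b². In
the coordinates a - b, a + b, and after a Fourier transform in the second one, such functions are
those invariant under SL₂(ℤ), hence depend only on a gcd. So N is a combination of indicators of the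
subgroups {i ∣ a - b, n/i ∣ a + b} (`weil_commutant`). The coefficients are themselves entries of N,
evenness makes them symmetric under i ↔ n/i, and their sum is N(0,0). For N(0,0) = 1, 2, 4 this
leaves i = √n, one factorization n = ij, or two of them (`nat_invariant_classification`). The
parameters (d, ℓ) are another name for a factorization (`Matched`).

N(0,0) is fixed by the entries of M at (0,J0), (J0,0) and (J0,J0). Each is at most 1, because M =
SMS and the vacuum row of S is positive; if one equals 1, then M respects the corresponding charge
and has the corresponding J-symmetry. Consequently two of them being 1 forces the third. If only the
(J0,J0) entry is 1, M is in (a); if all are, in (b); one off-diagonal entry alone gives B^iii or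
B^iv, and none gives B^i or B^ii. The spinor entries follow from MS = SM in the spinor rows, and
from T, which lets only one spinor couple to other weights, and only if 4 ∣ r
(`IsInvariant.classification`).

Conversely, the subgroup indicators commute with the Fourier transform (`indicator_dft`), B^ii is
vvᵀ for a vector v fixed by S, and B^i = B^ii + 1 - ½I - ½wwᵀ for another fixed vector w
(`matBi_eq`). The entry at (J0,J0) separates (c) from (a) and (b). -/

/-! ### Modular invariant functions and the commutant of the Weil representation -/

/-- The two moves generate SL₂(ℤ), and the Euclidean algorithm carries (u, z) to (gcd, 0). The
induction is on |u|: reduce z mod u, then exchange the two arguments. -/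
theorem eq_gcd_of_modular_invariant {α : Type*} (g : ℤ → ℤ → α)
    (hT : ∀ u z, g u (z + u) = g u z) (hS : ∀ u z, g u z = g (-z) u) (u z : ℤ) :
    g u z = g (Int.gcd u z) 0 := by
  have hT' : ∀ (u z : ℤ) (k : ℕ), g u (z + k * u) = g u z := by
    intro u z k
    induction k with
    | zero => simp
    | succ k ih => rw [← ih, ← hT u (z + k * u)]; congr 1; push_cast; ring
  have hTi : ∀ u z k : ℤ, g u (z + k * u) = g u z := by
    intro u z k
    rcases Int.le_total 0 k with h | h
    · lift k to ℕ using h; exact hT' u z k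
    · obtain ⟨m, rfl⟩ : ∃ m : ℕ, k = -m := ⟨k.natAbs, by omega⟩
      rw [← hT' u (z + -m * u) m]; congr 1; ring
  have hneg : ∀ u z, g u z = g (-u) (-z) := fun u z => by rw [hS u z, hS (-z) u]
  induction hm : u.natAbs using Nat.strong_induction_on generalizing u z with
  | _ m ih =>
    by_cases hu : u = 0
    · subst hu
      rw [hS, Int.gcd_zero_left]
      rcases Int.natAbs_eq z with h | h
      · rw [hneg, neg_neg, neg_zero, ← h]
      · congr 1; omega
    · have h1 : g u z = g (-(z % u)) u := by
        rw [← hS, ← hTi u (z % u) (z / u)]; congr 1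
        rw [mul_comm]; exact (Int.emod_add_mul_ediv z u).symm
      have hlt : (-(z % u)).natAbs < m := by
        have := Int.emod_nonneg z hu
        have := Int.emod_lt_abs z hu
        rw [Int.abs_eq_natAbs] at this
        omega
      rw [h1, ih _ hlt _ _ rfl]
      congr 2
      rw [Int.neg_gcd, Int.gcd_comm, Int.gcd_comm u z, Int.gcd_comm u, Int.gcd_emod]

lemma zmod_natCast_dvd_intCast {n i : ℕ} [NeZero n] (hi : i ∣ n) (x : ℤ) :
    ((i : ℕ) : ZMod n) ∣ (x : ZMod n) ↔ (i : ℤ) ∣ x := by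
  constructor
  · rintro ⟨c, hc⟩
    have h : ((x - i * (c.val : ℤ) : ℤ) : ZMod n) = 0 := by
      push_cast; rw [hc, ZMod.natCast_zmod_val, sub_self]
    rw [ZMod.intCast_zmod_eq_zero_iff_dvd] at h
    have h2 : (i : ℤ) ∣ x - i * (c.val : ℤ) := (Int.natCast_dvd_natCast.2 hi).trans h
    exact (dvd_sub_left (Dvd.intro _ rfl)).1 h2
  · rintro ⟨c, rfl⟩
    exact ⟨(c : ZMod n), by push_cast; rfl⟩

/-- The value depends only on gcd(u, z, n). Möbius inversion rewrites a function of this gcd as a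
sum over its divisors, that is, over the i ∣ n dividing both u and z. -/
theorem eq_divisor_sum_of_modular_invariant {n : ℕ} [NeZero n] (h : ZMod n → ZMod n → ℂ)
    (hT : ∀ u z, h u (z + u) = h u z) (hS : ∀ u z, h u z = h (-z) u) :
    ∃ k : ℕ → ℂ, ∀ u z : ZMod n, h u z =
      ∑ i ∈ n.divisors, if (i : ZMod n) ∣ u ∧ (i : ZMod n) ∣ z then k i else 0 := by
  classical
  have key : ∀ u z : ℤ, h u z = h (((Int.gcd u z).gcd n : ℕ) : ZMod n) 0 := by
    intro u z
    have e := eq_gcd_of_modular_invariant (fun u z : ℤ => h u z)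
      (fun u z => by push_cast; exact hT _ _) (fun u z => by push_cast; exact hS _ _)
    -- The second use is at (gcd, n): since n = 0 in `ZMod n`, it brings n into the gcd.
    have e1 := e u z
    have e2 := e (Int.gcd u z) n
    simp only [Int.cast_natCast, Int.cast_zero, CharP.cast_eq_zero, Int.gcd_natCast_natCast]
      at e1 e2
    rw [e1, e2]
  set φ : ℕ → ℂ := fun D => h (D : ZMod n) 0
  set k : ℕ → ℂ := fun m => ∑ x ∈ m.divisorsAntidiagonal, (ArithmeticFunction.moebius x.1 : ℂ) * φ x.2
  have hk : ∀ m > 0, ∑ i ∈ m.divisors, k i = φ m :=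
    ArithmeticFunction.sum_eq_iff_sum_mul_moebius_eq.2 (fun m _ => rfl)
  refine ⟨k, fun u z => ?_⟩
  obtain ⟨u, rfl⟩ := ZMod.intCast_surjective u
  obtain ⟨z, rfl⟩ := ZMod.intCast_surjective z
  have hn : n ≠ 0 := NeZero.ne n
  have hpos : 0 < (Int.gcd u z).gcd n := Nat.gcd_pos_of_pos_right _ (Nat.pos_of_ne_zero hn)
  rw [key, ← Finset.sum_filter]
  change φ _ = _
  rw [← hk _ hpos]
  refine Finset.sum_congr ?_ (fun _ _ => rfl)
  ext i
  simp only [Nat.mem_divisors, Finset.mem_filter]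
  constructor
  · rintro ⟨h1, -⟩
    have hin : i ∣ n := h1.trans (Nat.gcd_dvd_right _ _)
    have hg : i ∣ Int.gcd u z := h1.trans (Nat.gcd_dvd_left _ _)
    have hg' : (i : ℤ) ∣ (Int.gcd u z : ℤ) := Int.natCast_dvd_natCast.2 hg
    exact ⟨⟨hin, hn⟩, (zmod_natCast_dvd_intCast hin u).2 (hg'.trans (Int.gcd_dvd_left _ _)),
      (zmod_natCast_dvd_intCast hin z).2 (hg'.trans (Int.gcd_dvd_right _ _))⟩
  · rintro ⟨⟨hin, -⟩, hu, hz⟩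
    refine ⟨Nat.dvd_gcd ?_ hin, hpos.ne'⟩
    exact Int.natCast_dvd_natCast.1 (Int.dvd_coe_gcd ((zmod_natCast_dvd_intCast hin u).1 hu)
      ((zmod_natCast_dvd_intCast hin z).1 hz))

/-- The multiples of i form a subgroup, and z ↦ svz is a trivial character on it exactly when n/i ∣
v. Otherwise translation by i multiplies the sum by a number other than 1, so the sum vanishes. -/
lemma sum_addChar_over_multiples {n i : ℕ} [NeZero n] (hi : i ∣ n) (s v : ZMod n)
    (hs : IsUnit s) :
    (∑ z : ZMod n, if (i : ZMod n) ∣ z then ZMod.stdAddChar (s * v * z) else 0) =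
      if ((n / i : ℕ) : ZMod n) ∣ v then
        (∑ z : ZMod n, if (i : ZMod n) ∣ z then (1 : ℂ) else 0) else 0 := by
  classical
  obtain ⟨j, rfl⟩ := hi
  have hi0 : 0 < i := Nat.pos_of_ne_zero (fun h => NeZero.ne (i * j) (by simp [h]))
  rw [Nat.mul_div_cancel_left _ hi0]
  have hij : (i : ZMod (i * j)) * (j : ZMod (i * j)) = 0 := by
    rw [← Nat.cast_mul]; simp
  split_ifs with hv
  · refine Finset.sum_congr rfl fun z _ => ?_
    split_ifs with hz
    · obtain ⟨a, rfl⟩ := hv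
      obtain ⟨b, rfl⟩ := hz
      have e : s * ((j : ZMod (i * j)) * a) * ((i : ZMod (i * j)) * b) = 0 := by
        linear_combination s * a * b * hij
      rw [e, AddChar.map_zero_eq_one]
    · rfl
  · set A := ∑ z : ZMod (i * j), if (i : ZMod (i * j)) ∣ z then ZMod.stdAddChar (s * v * z) else (0 : ℂ)
      with hA
    have hshift : A = ZMod.stdAddChar (s * v * (i : ZMod (i * j))) * A := by
      conv_lhs => rw [hA, ← Equiv.sum_comp (Equiv.addRight (i : ZMod (i * j)))]
      rw [hA, Finset.mul_sum]
      refine Finset.sum_congr rfl fun z _ => ?_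
      simp only [Equiv.coe_addRight, dvd_add_self_right, mul_ite, mul_zero]
      rw [mul_add, AddChar.map_add_eq_mul]
      split_ifs <;> ring
    have hne : ZMod.stdAddChar (s * v * (i : ZMod (i * j))) ≠ (1 : ℂ) := by
      intro h
      rw [← (ZMod.stdAddChar (N := i * j)).map_zero_eq_one, ZMod.injective_stdAddChar.eq_iff,
        mul_assoc, hs.mul_right_eq_zero] at h
      apply hv
      obtain ⟨x, rfl⟩ := ZMod.intCast_surjective v
      rw [zmod_natCast_dvd_intCast (Dvd.intro_left i rfl)]
      have h' : ((x * i : ℤ) : ZMod (i * j)) = 0 := by push_cast; exact h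
      rw [ZMod.intCast_zmod_eq_zero_iff_dvd] at h'
      push_cast at h'
      rw [mul_comm x] at h'
      exact Int.dvd_of_mul_dvd_mul_left (by exact_mod_cast hi0.ne') h'
    have : (1 - ZMod.stdAddChar (s * v * (i : ZMod (i * j)))) * A = 0 := by
      rw [sub_mul, one_mul, ← hshift, sub_self]
    rcases mul_eq_zero.1 this with h | h
    · exact absurd (sub_eq_zero.1 h).symm hne
    · exact h

/-- The commutant of the Weil representation on functions on `ZMod n`, for `n` odd, is spanned
by the indicator functions of the self-dual subgroups `{i ∣ a - b, n / i ∣ a + b}`. -/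
theorem weil_commutant {n : ℕ} [NeZero n] (N : ZMod n → ZMod n → ℂ) (t : ZMod n)
    (ht : 2 * t = 1)
    (hS : ∀ a c, ∑ y, N a y * ZMod.stdAddChar (y * c) = ∑ y, ZMod.stdAddChar (a * y) * N y c)
    (hT : ∀ a b, a ^ 2 ≠ b ^ 2 → N a b = 0) :
    ∃ c : ℕ → ℂ, (∀ a b : ZMod n, N a b = ∑ i ∈ n.divisors,
        if (i : ZMod n) ∣ a - b ∧ ((n / i : ℕ) : ZMod n) ∣ a + b then c i else 0) ∧
      ∀ i ∈ n.divisors, c i = N (t * (((n / i : ℕ) : ZMod n) + i)) (t * (((n / i : ℕ) : ZMod n) - i)) := by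
  classical
  have htu : IsUnit t := IsUnit.of_mul_eq_one_right 2 ht
  have hn0 : (n : ℂ) ≠ 0 := Nat.cast_ne_zero.2 (NeZero.ne n)
  have orth : ∀ b : ZMod n, ∑ x : ZMod n, (ZMod.stdAddChar (x * b) : ℂ) = if b = 0 then (n : ℂ) else 0 := by
    intro b
    rw [AddChar.sum_mulShift _ (ZMod.isPrimitive_stdAddChar n), ZMod.card]
    split_ifs <;> simp
  -- double Fourier self-duality
  have dual : ∀ a b, (n : ℂ) * N a b = ∑ x, ∑ y, ZMod.stdAddChar (a * x - b * y) * N x y := by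
    intro a b
    have h1 : ∑ c, ZMod.stdAddChar (-(b * c)) * ∑ y, N a y * ZMod.stdAddChar (y * c) = (n : ℂ) * N a b := by
      simp_rw [Finset.mul_sum]
      rw [Finset.sum_comm]
      have : ∀ y, ∑ c, ZMod.stdAddChar (-(b * c)) * (N a y * ZMod.stdAddChar (y * c)) =
          N a y * if y - b = 0 then (n : ℂ) else 0 := by
        intro y
        rw [← orth, Finset.mul_sum]
        refine Finset.sum_congr rfl fun c _ => ?_
        rw [mul_left_comm, ← AddChar.map_add_eq_mul]; congr 2; ring
      simp_rw [this, sub_eq_zero]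
      simp [mul_comm]
    rw [← h1]
    simp_rw [hS, Finset.mul_sum]
    rw [Finset.sum_comm]
    refine Finset.sum_congr rfl fun x _ => Finset.sum_congr rfl fun y _ => ?_
    rw [← mul_assoc, ← AddChar.map_add_eq_mul]; congr 2; ring
  -- Since t = 1/2, this is N in the coordinates u = a - b, v = a + b, where a² - b² = uv.
  set f : ZMod n → ZMod n → ℂ := fun u v => N (t * (v + u)) (t * (v - u)) with hf
  have hNf : ∀ a b, N a b = f (a - b) (a + b) := by
    intro a b
    simp only [hf]
    congr 1
    · linear_combination (-a) * ht
    · linear_combination (-b) * ht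
  have hfT : ∀ u v, u * v ≠ 0 → f u v = 0 := by
    intro u v h
    apply hT
    intro h2
    apply h
    linear_combination h2 - u * v * (2 * t + 1) * ht
  have hfS : ∀ u v, (n : ℂ) * f u v = ∑ u', ∑ v', ZMod.stdAddChar (t * (u * v' + v * u')) * f u' v' := by
    intro u v
    simp only [hf]
    rw [dual, ← Fintype.sum_prod_type', ← Fintype.sum_prod_type']
    refine (Fintype.sum_equiv
      ⟨fun p : ZMod n × ZMod n => (t * (p.2 + p.1), t * (p.2 - p.1)),
        fun p => (p.1 - p.2, p.1 + p.2), fun p => ?_, fun p => ?_⟩ _ _ fun p => ?_).symm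
    · ext
      · simp only; linear_combination p.1 * ht
      · simp only; linear_combination p.2 * ht
    · ext
      · simp only; linear_combination p.1 * ht
      · simp only; linear_combination p.2 * ht
    · simp only [Equiv.coe_fn_mk]
      congr 2
      linear_combination (-t * (u * p.2 + v * p.1)) * ht
  -- The Fourier transform in v alone turns the support condition uv = 0 into invariance under z ↦ z
  -- + u, and Fourier self-duality into invariance under (u, z) ↦ (-z, u).
  set g : ZMod n → ZMod n → ℂ := fun u z => ∑ v, ZMod.stdAddChar (t * v * z) * f u v with hg
  have hgT : ∀ u z, g u (z + u) = g u z := by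
    intro u z
    refine Finset.sum_congr rfl fun v _ => ?_
    by_cases h : u * v = 0
    · congr 2
      linear_combination t * h
    · rw [hfT u v h, mul_zero, mul_zero]
  have hgS : ∀ u z, g u z = g (-z) u := by
    intro u z
    apply mul_left_cancel₀ hn0
    simp only [hg, Finset.mul_sum]
    have e1 : ∀ v, (n : ℂ) * (ZMod.stdAddChar (t * v * z) * f u v) =
        ∑ u', ∑ v', ZMod.stdAddChar (v * (t * (z + u'))) * (ZMod.stdAddChar (t * v' * u) * f u' v') := by
      intro v
      rw [mul_left_comm, hfS, Finset.mul_sum]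
      refine Finset.sum_congr rfl fun u' _ => ?_
      rw [Finset.mul_sum]
      refine Finset.sum_congr rfl fun v' _ => ?_
      rw [← mul_assoc, ← mul_assoc, ← AddChar.map_add_eq_mul, ← AddChar.map_add_eq_mul]
      congr 2; ring
    simp_rw [e1]
    rw [Finset.sum_comm]
    have e2 : ∀ u', ∑ v, ∑ v', ZMod.stdAddChar (v * (t * (z + u'))) *
        (ZMod.stdAddChar (t * v' * u) * f u' v') =
        if u' = -z then (n : ℂ) * ∑ v', ZMod.stdAddChar (t * v' * u) * f u' v' else 0 := by
      intro u'
      simp_rw [← Finset.mul_sum]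
      rw [← Finset.sum_mul, orth]
      simp only [htu.mul_right_eq_zero, add_comm z, add_eq_zero_iff_eq_neg]
      split_ifs <;> simp
    simp_rw [e2]
    simp [Finset.mul_sum]
  obtain ⟨k, hk⟩ := eq_divisor_sum_of_modular_invariant g hgT hgS
  have hinv : ∀ u v, (n : ℂ) * f u v = ∑ z, ZMod.stdAddChar (-t * v * z) * g u z := by
    intro u v
    simp only [hg, Finset.mul_sum]
    rw [Finset.sum_comm]
    have : ∀ w, ∑ z, ZMod.stdAddChar (-t * v * z) * (ZMod.stdAddChar (t * w * z) * f u w) =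
        (if w = v then (n : ℂ) else 0) * f u w := by
      intro w
      have h1 := orth (t * (w - v))
      simp only [htu.mul_right_eq_zero, sub_eq_zero] at h1
      rw [← h1, Finset.sum_mul]
      refine Finset.sum_congr rfl fun z _ => ?_
      rw [← mul_assoc, ← AddChar.map_add_eq_mul]; congr 2; ring
    simp_rw [this]
    simp
  -- Transforming back, the indicator of i ∣ z becomes that of n/i ∣ v, scaled by the number of
  -- multiples of i over n.
  set c : ℕ → ℂ := fun i => (n : ℂ)⁻¹ * (k i * ∑ z : ZMod n, if (i : ZMod n) ∣ z then (1 : ℂ) else 0)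
  have hfc : ∀ u v, f u v = ∑ i ∈ n.divisors,
      if (i : ZMod n) ∣ u ∧ ((n / i : ℕ) : ZMod n) ∣ v then c i else 0 := by
    intro u v
    apply mul_left_cancel₀ hn0
    rw [hinv]
    simp_rw [hk, Finset.mul_sum]
    rw [Finset.sum_comm]
    refine Finset.sum_congr rfl fun i hi => ?_
    by_cases hu : (i : ZMod n) ∣ u
    · have := sum_addChar_over_multiples (Nat.dvd_of_mem_divisors hi) (-t) v htu.neg
      simp only [hu, true_and]
      calc _ = k i * ∑ z : ZMod n, (if (i : ZMod n) ∣ z then (ZMod.stdAddChar (-t * v * z) : ℂ) else 0) := by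
            rw [Finset.mul_sum]
            refine Finset.sum_congr rfl fun z _ => ?_
            split_ifs <;> ring
        _ = _ := by
            rw [this]
            split_ifs
            · simp only [c]
              field_simp
            · simp
    · simp [hu]
  refine ⟨c, fun a b => by rw [hNf, hfc], fun i hi => ?_⟩
  have hin := Nat.dvd_of_mem_divisors hi
  have hi0 := Nat.pos_of_mem_divisors hi
  -- At (u, v) = (i, n/i) only the i-th term survives: j ∣ i and n/j ∣ n/i force j = i. Thus every
  -- coefficient is an entry of N.
  change c i = f i ((n / i : ℕ) : ZMod n)
  rw [hfc, Finset.sum_eq_single_of_mem i hi, if_pos ⟨dvd_rfl, dvd_rfl⟩]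
  intro j hj hji
  rw [if_neg]
  rintro ⟨h1, h2⟩
  have hjn := Nat.dvd_of_mem_divisors hj
  have h1' : j ∣ i := by
    have := (zmod_natCast_dvd_intCast hjn (i : ℤ)).1 (by exact_mod_cast h1)
    exact_mod_cast this
  have h2' : n / j ∣ n / i := by
    have := (zmod_natCast_dvd_intCast (Nat.div_dvd_of_dvd hjn) ((n / i : ℕ) : ℤ)).1 (by exact_mod_cast h2)
    exact_mod_cast this
  apply hji
  refine Nat.dvd_antisymm h1' ?_
  have hj0 := Nat.pos_of_mem_divisors hj
  obtain ⟨m, hm⟩ := h2'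
  have e1 := Nat.div_mul_cancel hin
  have e2 := Nat.div_mul_cancel hjn
  have hpos : 0 < n / j := Nat.div_pos (Nat.le_of_dvd (Nat.pos_of_ne_zero (NeZero.ne n)) hjn) hj0
  refine ⟨m, Nat.eq_of_mul_eq_mul_left hpos ?_⟩
  calc n / j * j = n / i * i := by rw [e1, e2]
    _ = n / j * (i * m) := by rw [hm]; ring

/-! ### Natural number coefficients and their decomposition into pairs -/

/-- The sum of the indicator functions of `{i ∣ a - b, j ∣ a + b}` and `{j ∣ a - b, i ∣ a + b}`. -/
def pairCount (i j : ℕ) (a b : ℤ) : ℕ :=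
  (if (i : ℤ) ∣ a - b ∧ (j : ℤ) ∣ a + b then 1 else 0) +
    (if (j : ℤ) ∣ a - b ∧ (i : ℤ) ∣ a + b then 1 else 0)

lemma pairCount_comm (i j : ℕ) (a b : ℤ) : pairCount j i a b = pairCount i j a b := by
  unfold pairCount; rw [add_comm]

/-- The coefficients are entries of N, hence natural numbers. Replacing b by -b exchanges a - b and
a + b, whence the symmetry i ↔ n/i. -/
lemma exists_nat_coeff {n : ℕ} [NeZero n] (hn : Odd n) (N : ZMod n → ZMod n → ℕ)
    (heven : ∀ a b, N a (-b) = N a b)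
    (hS : ∀ a c, ∑ y, (N a y : ℂ) * ZMod.stdAddChar (y * c) =
      ∑ y, ZMod.stdAddChar (a * y) * (N y c : ℂ))
    (hT : ∀ a b, a ^ 2 ≠ b ^ 2 → N a b = 0) :
    ∃ c : ℕ → ℕ, (∀ i ∈ n.divisors, c (n / i) = c i) ∧ ∀ a b : ℤ,
      N a b = ∑ i ∈ n.divisors, if (i : ℤ) ∣ a - b ∧ ((n / i : ℕ) : ℤ) ∣ a + b then c i else 0 := by
  classical
  obtain ⟨t, ht⟩ : ∃ t : ZMod n, 2 * t = 1 := by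
    obtain ⟨k, hk⟩ := hn
    refine ⟨(k + 1 : ℕ), ?_⟩
    have : ((2 * k + 1 : ℕ) : ZMod n) = 0 := by rw [← hk]; simp
    push_cast at this ⊢
    linear_combination this
  obtain ⟨c, hc, hc2⟩ := weil_commutant (fun a b => (N a b : ℂ)) t ht hS
    (fun a b h => by simp [hT a b h])
  refine ⟨fun i => N (t * (((n / i : ℕ) : ZMod n) + i)) (t * (((n / i : ℕ) : ZMod n) - i)),
    fun i hi => ?_, fun a b => ?_⟩
  · have : n / (n / i) = i := Nat.div_div_self (Nat.dvd_of_mem_divisors hi) (NeZero.ne n)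
    simp only [this]
    rw [← heven]
    congr 1 <;> ring
  · have h := hc a b
    have h2 : (N a b : ℂ) = ((∑ i ∈ n.divisors, if (i : ℤ) ∣ a - b ∧ ((n / i : ℕ) : ℤ) ∣ a + b then
        N (t * (((n / i : ℕ) : ZMod n) + i)) (t * (((n / i : ℕ) : ZMod n) - i)) else 0 : ℕ) : ℂ) := by
      rw [h]
      push_cast
      refine Finset.sum_congr rfl fun i hi => ?_
      have hin := Nat.dvd_of_mem_divisors hi
      have e1 := zmod_natCast_dvd_intCast hin (a - b)
      have e2 := zmod_natCast_dvd_intCast (Nat.div_dvd_of_dvd hin) (a + b)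
      push_cast at e1 e2
      rw [hc2 i hi]
      simp only [e1, ← e2]
    exact_mod_cast h2

/-- The involution i ↦ n/i fixes only √n; modulo 2 all the other coefficients cancel in pairs. -/
lemma even_coeff_of_square {n : ℕ} (hn : n ≠ 0) (c : ℕ → ℕ)
    (hsymm : ∀ i ∈ n.divisors, c (n / i) = c i) (heven : Even (∑ i ∈ n.divisors, c i))
    (i : ℕ) (hi : i * i = n) : Even (c i) := by
  classical
  have hmem : i ∈ n.divisors := Nat.mem_divisors.2 ⟨⟨i, hi.symm⟩, hn⟩
  have hi0 : 0 < i := Nat.pos_of_mem_divisors hmem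
  rw [← Finset.add_sum_erase _ _ hmem, Nat.even_add] at heven
  refine heven.2 ?_
  rw [← ZMod.natCast_eq_zero_iff_even]
  push_cast
  refine Finset.sum_involution (fun j _ => n / j) (fun j hj => ?_) (fun j hj _ h => ?_) (fun j hj => ?_) (fun j hj => ?_)
  · rw [hsymm j (Finset.mem_of_mem_erase hj)]
    exact CharTwo.add_self_eq_zero _
  · have hj' := Finset.mem_of_mem_erase hj
    have e := Nat.div_mul_cancel (Nat.dvd_of_mem_divisors hj')
    rw [h, ← hi] at e
    exact Finset.ne_of_mem_erase hj (Nat.mul_self_inj.1 e)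
  · have hj' := Finset.mem_of_mem_erase hj
    have e := Nat.div_mul_cancel (Nat.dvd_of_mem_divisors hj')
    refine Finset.mem_erase.2 ⟨fun h => ?_, Nat.mem_divisors.2 ⟨Nat.div_dvd_of_dvd (Nat.dvd_of_mem_divisors hj'), hn⟩⟩
    rw [h, ← hi] at e
    exact Finset.ne_of_mem_erase hj (Nat.eq_of_mul_eq_mul_left hi0 e)
  · exact Nat.div_div_self (Nat.dvd_of_mem_divisors (Finset.mem_of_mem_erase hj)) hn

/-- Take i with a nonzero coefficient and lower the coefficients of i and n/i by one each. When i =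
n/i this means lowering one coefficient by 2, which parity permits. The predicate is left free so
that the result applies both to the values of N and to the total sum. -/
lemma exists_pair_decomposition {n : ℕ} (hn : n ≠ 0) (c : ℕ → ℕ)
    (hsymm : ∀ i ∈ n.divisors, c (n / i) = c i) (heven : Even (∑ i ∈ n.divisors, c i))
    (hpos : 0 < ∑ i ∈ n.divisors, c i) :
    ∃ (i j : ℕ) (c' : ℕ → ℕ), i * j = n ∧ (∀ i ∈ n.divisors, c' (n / i) = c' i) ∧
      ∀ p : ℕ → Prop, ∀ _ : DecidablePred p, (∑ k ∈ n.divisors, if p k then c k else 0) =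
        (if p i then 1 else 0) + (if p j then 1 else 0) + ∑ k ∈ n.divisors, if p k then c' k else 0 := by
  classical
  obtain ⟨i, hi, hci⟩ : ∃ i ∈ n.divisors, c i ≠ 0 := by
    by_contra! h
    rw [Finset.sum_eq_zero h] at hpos
    exact lt_irrefl _ hpos
  have hin := Nat.dvd_of_mem_divisors hi
  have hi0 := Nat.pos_of_mem_divisors hi
  have hj : n / i ∈ n.divisors := Nat.mem_divisors.2 ⟨Nat.div_dvd_of_dvd hin, hn⟩
  have hle : ∀ k ∈ n.divisors, (if i = k then 1 else 0) + (if n / i = k then 1 else 0) ≤ c k := by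
    intro k hk
    by_cases h1 : i = k <;> by_cases h2 : n / i = k
    · have := even_coeff_of_square hn c hsymm heven i (by
        have e := Nat.div_mul_cancel hin
        rwa [h2, ← h1] at e)
      obtain ⟨m, hm⟩ := this
      subst h1
      simp only [h2, if_true]
      omega
    · subst h1; simp only [if_true, h2, if_false]; omega
    · subst h2; simp only [if_true, h1, if_false, hsymm i hi]; omega
    · simp [h1, h2]
  refine ⟨i, n / i, fun k => c k - ((if i = k then 1 else 0) + (if n / i = k then 1 else 0)),
    Nat.mul_div_cancel' hin, fun k hk => ?_, fun p _ => ?_⟩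
  · have hkn := Nat.dvd_of_mem_divisors hk
    have a1 : i = n / k ↔ n / i = k := by
      constructor
      · rintro rfl; exact Nat.div_div_self hkn hn
      · rintro rfl; exact (Nat.div_div_self hin hn).symm
    have a2 : n / i = n / k ↔ i = k := by
      constructor
      · intro h
        rw [← Nat.div_div_self hin hn, h, Nat.div_div_self hkn hn]
      · rintro rfl; rfl
    simp only [hsymm k hk, a1, a2]
    rw [add_comm (if n / i = k then 1 else 0)]
  · have e : ∀ k ∈ n.divisors, (if p k then c k else 0) = (if i = k then (if p i then 1 else 0) else 0) +
        (if n / i = k then (if p (n / i) then 1 else 0) else 0) +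
        (if p k then c k - ((if i = k then 1 else 0) + (if n / i = k then 1 else 0)) else 0) := by
      intro k hk
      have := hle k hk
      by_cases hp : p k
      · have q1 : (if i = k then (if p i then 1 else 0) else 0) = if i = k then 1 else 0 := by
          split_ifs with h1 h2 <;> first | rfl | (subst h1; contradiction)
        have q2 : (if n / i = k then (if p (n / i) then 1 else 0) else 0) = if n / i = k then 1 else 0 := by
          split_ifs with h1 h2 <;> first | rfl | (subst h1; contradiction)
        rw [q1, q2, if_pos hp, if_pos hp]
        omega
      · have q1 : (if i = k then (if p i then 1 else 0) else 0) = 0 := by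
          split_ifs with h1 h2 <;> first | rfl | (subst h1; contradiction)
        have q2 : (if n / i = k then (if p (n / i) then 1 else 0) else 0) = 0 := by
          split_ifs with h1 h2 <;> first | rfl | (subst h1; contradiction)
        rw [q1, q2, if_neg hp, if_neg hp]
    rw [Finset.sum_congr rfl e, Finset.sum_add_distrib, Finset.sum_add_distrib,
      Finset.sum_ite_eq, Finset.sum_ite_eq, if_pos hi, if_pos hj]

/-- Classification of the even nonnegative integral invariants with small value at the origin. -/
theorem nat_invariant_classification {n : ℕ} [NeZero n] (hn : Odd n) (N : ZMod n → ZMod n → ℕ)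
    (heven : ∀ a b, N a (-b) = N a b)
    (hS : ∀ a c, ∑ y, (N a y : ℂ) * ZMod.stdAddChar (y * c) =
      ∑ y, ZMod.stdAddChar (a * y) * (N y c : ℂ))
    (hT : ∀ a b, a ^ 2 ≠ b ^ 2 → N a b = 0) :
    (N 0 0 = 1 → ∃ i, i * i = n ∧
      ∀ a b : ℤ, N a b = if (i : ℤ) ∣ a - b ∧ (i : ℤ) ∣ a + b then 1 else 0) ∧
    (N 0 0 = 2 → ∃ i j, i * j = n ∧ ∀ a b : ℤ, N a b = pairCount i j a b) ∧
    (N 0 0 = 4 → ∃ i j i' j', i * j = n ∧ i' * j' = n ∧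
      ∀ a b : ℤ, N a b = pairCount i j a b + pairCount i' j' a b) := by
  classical
  have hn0 : n ≠ 0 := NeZero.ne n
  obtain ⟨c, hc, hN⟩ := exists_nat_coeff hn N heven hS hT
  -- Every subgroup contains the origin, so N(0,0) is the sum of all coefficients.
  have h00 : N 0 0 = ∑ i ∈ n.divisors, c i := by
    have := hN 0 0
    simpa using this
  have step : ∀ c : ℕ → ℕ, (∀ i ∈ n.divisors, c (n / i) = c i) → Even (∑ i ∈ n.divisors, c i) →
      0 < ∑ i ∈ n.divisors, c i → ∃ (i j : ℕ) (c' : ℕ → ℕ), i * j = n ∧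
      (∀ i ∈ n.divisors, c' (n / i) = c' i) ∧
      ∑ i ∈ n.divisors, c i = 2 + ∑ i ∈ n.divisors, c' i ∧
      ∀ a b : ℤ, (∑ i ∈ n.divisors, if (i : ℤ) ∣ a - b ∧ ((n / i : ℕ) : ℤ) ∣ a + b then c i else 0) =
        pairCount i j a b +
        ∑ i ∈ n.divisors, if (i : ℤ) ∣ a - b ∧ ((n / i : ℕ) : ℤ) ∣ a + b then c' i else 0 := by
    intro c hc he hp
    obtain ⟨i, j, c', hij, hc', h⟩ := exists_pair_decomposition hn0 c hc he hp
    have hi0 : 0 < i := Nat.pos_of_ne_zero fun h => hn0 (by rw [← hij, h, zero_mul])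
    have hj0 : 0 < j := Nat.pos_of_ne_zero fun h => hn0 (by rw [← hij, h, mul_zero])
    refine ⟨i, j, c', hij, hc', ?_, fun a b => ?_⟩
    · simpa using h (fun _ => True) (fun _ => inferInstance)
    · rw [h (fun i => (i : ℤ) ∣ a - b ∧ ((n / i : ℕ) : ℤ) ∣ a + b) (fun _ => inferInstance)]
      have e1 : n / i = j := by rw [← hij]; exact Nat.mul_div_cancel_left _ hi0
      have e2 : n / j = i := by rw [← hij]; exact Nat.mul_div_cancel _ hj0
      simp only [e1, e2, pairCount]
  have zero : ∀ c : ℕ → ℕ, ∑ i ∈ n.divisors, c i = 0 → ∀ p : ℕ → Prop, ∀ _ : DecidablePred p,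
      (∑ i ∈ n.divisors, if p i then c i else 0) = 0 := by
    intro c h p _
    refine Finset.sum_eq_zero fun i hi => ?_
    rw [Finset.sum_eq_zero_iff.1 h i hi, ite_self]
  refine ⟨fun h => ?_, fun h => ?_, fun h => ?_⟩
  · rw [h00] at h
    obtain ⟨i, hi, hci⟩ : ∃ i ∈ n.divisors, c i ≠ 0 := by
      by_contra! h'
      rw [Finset.sum_eq_zero h'] at h
      exact absurd h (by norm_num)
    have hin := Nat.dvd_of_mem_divisors hi
    have hj : n / i ∈ n.divisors := Nat.mem_divisors.2 ⟨Nat.div_dvd_of_dvd hin, hn0⟩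
    have hrest : ∀ k ∈ n.divisors, k ≠ i → c k = 0 := by
      intro k hk hki
      have := Finset.add_sum_erase n.divisors c hi
      have h2 := Finset.single_le_sum (f := c) (fun _ _ => Nat.zero_le _) (Finset.mem_erase.2 ⟨hki, hk⟩)
      omega
    have hci1 : c i = 1 := by
      have := Finset.single_le_sum (f := c) (fun _ _ => Nat.zero_le _) hi
      omega
    have hii : n / i = i := by
      by_contra hne
      exact hci (by rw [← hc i hi]; exact hrest _ hj hne)
    refine ⟨i, ?_, fun a b => ?_⟩
    · have e := Nat.div_mul_cancel hin
      rwa [hii] at e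
    · rw [hN, Finset.sum_eq_single_of_mem i hi, hii, hci1]
      intro k hk hki
      rw [hrest k hk hki, ite_self]
  · rw [h00] at h
    obtain ⟨i, j, c', hij, -, hs, hd⟩ := step c hc (by rw [h]; decide) (by omega)
    refine ⟨i, j, hij, fun a b => ?_⟩
    rw [hN, hd, zero c' (by omega) _ _, add_zero]
  · rw [h00] at h
    obtain ⟨i, j, c', hij, hc', hs, hd⟩ := step c hc (by rw [h]; decide) (by omega)
    obtain ⟨i', j', c'', hij', -, hs', hd'⟩ := step c' hc' (by
      rw [show ∑ i ∈ n.divisors, c' i = 2 by omega]; decide) (by omega)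
    refine ⟨i, j, i', j', hij, hij', fun a b => ?_⟩
    rw [hN, hd, hd', zero c'' (by omega) _ _, add_zero]


/-! ### Admissible parameters and factorizations of n -/

/-- The parameters `(d, l)` describe the pair of subgroups `{i ∣ a - b, j ∣ a + b}`,
`{j ∣ a - b, i ∣ a + b}` of `(ℤ/n)²`. -/
def Matched (n d l i j : ℕ) : Prop :=
  i * j = n ∧ n ∣ d * d ∧ (∀ a : ℤ, (i : ℤ) ∣ a ∧ (j : ℤ) ∣ a ↔ (d : ℤ) ∣ a) ∧
    ∀ a b : ℤ, ((i : ℤ) ∣ a - b ∧ (j : ℤ) ∣ a + b) ↔ ((n : ℤ) ∣ d * a ∧ b ≡ a * l [ZMOD d])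

/-- Here d is the lcm of gm₁ and gm₂. As n is odd, gm₁ ∣ a - b and gm₂ ∣ a + b give g ∣ a. Since l
is 1 mod m₁ and -1 mod m₂, the two conditions then say b ≡ al modulo gm₁ and gm₂, hence modulo d. -/
lemma matched_of_coprime {n g m₁ m₂ l : ℕ} (hn : Odd n) (hng : n = g ^ 2 * (m₁ * m₂))
    (hcop : Nat.Coprime m₁ m₂) (h1 : (m₁ : ℤ) ∣ l - 1) (h2 : (m₂ : ℤ) ∣ l + 1) :
    Matched n (g * (m₁ * m₂)) l (g * m₁) (g * m₂) := by
  have hn0 : n ≠ 0 := by rintro rfl; exact absurd hn (by decide)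
  have hg0 : g ≠ 0 := by rintro rfl; simp at hng; exact hn0 hng
  have hm0 : m₁ * m₂ ≠ 0 := by intro h; rw [h] at hng; simp at hng; exact hn0 hng
  have hgodd : Odd g := by
    rw [hng, Nat.odd_mul, Nat.odd_pow_iff (by norm_num)] at hn; exact hn.1
  have hg2 : IsCoprime (g : ℤ) 2 := by
    rw [show (2 : ℤ) = ((2 : ℕ) : ℤ) by norm_num, Nat.isCoprime_iff_coprime]
    exact hgodd.coprime_two_right
  have hc : IsCoprime (m₁ : ℤ) (m₂ : ℤ) := Nat.isCoprime_iff_coprime.2 hcop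
  have hlcm : ∀ x : ℤ, ((g * m₁ : ℕ) : ℤ) ∣ x → ((g * m₂ : ℕ) : ℤ) ∣ x →
      ((g * (m₁ * m₂) : ℕ) : ℤ) ∣ x := by
    rintro x ⟨u, hu⟩ ⟨v, hv⟩
    push_cast at hu hv ⊢
    have h3 : (m₁ : ℤ) * u = m₂ * v := by
      apply mul_left_cancel₀ (show (g : ℤ) ≠ 0 by exact_mod_cast hg0)
      linarith
    have h4 : (m₂ : ℤ) ∣ u := hc.symm.dvd_of_dvd_mul_left (Dvd.intro _ h3.symm)
    obtain ⟨w, rfl⟩ := h4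
    exact ⟨w, by rw [hu]; ring⟩
  refine ⟨by rw [hng]; ring, ⟨m₁ * m₂, by rw [hng]; ring⟩, fun a => ⟨fun h => hlcm a h.1 h.2, fun h => ⟨?_, ?_⟩⟩, fun a b => ⟨?_, ?_⟩⟩
  · refine dvd_trans ⟨(m₂ : ℤ), ?_⟩ h
    push_cast; ring
  · refine dvd_trans ⟨(m₁ : ℤ), ?_⟩ h
    push_cast; ring
  · rintro ⟨ha, hb⟩
    have hga : (g : ℤ) ∣ a := by
      have e1 : (g : ℤ) ∣ a - b := dvd_trans ⟨(m₁ : ℤ), by push_cast; ring⟩ ha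
      have e2 : (g : ℤ) ∣ a + b := dvd_trans ⟨(m₂ : ℤ), by push_cast; ring⟩ hb
      have e3 : (g : ℤ) ∣ 2 * a := by
        have := dvd_add e1 e2
        rwa [show a - b + (a + b) = 2 * a by ring] at this
      exact hg2.dvd_of_dvd_mul_left e3
    obtain ⟨a', rfl⟩ := hga
    refine ⟨⟨a', by rw [hng]; push_cast; ring⟩, ?_⟩
    rw [Int.modEq_iff_dvd]
    obtain ⟨p, hp⟩ := h1
    obtain ⟨q, hq⟩ := h2
    apply hlcm
    · obtain ⟨u, hu⟩ := ha
      refine ⟨u + a' * p, ?_⟩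
      push_cast at hu ⊢
      linear_combination hu + g * a' * hp
    · obtain ⟨u, hu⟩ := hb
      refine ⟨-u + a' * q, ?_⟩
      push_cast at hu ⊢
      linear_combination -hu + g * a' * hq
  · rintro ⟨ha, hb⟩
    have hga : (g : ℤ) ∣ a := by
      obtain ⟨u, hu⟩ := ha
      rw [hng] at hu
      push_cast at hu
      refine ⟨u, ?_⟩
      apply mul_left_cancel₀ (show (g : ℤ) * (m₁ * m₂) ≠ 0 by exact_mod_cast mul_ne_zero hg0 hm0)
      linarith
    obtain ⟨a', rfl⟩ := hga
    rw [Int.modEq_iff_dvd] at hb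
    obtain ⟨w, hw⟩ := hb
    obtain ⟨p, hp⟩ := h1
    obtain ⟨q, hq⟩ := h2
    push_cast at hw
    constructor
    · refine ⟨m₂ * w - a' * p, ?_⟩
      push_cast
      linear_combination hw - g * a' * hp
    · refine ⟨-m₁ * w + a' * q, ?_⟩
      push_cast
      linear_combination -hw + g * a' * hq

/-- The conditions d ∣ n and n ∣ d² force d = gm with n = g²m, and then d²/n = m; the real bound on
ℓ becomes one between integers. -/
lemma admissible_iff {r g m l : ℕ} (hg : g ≠ 0) (hn : 2 * r + 1 = g ^ 2 * m) :
    Admissible r (g * m) l ↔ 2 * l < m ∧ l ^ 2 ≡ 1 [MOD m] := by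
  have hm0 : 0 < m := Nat.pos_of_ne_zero (by rintro rfl; omega)
  have hd : (g * m) ^ 2 / (2 * r + 1) = m := by
    rw [hn, show (g * m) ^ 2 = g ^ 2 * m * m by ring]
    exact Nat.mul_div_cancel_left _ (by positivity)
  have hlt : (l : ℝ) < ((g * m : ℕ) : ℝ) ^ 2 / (2 * (2 * r + 1)) ↔ 2 * l < m := by
    have hnr : (2 * (r : ℝ) + 1) = g ^ 2 * m := by exact_mod_cast hn
    have hgr : (0 : ℝ) < g := by positivity
    have hmr : (0 : ℝ) < m := by positivity
    have : ((g * m : ℕ) : ℝ) ^ 2 / (2 * (2 * r + 1)) = m / 2 := by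
      rw [hnr]; push_cast; field_simp
    rw [this, lt_div_iff₀ (by norm_num : (0 : ℝ) < 2), mul_comm]
    exact_mod_cast Iff.rfl
  unfold Admissible
  rw [hd, hlt]
  constructor
  · rintro ⟨-, -, h1, h2⟩; exact ⟨h1, h2⟩
  · rintro ⟨h1, h2⟩
    exact ⟨⟨g, by rw [hn]; ring⟩, ⟨m, by rw [hn]; ring⟩, h1, h2⟩

/-- As m divides (l - 1)(l + 1) and is odd, its gcds with the two factors are coprime, with product
m. These are m₁ and m₂. -/
lemma Admissible.exists_matched {r d l : ℕ} (h : Admissible r d l) :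
    ∃ i j, Matched (2 * r + 1) d l i j := by
  have h' := h
  obtain ⟨⟨g, hg⟩, hd2, -, -⟩ := h
  have hd0 : d ≠ 0 := by rintro rfl; omega
  have hg0 : g ≠ 0 := by rintro rfl; omega
  obtain ⟨m, rfl⟩ : g ∣ d := by
    rw [hg, pow_two] at hd2
    exact Nat.dvd_of_mul_dvd_mul_left (Nat.pos_of_ne_zero hd0) hd2
  have hn : 2 * r + 1 = g ^ 2 * m := by rw [hg]; ring
  have hodd : Odd (2 * r + 1) := ⟨r, rfl⟩
  obtain ⟨-, hl⟩ := (admissible_iff hg0 hn).1 h'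
  have hmodd : Odd m := by
    rw [hn, Nat.odd_mul] at hodd; exact hodd.2
  have hml : (m : ℤ) ∣ ((l : ℤ) - 1) * (l + 1) := by
    have := (Int.natCast_modEq_iff.2 hl).symm
    rw [Int.modEq_iff_dvd] at this
    push_cast at this
    rwa [show ((l : ℤ) - 1) * (l + 1) = l ^ 2 - 1 by ring]
  set m₁ := Int.gcd m ((l : ℤ) - 1)
  set m₂ := Int.gcd m ((l : ℤ) + 1)
  have d1 : (m₁ : ℤ) ∣ (l : ℤ) - 1 := Int.gcd_dvd_right _ _
  have d2 : (m₂ : ℤ) ∣ (l : ℤ) + 1 := Int.gcd_dvd_right _ _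
  have d3 : m₁ ∣ m := Int.natCast_dvd_natCast.1 (Int.gcd_dvd_left _ _)
  have d4 : m₂ ∣ m := Int.natCast_dvd_natCast.1 (Int.gcd_dvd_left _ _)
  have hcop : Nat.Coprime m₁ m₂ := by
    have hk1 : ((Nat.gcd m₁ m₂ : ℕ) : ℤ) ∣ 2 := by
      have e1 : ((Nat.gcd m₁ m₂ : ℕ) : ℤ) ∣ (l : ℤ) - 1 :=
        (Int.natCast_dvd_natCast.2 (Nat.gcd_dvd_left _ _)).trans d1
      have e2 : ((Nat.gcd m₁ m₂ : ℕ) : ℤ) ∣ (l : ℤ) + 1 :=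
        (Int.natCast_dvd_natCast.2 (Nat.gcd_dvd_right _ _)).trans d2
      have := dvd_sub e2 e1
      rwa [show (l : ℤ) + 1 - (l - 1) = 2 by ring] at this
    have hk2 : Nat.gcd m₁ m₂ ∣ 2 := by exact_mod_cast hk1
    have hk3 : Nat.gcd m₁ m₂ ∣ m := (Nat.gcd_dvd_left _ _).trans d3
    exact Nat.eq_one_of_dvd_coprimes hmodd.coprime_two_right hk3 hk2
  have hm : m = m₁ * m₂ := by
    refine Nat.dvd_antisymm ?_ (hcop.mul_dvd_of_dvd_of_dvd d3 d4)
    have : m ∣ ((l : ℤ) - 1).natAbs * ((l : ℤ) + 1).natAbs := by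
      rw [← Int.natAbs_mul]; exact Int.natCast_dvd.1 hml
    have e := Nat.dvd_gcd_mul_gcd_iff_dvd_mul.2 this
    simpa [m₁, m₂, Int.gcd] using e
  refine ⟨g * m₁, g * m₂, ?_⟩
  rw [hm] at hn ⊢
  exact matched_of_coprime hodd hn hcop d1 d2

/-- The Chinese remainder theorem gives l modulo m₁m₂. The bound 2l < m₁m₂ chooses between l and -l,
which exchanges i and j; hence the alternative. -/
lemma exists_admissible_matched {r i j : ℕ} (hij : i * j = 2 * r + 1) :
    ∃ d l, Admissible r d l ∧
      (Matched (2 * r + 1) d l i j ∨ Matched (2 * r + 1) d l j i) := by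
  have hodd : Odd (2 * r + 1) := ⟨r, rfl⟩
  have hi0 : 0 < i := Nat.pos_of_ne_zero (by rintro rfl; omega)
  obtain ⟨g, m₁, m₂, hg0, hcop, rfl, rfl⟩ :=
    Nat.exists_coprime' (m := i) (n := j) (Nat.gcd_pos_of_pos_left _ hi0)
  have hn : 2 * r + 1 = g ^ 2 * (m₁ * m₂) := by rw [← hij]; ring
  have hmodd : Odd (m₁ * m₂) := by
    rw [hn, Nat.odd_mul] at hodd; exact hodd.2
  have hm0 : 0 < m₁ * m₂ := hmodd.pos
  have hfin : ∀ (p q l : ℕ), Nat.Coprime p q → m₁ * m₂ = p * q → (p : ℤ) ∣ l - 1 → (q : ℤ) ∣ l + 1 →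
      2 * l < m₁ * m₂ → Admissible r (g * (m₁ * m₂)) l ∧
        Matched (2 * r + 1) (g * (m₁ * m₂)) l (p * g) (q * g) := by
    intro p q l hpq hm h1 h2 hl
    constructor
    · refine (admissible_iff hg0.ne' hn).2 ⟨hl, ?_⟩
      rw [← Int.natCast_modEq_iff]
      refine (Int.modEq_iff_dvd.2 ?_).symm
      rw [hm]
      push_cast
      rw [show (l : ℤ) ^ 2 - 1 = (l - 1) * (l + 1) by ring]
      exact mul_dvd_mul h1 h2
    · rw [mul_comm p, mul_comm q, hm]
      exact matched_of_coprime ⟨r, rfl⟩ (by rw [hn, hm]) hpq h1 h2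
  obtain ⟨x, y, hxy⟩ : IsCoprime (m₁ : ℤ) m₂ := Nat.isCoprime_iff_coprime.2 hcop
  -- By xm₁ + ym₂ = 1 also l₀ + 1 = 2ym₂, so l₀ is 1 mod m₁ and -1 mod m₂.
  set l₀ : ℤ := 1 - 2 * (x * m₁)
  have hmz : (0 : ℤ) < ((m₁ * m₂ : ℕ) : ℤ) := by exact_mod_cast hm0
  obtain ⟨l₁, hl₁⟩ : ∃ l₁ : ℕ, (l₁ : ℤ) = l₀ % ((m₁ * m₂ : ℕ) : ℤ) :=
    ⟨(l₀ % ((m₁ * m₂ : ℕ) : ℤ)).toNat, Int.toNat_of_nonneg (Int.emod_nonneg _ hmz.ne')⟩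
  have hlt : l₁ < m₁ * m₂ := by
    have := Int.emod_lt_of_pos l₀ hmz
    rw [← hl₁] at this; exact_mod_cast this
  obtain ⟨k, hk⟩ : ∃ k : ℤ, (l₁ : ℤ) = l₀ + m₁ * m₂ * k := by
    refine ⟨-(l₀ / ((m₁ * m₂ : ℕ) : ℤ)), ?_⟩
    have := Int.emod_add_mul_ediv l₀ ((m₁ * m₂ : ℕ) : ℤ)
    push_cast at this hl₁ ⊢
    linarith
  have h1 : (m₁ : ℤ) ∣ (l₁ : ℤ) - 1 := ⟨m₂ * k - 2 * x, by rw [hk]; simp only [l₀]; ring⟩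
  have h2 : (m₂ : ℤ) ∣ (l₁ : ℤ) + 1 :=
    ⟨m₁ * k + 2 * y, by rw [hk]; simp only [l₀]; linear_combination -2 * hxy⟩
  by_cases hl : 2 * l₁ < m₁ * m₂
  · obtain ⟨ha, hb⟩ := hfin m₁ m₂ l₁ hcop rfl h1 h2 hl
    exact ⟨_, _, ha, Or.inl hb⟩
  · have hne : 2 * l₁ ≠ m₁ * m₂ := by
      intro h
      rw [← h] at hmodd
      exact absurd hmodd (by simp)
    have hsub : ((m₁ * m₂ - l₁ : ℕ) : ℤ) = m₁ * m₂ - l₁ := by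
      rw [Nat.cast_sub hlt.le]; push_cast; rfl
    obtain ⟨ha, hb⟩ := hfin m₂ m₁ (m₁ * m₂ - l₁) hcop.symm (mul_comm _ _) (by
        rw [hsub, show (m₁ : ℤ) * m₂ - l₁ - 1 = m₁ * m₂ - (l₁ + 1) by ring]
        exact dvd_sub (Dvd.intro_left _ rfl) h2) (by
        rw [hsub, show (m₁ : ℤ) * m₂ - l₁ + 1 = m₁ * m₂ - (l₁ - 1) by ring]
        exact dvd_sub (Dvd.intro _ rfl) h1) (by omega)
    exact ⟨_, _, ha, Or.inr hb⟩

lemma indicator_add_indicator (P Q R S : Prop) [Decidable P] [Decidable Q] [Decidable R] [Decidable S]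
    (hR : R ↔ P ∧ Q) (hS : S ↔ P ∨ Q) :
    (if P then 1 else 0) + (if Q then 1 else 0) = if R then 2 else if S then 1 else 0 := by
  by_cases hP : P <;> by_cases hQ : Q <;> simp [hR, hS, hP, hQ]

open Classical in
-- The two subgroups are the solutions of b ≡ al and of b ≡ -al. Since n is odd they meet exactly
-- where d divides both a and b, and there the two indicators add up to 2.
lemma Matched.pairCount_eq {n d l i j : ℕ} (hn : Odd n) (h : Matched n d l i j) (a b : ℤ) :
    pairCount i j a b = if (d : ℤ) ∣ a ∧ (d : ℤ) ∣ b then 2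
      else if (n : ℤ) ∣ d * a ∧ (b ≡ a * l [ZMOD d] ∨ b ≡ -(a * l) [ZMOD d]) then 1 else 0 := by
  obtain ⟨hij, -, hd, hm⟩ := h
  have h1 := hm a b
  have h2 : ((j : ℤ) ∣ a - b ∧ (i : ℤ) ∣ a + b) ↔ ((n : ℤ) ∣ d * a ∧ b ≡ -(a * l) [ZMOD d]) := by
    have := hm a (-b)
    rw [sub_neg_eq_add, ← sub_eq_add_neg] at this
    rw [and_comm, this]
    constructor
    · rintro ⟨p, q⟩; exact ⟨p, by simpa using q.neg⟩
    · rintro ⟨p, q⟩; exact ⟨p, by simpa using q.neg⟩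
  have hboth : (((i : ℤ) ∣ a - b ∧ (j : ℤ) ∣ a + b) ∧ ((j : ℤ) ∣ a - b ∧ (i : ℤ) ∣ a + b)) ↔
      ((d : ℤ) ∣ a ∧ (d : ℤ) ∣ b) := by
    have two : ∀ k : ℕ, k ∣ n → ∀ x : ℤ, (k : ℤ) ∣ 2 * x → (k : ℤ) ∣ x := by
      intro k hk x hx
      have : IsCoprime (k : ℤ) 2 := by
        rw [show (2 : ℤ) = ((2 : ℕ) : ℤ) by norm_num, Nat.isCoprime_iff_coprime]
        exact (hn.of_dvd_nat hk).coprime_two_right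
      exact this.dvd_of_dvd_mul_left hx
    have key : ∀ k : ℕ, k ∣ n → (k : ℤ) ∣ a - b → (k : ℤ) ∣ a + b → (k : ℤ) ∣ a ∧ (k : ℤ) ∣ b := by
      intro k hk h1 h2
      refine ⟨two k hk _ ?_, two k hk _ ?_⟩
      · have := dvd_add h1 h2; rwa [show a - b + (a + b) = 2 * a by ring] at this
      · have := dvd_sub h2 h1; rwa [show a + b - (a - b) = 2 * b by ring] at this
    rw [← hd a, ← hd b]
    constructor
    · rintro ⟨⟨p1, p2⟩, p3, p4⟩
      have k1 := key i ⟨j, hij.symm⟩ p1 p4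
      have k2 := key j ⟨i, by rw [← hij, mul_comm]⟩ p3 p2
      exact ⟨⟨k1.1, k2.1⟩, k1.2, k2.2⟩
    · rintro ⟨⟨p1, p2⟩, p3, p4⟩
      exact ⟨⟨dvd_sub p1 p3, dvd_add p2 p4⟩, dvd_sub p2 p4, dvd_add p1 p3⟩
  have := indicator_add_indicator _ _ _ _ hboth.symm
    (show ((n : ℤ) ∣ d * a ∧ (b ≡ a * l [ZMOD d] ∨ b ≡ -(a * l) [ZMOD d])) ↔ _ by
      rw [and_or_left, ← h1, ← h2])
  rw [← this]
  simp only [pairCount]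

/-! ### The cosine and sine matrices modulo n and their determinants -/

/-- A sum over `ZMod (2 * r + 1)` folded along `x ↦ -x`. -/
lemma zmod_sum_fold {M : Type*} [AddCommMonoid M] (r : ℕ) (f : ZMod (2 * r + 1) → M) :
    ∑ x, f x = f 0 + ∑ k : Fin r, (f ((k.val + 1 : ℕ) : ZMod (2 * r + 1)) +
      f (-((k.val + 1 : ℕ) : ZMod (2 * r + 1)))) := by
  have h1 : ∑ x, f x = ∑ k ∈ Finset.range (2 * r + 1), f (k : ZMod (2 * r + 1)) := by
    rw [← Fin.sum_univ_eq_sum_range (fun k => f (k : ZMod (2 * r + 1)))]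
    refine Fintype.sum_congr _ _ fun x => ?_
    congr 1
    exact (Fin.cast_val_eq_self x).symm
  have h2 : ∀ g : ℕ → M, ∑ k ∈ Finset.range (2 * r), g k =
      ∑ k ∈ Finset.range r, g k + ∑ k ∈ Finset.range r, g (r + k) := by
    intro g; rw [two_mul, Finset.sum_range_add]
  rw [h1, Finset.sum_range_succ', add_comm, Nat.cast_zero, h2, Finset.sum_add_distrib,
    Fin.sum_univ_eq_sum_range (fun k => f ((k + 1 : ℕ) : ZMod (2 * r + 1))),
    Fin.sum_univ_eq_sum_range (fun k => f (-((k + 1 : ℕ) : ZMod (2 * r + 1))))]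
  congr 2
  -- The residues r + 1, …, 2r are the negatives of r, …, 1, in this order.
  rw [← Finset.sum_range_reflect]
  refine Finset.sum_congr rfl fun k hk => ?_
  have hk' := Finset.mem_range.1 hk
  congr 1
  rw [eq_neg_iff_add_eq_zero, ← Nat.cast_add, show r + (r - 1 - k) + 1 + (k + 1) = 2 * r + 1 by omega]
  exact ZMod.natCast_self _

lemma stdAddChar_add_neg (r : ℕ) (m : ℤ) :
    (ZMod.stdAddChar (m : ZMod (2 * r + 1)) + ZMod.stdAddChar (-(m : ZMod (2 * r + 1))) : ℂ) =
      ((2 * Real.cos (2 * Real.pi * m / (2 * r + 1)) : ℝ) : ℂ) := by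
  rw [← Int.cast_neg, ZMod.stdAddChar_coe, ZMod.stdAddChar_coe]
  push_cast
  rw [Complex.two_cos]
  congr 1 <;> congr 1 <;> ring

/-- This is the sum of a character over ℤ/n, folded, with the term at 0 removed. -/
lemma sum_two_cos (r : ℕ) (m : ℤ) :
    ∑ k : Fin r, 2 * Real.cos (2 * Real.pi * ((k.val + 1) * m) / (2 * r + 1)) =
      if ((2 * r + 1 : ℕ) : ℤ) ∣ m then 2 * (r : ℝ) else -1 := by
  have h := AddChar.sum_mulShift (m : ZMod (2 * r + 1)) (ZMod.isPrimitive_stdAddChar (2 * r + 1))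
  rw [zmod_sum_fold, zero_mul, AddChar.map_zero_eq_one, ZMod.card] at h
  have e : ∀ k : Fin r, (ZMod.stdAddChar (((k.val + 1 : ℕ) : ZMod (2 * r + 1)) * (m : ZMod (2 * r + 1))) +
      ZMod.stdAddChar (-((k.val + 1 : ℕ) : ZMod (2 * r + 1)) * (m : ZMod (2 * r + 1))) : ℂ) =
      ((2 * Real.cos (2 * Real.pi * ((k.val + 1) * m) / (2 * r + 1)) : ℝ) : ℂ) := by
    intro k
    have := stdAddChar_add_neg r ((k.val + 1) * m)
    push_cast at this ⊢
    rw [← this, neg_mul]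
  simp_rw [e] at h
  rw [← Complex.ofReal_sum] at h
  simp only [ZMod.intCast_zmod_eq_zero_iff_dvd] at h
  have h' : 1 + ∑ k : Fin r, 2 * Real.cos (2 * Real.pi * ((k.val + 1) * m) / (2 * r + 1)) =
      if ((2 * r + 1 : ℕ) : ℤ) ∣ m then ((2 * r + 1 : ℕ) : ℝ) else 0 := by
    apply Complex.ofReal_injective
    push_cast
    push_cast at h
    rw [h]
    split_ifs <;> simp
  split_ifs at h' ⊢
  · push_cast at h'; linarith
  · linarith

/-- The cosine matrix `cos (2π k l / n)`, `0 ≤ k, l ≤ r`. -/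
noncomputable def cosMatrix (r : ℕ) : Matrix (Fin (r + 1)) (Fin (r + 1)) ℝ :=
  Matrix.of fun k l => Real.cos (2 * Real.pi * (k.val * l.val) / (2 * r + 1))

/-- The sine matrix `sin (2π k l / n)`, `1 ≤ k, l ≤ r`. -/
noncomputable def sinMatrix (r : ℕ) : Matrix (Fin r) (Fin r) ℝ :=
  Matrix.of fun k l => Real.sin (2 * Real.pi * ((k.val + 1) * (l.val + 1)) / (2 * r + 1))

/-- The number of preimages of `a ≤ r` under folding `ZMod (2 * r + 1)`. -/
noncomputable def mult {r : ℕ} (a : Fin (r + 1)) : ℝ := if a = 0 then 1 else 2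

lemma sum_mult_cos_mul_cos (r : ℕ) (a b : Fin (r + 1)) :
    ∑ k, mult k * (cosMatrix r a k * cosMatrix r k b) = if a = b then (2 * r + 1) / mult a else 0 := by
  rw [Fin.sum_univ_succ]
  have e : ∀ k : Fin r, mult k.succ * (cosMatrix r a k.succ * cosMatrix r k.succ b) =
      (2 * Real.cos (2 * Real.pi * ((k.val + 1) * ((a.val - b.val : ℤ) : ℤ)) / (2 * r + 1)) +
       2 * Real.cos (2 * Real.pi * ((k.val + 1) * ((a.val + b.val : ℤ) : ℤ)) / (2 * r + 1))) / 2 := by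
    intro k
    simp only [mult, Fin.succ_ne_zero, if_false, cosMatrix, Matrix.of_apply, Fin.val_succ]
    push_cast
    rw [show 2 * Real.pi * ((k.val + 1) * ((a.val : ℝ) - b.val)) / (2 * r + 1) =
      2 * Real.pi * (a.val * (k.val + 1)) / (2 * r + 1) - 2 * Real.pi * ((k.val + 1) * b.val) / (2 * r + 1) by ring,
      show 2 * Real.pi * ((k.val + 1) * ((a.val : ℝ) + b.val)) / (2 * r + 1) =
      2 * Real.pi * (a.val * (k.val + 1)) / (2 * r + 1) + 2 * Real.pi * ((k.val + 1) * b.val) / (2 * r + 1) by ring,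
      Real.cos_sub, Real.cos_add]
    ring
  rw [Fintype.sum_congr _ _ e, ← Finset.sum_div, Finset.sum_add_distrib, sum_two_cos, sum_two_cos]
  simp only [mult, cosMatrix, Matrix.of_apply]
  have ha := a.is_lt
  have hb := b.is_lt
  have d1 : ((2 * r + 1 : ℕ) : ℤ) ∣ (a.val : ℤ) - b.val ↔ a = b := by
    rw [Fin.ext_iff]
    constructor
    · intro h
      by_contra hne
      have := Int.le_of_dvd (a := ((2 * r + 1 : ℕ) : ℤ)) (b := |(a.val : ℤ) - b.val|) (by
        rw [abs_pos]; omega) ((dvd_abs _ _).2 h)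
      rcases abs_cases ((a.val : ℤ) - b.val) with h | h <;> push_cast at this <;> omega
    · intro h; rw [h]; simp
  have d2 : ((2 * r + 1 : ℕ) : ℤ) ∣ (a.val : ℤ) + b.val ↔ a = 0 ∧ b = 0 := by
    simp only [Fin.ext_iff, Fin.val_zero]
    constructor
    · intro h
      by_contra hne
      have := Int.le_of_dvd (by omega) h
      push_cast at this
      omega
    · rintro ⟨h1, h2⟩; simp [h1, h2]
  simp only [d1, d2]
  by_cases hab : a = b
  · subst hab
    by_cases h0 : a = 0
    · subst h0; simp; ring
    · simp [h0]; ring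
  · have : ¬ (a = 0 ∧ b = 0) := fun h => hab (h.1.trans h.2.symm)
    simp [hab, this]

lemma sum_sin_mul_sin (r : ℕ) (a b : Fin r) :
    ∑ k, sinMatrix r a k * sinMatrix r k b = if a = b then (2 * (r : ℝ) + 1) / 4 else 0 := by
  have e : ∀ k : Fin r, sinMatrix r a k * sinMatrix r k b =
      (2 * Real.cos (2 * Real.pi * ((k.val + 1) * ((a.val - b.val : ℤ) : ℤ)) / (2 * r + 1)) -
       2 * Real.cos (2 * Real.pi * ((k.val + 1) * ((a.val + b.val + 2 : ℤ) : ℤ)) / (2 * r + 1))) / 4 := by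
    intro k
    simp only [sinMatrix, Matrix.of_apply]
    push_cast
    rw [show 2 * Real.pi * ((k.val + 1) * ((a.val : ℝ) - b.val)) / (2 * r + 1) =
      2 * Real.pi * ((a.val + 1) * (k.val + 1)) / (2 * r + 1) - 2 * Real.pi * ((k.val + 1) * (b.val + 1)) / (2 * r + 1) by ring,
      show 2 * Real.pi * ((k.val + 1) * ((a.val : ℝ) + b.val + 2)) / (2 * r + 1) =
      2 * Real.pi * ((a.val + 1) * (k.val + 1)) / (2 * r + 1) + 2 * Real.pi * ((k.val + 1) * (b.val + 1)) / (2 * r + 1) by ring,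
      Real.cos_sub, Real.cos_add]
    ring
  rw [Fintype.sum_congr _ _ e, ← Finset.sum_div, Finset.sum_sub_distrib, sum_two_cos, sum_two_cos]
  have ha := a.is_lt
  have hb := b.is_lt
  have d1 : ((2 * r + 1 : ℕ) : ℤ) ∣ (a.val : ℤ) - b.val ↔ a = b := by
    rw [Fin.ext_iff]
    constructor
    · intro h
      by_contra hne
      have := Int.le_of_dvd (a := ((2 * r + 1 : ℕ) : ℤ)) (b := |(a.val : ℤ) - b.val|) (by
        rw [abs_pos]; omega) ((dvd_abs _ _).2 h)
      rcases abs_cases ((a.val : ℤ) - b.val) with h | h <;> push_cast at this <;> omega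
    · intro h; rw [h]; simp
  have d2 : ¬ ((2 * r + 1 : ℕ) : ℤ) ∣ (a.val : ℤ) + b.val + 2 := by
    intro h
    have := Int.le_of_dvd (by omega) h
    push_cast at this
    omega
  simp only [d1, d2]
  by_cases hab : a = b
  · simp [hab]
  · simp [hab]

/-- For decreasing nodes each of the m(m - 1)/2 factors is negative. -/
lemma vandermonde_sign {m : ℕ} (v : Fin m → ℝ) (hv : StrictAnti v) :
    0 < (-1 : ℝ) ^ (m * (m - 1) / 2) * (Matrix.vandermonde v).det := by
  have hcount : (-1 : ℝ) ^ (m * (m - 1) / 2) = ∏ i : Fin m, ∏ j ∈ Finset.Ioi i, (-1 : ℝ) := by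
    simp only [Finset.prod_const, Fin.card_Ioi]
    rw [Finset.prod_pow_eq_pow_sum, Fin.sum_univ_eq_sum_range (fun k => m - 1 - k),
      Finset.sum_range_reflect (fun k => k), Finset.sum_range_id]
  rw [Matrix.det_vandermonde, hcount, ← Finset.prod_mul_distrib]
  refine Finset.prod_pos fun i _ => ?_
  rw [← Finset.prod_mul_distrib]
  refine Finset.prod_pos fun j hj => ?_
  have := hv (Finset.mem_Ioi.1 hj)
  linarith

/-- Dividing each polynomial by its leading coefficient does not change the sign of the determinant,
and for monic polynomials of degrees 0, …, m - 1 it is the Vandermonde determinant. -/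
lemma polynomial_det_sign {m : ℕ} (v : Fin m → ℝ) (hv : StrictAnti v)
    (p : Fin m → Polynomial ℝ) (hdeg : ∀ i, (p i).natDegree = i) (hlead : ∀ i, 0 < (p i).leadingCoeff) :
    0 < (-1 : ℝ) ^ (m * (m - 1) / 2) * (Matrix.of fun i j => (p j).eval (v i)).det := by
  have h := Matrix.det_eval_matrixOfPolynomials_eq_det_vandermonde v
    (fun i => Polynomial.C (p i).leadingCoeff⁻¹ * p i) (fun i => by
      rw [Polynomial.natDegree_C_mul (inv_ne_zero (hlead i).ne'), hdeg])
    (fun i => by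
      rw [Polynomial.Monic, Polynomial.leadingCoeff_C_mul_of_isUnit]
      · exact inv_mul_cancel₀ (hlead i).ne'
      · exact (inv_ne_zero (hlead i).ne').isUnit)
  have h2 : (Matrix.of fun i j => (Polynomial.C (p j).leadingCoeff⁻¹ * p j).eval (v i)).det =
      (∏ j, (p j).leadingCoeff⁻¹) * (Matrix.of fun i j => (p j).eval (v i)).det := by
    rw [← Matrix.det_mul_row]
    simp
  have h3 := vandermonde_sign v hv
  rw [h, h2] at h3
  have h4 : 0 < ∏ j, (p j).leadingCoeff⁻¹ := Finset.prod_pos fun i _ => inv_pos.2 (hlead i)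
  rw [mul_left_comm] at h3
  exact pos_of_mul_pos_right h3 h4.le

/-- The entry at (k, l) is the Chebyshev polynomial T_l evaluated at cos(2πk/n), and these nodes
decrease because 2πk/n ≤ π for k ≤ r. The orthogonality relations give the square of the
determinant; only its sign needs an argument. -/
lemma cosMatrix_det_sign (r : ℕ) : 0 < (-1 : ℝ) ^ ((r + 1) * r / 2) * (cosMatrix r).det := by
  have h := polynomial_det_sign (m := r + 1) (fun k => Real.cos (2 * Real.pi * k.val / (2 * r + 1)))
    (fun a b hab => by
      have hb := b.is_lt
      have hab' : (a.val : ℝ) < b.val := by exact_mod_cast hab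
      have hbr : (b.val : ℝ) ≤ r := by exact_mod_cast Nat.lt_succ_iff.1 hb
      have hn : (0 : ℝ) < 2 * r + 1 := by positivity
      apply Real.cos_lt_cos_of_nonneg_of_le_pi (by positivity)
      · rw [div_le_iff₀ hn]; nlinarith [Real.pi_pos]
      · rw [div_lt_div_iff_of_pos_right hn]; nlinarith [Real.pi_pos])
    (fun k => Polynomial.Chebyshev.T ℝ k.val)
    (fun i => by simp) (fun i => by rw [Polynomial.Chebyshev.leadingCoeff_T]; positivity)
  have e : (Matrix.of fun i j : Fin (r + 1) => (Polynomial.Chebyshev.T ℝ (j.val : ℤ)).eval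
      (Real.cos (2 * Real.pi * i.val / (2 * r + 1)))) = cosMatrix r := by
    ext i j
    simp only [Matrix.of_apply, cosMatrix, Polynomial.Chebyshev.T_real_cos]
    congr 1; push_cast; ring
  rw [e] at h
  simpa using h

/-- The same with the polynomials U_l, after a positive sine has been taken out of each row. -/
lemma sinMatrix_det_sign (r : ℕ) : 0 < (-1 : ℝ) ^ (r * (r - 1) / 2) * (sinMatrix r).det := by
  have hn : (0 : ℝ) < 2 * r + 1 := by positivity
  have h := polynomial_det_sign (m := r) (fun k => Real.cos (2 * Real.pi * (k.val + 1) / (2 * r + 1)))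
    (fun a b hab => by
      have hb := b.is_lt
      have hab' : (a.val : ℝ) < b.val := by exact_mod_cast hab
      have hbr : (b.val : ℝ) + 1 ≤ r := by exact_mod_cast hb
      apply Real.cos_lt_cos_of_nonneg_of_le_pi (by positivity)
      · rw [div_le_iff₀ hn]; nlinarith [Real.pi_pos]
      · rw [div_lt_div_iff_of_pos_right hn]; nlinarith [Real.pi_pos])
    (fun k => Polynomial.Chebyshev.U ℝ k.val)
    (fun i => by simp) (fun i => by rw [Polynomial.Chebyshev.leadingCoeff_U_natCast]; positivity)
  have e : sinMatrix r = Matrix.of fun i j : Fin r => Real.sin (2 * Real.pi * (i.val + 1) / (2 * r + 1)) *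
      (Matrix.of fun i j : Fin r => (Polynomial.Chebyshev.U ℝ (j.val : ℤ)).eval
      (Real.cos (2 * Real.pi * (i.val + 1) / (2 * r + 1)))) i j := by
    ext i j
    simp only [Matrix.of_apply, sinMatrix]
    rw [mul_comm (Real.sin _), Polynomial.Chebyshev.U_real_cos]
    congr 1; push_cast; ring
  rw [e, Matrix.det_mul_column, mul_left_comm]
  refine mul_pos (Finset.prod_pos fun i _ => ?_) h
  have hb := i.is_lt
  have hbr : (i.val : ℝ) + 1 ≤ r := by exact_mod_cast hb
  apply Real.sin_pos_of_pos_of_lt_pi (by positivity)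
  rw [div_lt_iff₀ hn]; nlinarith [Real.pi_pos]

lemma prod_mult (r : ℕ) : ∏ a : Fin (r + 1), mult a = 2 ^ r := by
  rw [Fin.prod_univ_succ]; simp [mult]

lemma mult_pos {r : ℕ} (a : Fin (r + 1)) : 0 < mult a := by
  unfold mult; split_ifs <;> norm_num

lemma cosMatrix_mul (r : ℕ) : cosMatrix r * Matrix.diagonal mult * cosMatrix r =
    Matrix.diagonal fun a => (2 * r + 1) / mult a := by
  ext a b
  rw [Matrix.mul_apply]
  simp only [Matrix.mul_diagonal, Matrix.diagonal_apply]
  rw [← sum_mult_cos_mul_cos]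
  exact Finset.sum_congr rfl fun k _ => by ring

lemma cosMatrix_det_sq (r : ℕ) : (cosMatrix r).det ^ 2 = (2 * r + 1) ^ (r + 1) / 4 ^ r := by
  have h := congrArg Matrix.det (cosMatrix_mul r)
  rw [Matrix.det_mul, Matrix.det_mul, Matrix.det_diagonal, Matrix.det_diagonal, Finset.prod_div_distrib,
    prod_mult] at h
  simp only [Finset.prod_const, Finset.card_univ, Fintype.card_fin] at h
  rw [eq_div_iff (by positivity)] at h ⊢
  rw [← h, show (4 : ℝ) = 2 * 2 by norm_num, mul_pow]; ring

lemma sinMatrix_det_sq (r : ℕ) : (sinMatrix r).det ^ 2 = ((2 * r + 1) / 4) ^ r := by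
  have e : sinMatrix r * sinMatrix r = Matrix.diagonal fun _ => (2 * (r : ℝ) + 1) / 4 := by
    ext a b
    rw [Matrix.mul_apply, Matrix.diagonal_apply, sum_sin_mul_sin]
  have h := congrArg Matrix.det e
  rw [Matrix.det_mul, Matrix.det_diagonal] at h
  simpa [pow_two, div_pow] using h

lemma eq_sign_mul_sqrt {x y : ℝ} {k : ℕ} (hx : x ^ 2 = y) (hs : 0 < (-1 : ℝ) ^ k * x) :
    x = (-1) ^ k * Real.sqrt y := by
  have h1 : ((-1 : ℝ) ^ k) * (-1) ^ k = 1 := by rw [← mul_pow]; simp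
  have h2 : Real.sqrt y = (-1) ^ k * x := by
    rw [← hx, Real.sqrt_eq_iff_mul_self_eq (sq_nonneg x) hs.le]
    linear_combination -x ^ 2 * h1
  rw [h2, ← mul_assoc, h1, one_mul]

lemma cosMatrix_det (r : ℕ) : (cosMatrix r).det =
    (-1) ^ ((r + 1) * r / 2) * Real.sqrt ((2 * r + 1) ^ (r + 1) / 4 ^ r) :=
  eq_sign_mul_sqrt (cosMatrix_det_sq r) (cosMatrix_det_sign r)

lemma sinMatrix_det (r : ℕ) : (sinMatrix r).det =
    (-1) ^ (r * (r - 1) / 2) * Real.sqrt (((2 * r + 1) / 4) ^ r) :=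
  eq_sign_mul_sqrt (sinMatrix_det_sq r) (sinMatrix_det_sign r)

/-- By orthogonality the inverse of the cosine matrix C is DCD/n, with D the diagonal of
multiplicities. This determines all minors of C of size r. -/
lemma cosMatrix_adjugate (r : ℕ) (a b : Fin (r + 1)) : (cosMatrix r).adjugate a b =
    (cosMatrix r).det * (mult a * mult b * cosMatrix r a b) / (2 * r + 1) := by
  have hn : (2 * (r : ℝ) + 1) ≠ 0 := by positivity
  have h : cosMatrix r * (Matrix.diagonal mult * cosMatrix r * Matrix.diagonal mult) =
      (2 * (r : ℝ) + 1) • (1 : Matrix (Fin (r + 1)) (Fin (r + 1)) ℝ) := by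
    rw [← mul_assoc, ← mul_assoc, cosMatrix_mul, Matrix.diagonal_mul_diagonal, ← Matrix.diagonal_one,
      ← Matrix.diagonal_smul]
    congr 1; ext a
    have := (mult_pos a).ne'
    simp; field_simp
  have h2 : (cosMatrix r).det • (Matrix.diagonal mult * cosMatrix r * Matrix.diagonal mult) =
      (2 * (r : ℝ) + 1) • (cosMatrix r).adjugate := by
    have e : (2 * (r : ℝ) + 1) • (cosMatrix r).adjugate =
        (cosMatrix r).adjugate * ((2 * (r : ℝ) + 1) • 1) := by rw [Matrix.mul_smul, Matrix.mul_one]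
    rw [e, ← h, ← mul_assoc, Matrix.adjugate_mul, Matrix.smul_mul, Matrix.one_mul]
  have h3 := Matrix.ext_iff.2 h2 a b
  rw [Matrix.smul_apply, Matrix.smul_apply, Matrix.mul_diagonal, Matrix.diagonal_mul, smul_eq_mul,
    smul_eq_mul] at h3
  rw [eq_div_iff hn]
  linarith

/-! ### Coordinates of the shifted weights -/

lemma sum_fundamentalWeight_castSucc (r : ℕ) (j : Fin r) :
    ∑ i : Fin r, fundamentalWeight r i.castSucc j = (r : ℝ) - 1 - j.val := by
  have h : ∀ i : Fin r, fundamentalWeight r i.castSucc j = if j < i then 1 else 0 := by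
    intro i
    simp [fundamentalWeight, Fin.castSucc_ne_last]
  simp_rw [h]
  rw [Finset.sum_boole]
  have : (Finset.univ.filter fun i => j < i) = Finset.Ioi j := by ext; simp
  rw [this, Fin.card_Ioi, Nat.sub_sub, Nat.cast_sub (by omega)]
  push_cast; ring

lemma weylVector_apply (r : ℕ) (j : Fin r) : weylVector r j = (r : ℝ) - j.val - 1 / 2 := by
  rw [weylVector, Finset.sum_apply, Fin.sum_univ_castSucc, sum_fundamentalWeight_castSucc]
  simp [fundamentalWeight]; ring

lemma shifted_apply {r k : ℕ} (lam : PPlus r k) (j : Fin r) :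
    shifted lam j = ∑ i, (lam.1 i : ℝ) * fundamentalWeight r i j + ((r : ℝ) - j.val - 1 / 2) := by
  simp only [shifted, Pi.add_apply, Finset.sum_apply, Pi.smul_apply, smul_eq_mul, weylVector_apply]

lemma fin_one_ne_last {r : ℕ} (hr : 3 ≤ r) : (1 : Fin (r + 1)) ≠ Fin.last r := by
  intro h
  have := congrArg Fin.val h
  rw [Fin.val_last, Fin.val_one'] at this
  rw [Nat.mod_eq_of_lt (by omega)] at this
  omega

lemma fin_val_one {r : ℕ} (hr : 3 ≤ r) : (1 : Fin (r + 1)).val = 1 := by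
  rw [Fin.val_one', Nat.mod_eq_of_lt (by omega)]

lemma fin_zero_ne_last {r : ℕ} (hr : 3 ≤ r) : (0 : Fin (r + 1)) ≠ Fin.last r := by
  intro h
  have := congrArg Fin.val h
  simp at this; omega

lemma fundamentalWeight_zero {r : ℕ} (hr : 3 ≤ r) (j : Fin r) : fundamentalWeight r 0 j = 0 := by
  rw [fundamentalWeight, if_neg (fin_zero_ne_last hr), if_neg (by simp)]

lemma fundamentalWeight_one {r : ℕ} (hr : 3 ≤ r) (j : Fin r) :
    fundamentalWeight r 1 j = if j.val = 0 then 1 else 0 := by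
  rw [fundamentalWeight, if_neg (fin_one_ne_last hr), fin_val_one hr]
  simp only [Nat.lt_one_iff]

lemma fundamentalWeight_last (r : ℕ) (j : Fin r) : fundamentalWeight r (Fin.last r) j = 1 / 2 := by
  rw [fundamentalWeight, if_pos rfl]

lemma fundamentalWeight_of_ne_last {r : ℕ} {i : Fin (r + 1)} (hi : i ≠ Fin.last r) (j : Fin r) :
    fundamentalWeight r i j = if j.val < i.val then 1 else 0 := by
  rw [fundamentalWeight, if_neg hi]

lemma sum_single_mul {ι : Type*} [Fintype ι] [DecidableEq ι] (a : ι) (c : ℕ) (f : ι → ℝ) :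
    ∑ i, (((Pi.single a c : ι → ℕ) i : ℕ) : ℝ) * f i = c * f a := by
  rw [Finset.sum_eq_single a] <;> simp +contextual

/-- The coordinates of γ^a + ρ are r + 1/2, …, 1/2 with the one at position a omitted; this is why
minors will appear. -/
lemma shifted_gam {r : ℕ} (hr : 3 ≤ r) (a : Fin (r + 1)) (j : Fin r) :
    shifted (gam r a) j = (r : ℝ) + 1 / 2 - (a.succAbove j).val := by
  rw [shifted_apply]
  have h1l := fin_one_ne_last hr
  have h0l := fin_zero_ne_last hr
  have h1 := fin_val_one hr
  have hs : ((a.succAbove j).val : ℝ) = if j.val < a.val then (j.val : ℝ) else j.val + 1 := by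
    unfold Fin.succAbove
    simp only [Fin.lt_def, Fin.val_castSucc]
    split_ifs <;> simp
  rw [hs]
  have key : ∑ i, ((gam r a).1 i : ℝ) * fundamentalWeight r i j = if j.val < a.val then 1 else 0 := by
    unfold gam
    simp only
    split_ifs with h0 h0' h1' h1'' hl hl' h
    · subst h0; simp at h0'
    · rw [sum_single_mul, fundamentalWeight_zero hr, mul_zero]
    · simp only [Pi.add_apply, Nat.cast_add, add_mul, Finset.sum_add_distrib, sum_single_mul,
        fundamentalWeight_zero hr, fundamentalWeight_one hr]
      subst h1'
      rw [h1] at h1''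
      rw [if_pos (by omega)]; norm_num
    · simp only [Pi.add_apply, Nat.cast_add, add_mul, Finset.sum_add_distrib, sum_single_mul,
        fundamentalWeight_zero hr, fundamentalWeight_one hr]
      subst h1'
      rw [h1] at h1''
      rw [if_neg (by omega)]; norm_num
    · rw [sum_single_mul, fundamentalWeight_last]; norm_num
    · subst hl; simp at hl'
    · rw [sum_single_mul, fundamentalWeight_of_ne_last hl, if_pos h]; norm_num
    · rw [sum_single_mul, fundamentalWeight_of_ne_last hl, if_neg h]; norm_num
  rw [key]
  split_ifs <;> ring

lemma shifted_spinor {r : ℕ} (hr : 3 ≤ r) (j : Fin r) :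
    shifted (spinor r) j = (r : ℝ) - j.val := by
  rw [shifted_apply]
  simp only [spinor, Pi.add_apply, Nat.cast_add, add_mul, Finset.sum_add_distrib, sum_single_mul,
    fundamentalWeight_zero hr, fundamentalWeight_last]
  ring

lemma shifted_simpleCurrent_of_ne {r k : ℕ} (hr : 3 ≤ r) (lam : PPlus r k) (j : Fin r) (hj : j.val ≠ 0) :
    shifted (simpleCurrent lam) j = shifted lam j := by
  rw [shifted_apply, shifted_apply]
  congr 1
  rw [← Equiv.sum_comp (Equiv.swap (0 : Fin (r + 1)) 1)]
  refine Finset.sum_congr rfl fun i _ => ?_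
  simp only [simpleCurrent, Equiv.swap_apply_self]
  congr 1
  have h1l := fin_one_ne_last hr
  have h0l := fin_zero_ne_last hr
  have h1 := fin_val_one hr
  by_cases h0 : i = 0
  · subst h0; rw [Equiv.swap_apply_left, fundamentalWeight_zero hr, fundamentalWeight_one hr, if_neg hj]
  by_cases h1' : i = 1
  · subst h1'; rw [Equiv.swap_apply_right, fundamentalWeight_zero hr, fundamentalWeight_one hr, if_neg hj]
  · rw [Equiv.swap_apply_of_ne_of_ne h0 h1']

/-- J is the reflection x ↦ n - x of the first coordinate of λ + ρ, with n the height; it fixes the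
other coordinates. -/
lemma shifted_simpleCurrent_zero {r k : ℕ} (hr : 3 ≤ r) (lam : PPlus r k) (j : Fin r) (hj : j.val = 0) :
    shifted (simpleCurrent lam) j = height r k - shifted lam j := by
  rw [shifted_apply, shifted_apply, height, eq_sub_iff_add_eq, hj]
  have h1l := fin_one_ne_last hr
  have h0l := fin_zero_ne_last hr
  have h1 := fin_val_one hr
  have hsum : ∑ i, ((simpleCurrent lam).1 i : ℝ) * fundamentalWeight r i j +
      ∑ i, (lam.1 i : ℝ) * fundamentalWeight r i j = k := by
    rw [← Equiv.sum_comp (Equiv.swap (0 : Fin (r + 1)) 1), ← Finset.sum_add_distrib]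
    have hk := congrArg (Nat.cast : ℕ → ℝ) lam.2
    rw [← hk]
    push_cast
    refine Finset.sum_congr rfl fun i _ => ?_
    simp only [simpleCurrent, Equiv.swap_apply_self]
    rw [← mul_add, mul_comm]
    congr 1
    by_cases h0 : i = 0
    · subst h0; simp [fundamentalWeight_zero hr, fundamentalWeight_one hr, colabel, hj]
    by_cases h1' : i = 1
    · subst h1'; simp [fundamentalWeight_zero hr, fundamentalWeight_one hr, colabel, hj]
    · rw [Equiv.swap_apply_of_ne_of_ne h0 h1']
      by_cases hl : i = Fin.last r
      · subst hl; simp [fundamentalWeight, colabel]; norm_num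
      · have : 0 < i.val := Nat.pos_of_ne_zero fun h => h0 (Fin.ext (by simpa using h))
        simp [fundamentalWeight, colabel, h0, h1', hl, hj, this]; norm_num
  push_cast
  linarith

/-! ### The Kac–Peterson matrix as a determinant of sines -/

/-- The determinant `det (sin (2π x_a y_b / n))`. -/
noncomputable def sinDet {r : ℕ} (n : ℝ) (x y : Fin r → ℝ) : ℝ :=
  (Matrix.of fun a b => Real.sin (2 * Real.pi * (x a * y b) / n)).det

lemma sinDet_comm {r : ℕ} (n : ℝ) (x y : Fin r → ℝ) : sinDet n x y = sinDet n y x := by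
  rw [sinDet, sinDet, ← Matrix.det_transpose]
  congr 1
  ext a b
  simp [mul_comm]

/-- The phase and the volume factor in front of the determinant of sines. -/
noncomputable def kpConst (r k : ℕ) : ℂ :=
  Complex.I ^ (r ^ 2) / ((Real.sqrt (4 * height r k ^ r) : ℝ) : ℂ) * (-2 * Complex.I) ^ r

/-- For each permutation the sum over the signs is a product of factors -2i sin, and the signed sum
over the permutations is then a determinant. -/
lemma kpS_eq_sinDet (r k : ℕ) (mu nu : PPlus r k) :
    kpS r k mu nu = kpConst r k * (sinDet (height r k) (shifted mu) (shifted nu) : ℂ) := by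
  unfold kpS kpConst
  rw [mul_assoc (_ / _) (_ ^ r)]
  congr 1
  have h1 : (-2 * Complex.I) ^ r * (sinDet (height r k) (shifted mu) (shifted nu) : ℂ) =
      (Matrix.of fun a b => (-2 * Complex.I) *
        ((Real.sin (2 * Real.pi * (shifted mu a * shifted nu b) / height r k) : ℝ) : ℂ)).det := by
    have := Matrix.det_mul_column (fun _ : Fin r => -2 * Complex.I)
      (Matrix.of fun a b => ((Real.sin (2 * Real.pi * (shifted mu a * shifted nu b) / height r k) : ℝ) : ℂ))
    simp only [Matrix.of_apply, Finset.prod_const, Finset.card_univ, Fintype.card_fin] at this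
    rw [this]
    congr 1
    rw [sinDet]
    exact (Complex.ofRealHom.map_det _)
  rw [h1, Matrix.det_apply']
  refine Finset.sum_congr rfl fun σ _ => ?_
  have h2 : ∀ j : Fin r, (Matrix.of fun a b => (-2 * Complex.I) *
      ((Real.sin (2 * Real.pi * (shifted mu a * shifted nu b) / height r k) : ℝ) : ℂ)) (σ j) j =
      ∑ e : ℤˣ, ((e : ℤ) : ℂ) * Complex.exp (-2 * Real.pi * Complex.I *
        ((((e : ℤ) : ℝ) * shifted mu (σ j) * shifted nu j : ℝ) : ℂ) / (height r k : ℂ)) := by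
    intro j
    rw [UnitsInt.univ, Finset.sum_pair (by decide)]
    simp only [Matrix.of_apply, Complex.ofReal_sin]
    have hs := Complex.two_sin ((2 * Real.pi * (shifted mu (σ j) * shifted nu j) / height r k : ℝ) : ℂ)
    rw [show (-2 * Complex.I) * Complex.sin ((2 * Real.pi * (shifted mu (σ j) * shifted nu j) / height r k : ℝ) : ℂ) =
      -Complex.I * (2 * Complex.sin ((2 * Real.pi * (shifted mu (σ j) * shifted nu j) / height r k : ℝ) : ℂ)) by ring, hs]
    push_cast
    have e1 : ∀ z : ℂ, -Complex.I * (z * Complex.I) = z := by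
      intro z; rw [mul_comm z, ← mul_assoc]; simp
    rw [e1]
    rw [sub_eq_add_neg, one_mul, neg_one_mul]
    congr 1
    · congr 1; ring
    · congr 2; ring
  rw [Finset.prod_congr rfl fun j _ => h2 j, Fintype.prod_sum, Finset.mul_sum]
  refine Finset.sum_congr rfl fun ε _ => ?_
  rw [Finset.prod_mul_distrib, ← Complex.exp_sum, ← mul_assoc]
  congr 1
  · push_cast; rfl
  · congr 1
    push_cast
    rw [Finset.mul_sum, Finset.sum_div]

lemma kpS_comm (r k : ℕ) (mu nu : PPlus r k) : kpS r k mu nu = kpS r k nu mu := by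
  rw [kpS_eq_sinDet, kpS_eq_sinDet, sinDet_comm]

/-- Reflecting one coordinate multiplies one row by c. With x the shifted weight this is the
symmetry of S under J, with c the sign of the monodromy charge. -/
lemma sinDet_reflect {r : ℕ} {n : ℝ} (hn : n ≠ 0) (c : ℝ) (x x' y : Fin r → ℝ) (i : Fin r)
    (hi : x' i = n - x i) (hne : ∀ j, j ≠ i → x' j = x j)
    (hy : ∀ (j : Fin r) (t : ℝ), Real.sin (2 * Real.pi * y j - t) = c * Real.sin t) :
    sinDet n x' y = c * sinDet n x y := by
  classical
  have h : (Matrix.of fun a b => Real.sin (2 * Real.pi * (x' a * y b) / n)) =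
      Matrix.updateRow (Matrix.of fun a b => Real.sin (2 * Real.pi * (x a * y b) / n)) i
        (c • (Matrix.of fun a b => Real.sin (2 * Real.pi * (x a * y b) / n)) i) := by
    ext a b
    by_cases ha : a = i
    · subst ha
      rw [Matrix.updateRow_self, Pi.smul_apply, smul_eq_mul, Matrix.of_apply, Matrix.of_apply, hi, ← hy]
      congr 1
      field_simp
    · rw [Matrix.updateRow_ne ha, Matrix.of_apply, Matrix.of_apply, hne a ha]
  rw [sinDet, h, Matrix.det_updateRow_smul, Matrix.updateRow_eq_self, sinDet]

lemma kpS_simpleCurrent {r k : ℕ} (hr : 3 ≤ r) (mu nu : PPlus r k) (c : ℝ)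
    (hy : ∀ (j : Fin r) (t : ℝ), Real.sin (2 * Real.pi * shifted nu j - t) = c * Real.sin t) :
    kpS r k (simpleCurrent mu) nu = c * kpS r k mu nu := by
  rw [kpS_eq_sinDet, kpS_eq_sinDet]
  have hn : height r k ≠ 0 := by
    have : (3 : ℝ) ≤ r := by exact_mod_cast hr
    have : (0 : ℝ) ≤ k := by positivity
    unfold height; linarith
  rw [sinDet_reflect hn c (shifted mu) _ _ ⟨0, by omega⟩
    (shifted_simpleCurrent_zero hr mu _ rfl)
    (fun j hj => shifted_simpleCurrent_of_ne hr mu j fun h => hj (Fin.ext h)) hy]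
  push_cast; ring


/-! ### The matrix S at level 2 -/

/-- A model of the set of weights of level `2`: the two simple currents, the `γ^a` with
`1 ≤ a ≤ r`, and the two spinors. -/
abbrev Wt (r : ℕ) : Type := Bool ⊕ (Fin r ⊕ Bool)

/-- The weight of level `2` with a given name. -/
noncomputable def wt (r : ℕ) : Wt r → PPlus r 2
  | .inl i => if i then simpleCurrent (gam r 0) else gam r 0
  | .inr (.inl a) => gam r a.succ
  | .inr (.inr i) => if i then simpleCurrent (spinor r) else spinor r

/-- The Kac–Peterson matrix at level `2`. -/
noncomputable def smat (r : ℕ) : Wt r → Wt r → ℝ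
  | .inl _, .inl _ => 1 / (2 * Real.sqrt (2 * r + 1))
  | .inl _, .inr (.inl _) => 1 / Real.sqrt (2 * r + 1)
  | .inr (.inl _), .inl _ => 1 / Real.sqrt (2 * r + 1)
  | .inl i, .inr (.inr _) => if i then -(1 / 2) else 1 / 2
  | .inr (.inr _), .inl i => if i then -(1 / 2) else 1 / 2
  | .inr (.inl a), .inr (.inl b) =>
      2 * Real.cos (2 * Real.pi * ((a.val + 1) * (b.val + 1)) / (2 * r + 1)) / Real.sqrt (2 * r + 1)
  | .inr (.inl _), .inr (.inr _) => 0
  | .inr (.inr _), .inr (.inl _) => 0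
  | .inr (.inr i), .inr (.inr j) => if i = j then 1 / 2 else -(1 / 2)

lemma smat_comm (r : ℕ) (x y : Wt r) : smat r x y = smat r y x := by
  rcases x with i | a | i <;> rcases y with j | b | j <;> simp [smat, mul_comm, eq_comm]

lemma height_two (r : ℕ) : height r 2 = 2 * r + 1 := by unfold height; push_cast; ring

/-- For half-integers the sine is a cosine times a sign depending on the row and a sign depending on
the column. -/
lemma sin_half_integers (r k l : ℕ) :
    Real.sin (2 * Real.pi * (((r : ℝ) + 1 / 2 - k) * ((r : ℝ) + 1 / 2 - l)) / (2 * r + 1)) =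
      ((-1) ^ r * (-1) ^ k) * ((-1) ^ l * Real.cos (2 * Real.pi * (k * l) / (2 * r + 1))) := by
  have hn : (2 * (r : ℝ) + 1) ≠ 0 := by positivity
  have e : 2 * Real.pi * (((r : ℝ) + 1 / 2 - k) * ((r : ℝ) + 1 / 2 - l)) / (2 * r + 1) =
      2 * Real.pi * (k * l) / (2 * r + 1) + Real.pi / 2 + r * Real.pi - k * Real.pi - l * Real.pi := by
    field_simp; ring
  rw [e, Real.sin_sub_nat_mul_pi, Real.sin_sub_nat_mul_pi, Real.sin_add_nat_mul_pi, Real.sin_add_pi_div_two]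
  ring

lemma prod_neg_one_succAbove (r : ℕ) (a : Fin (r + 1)) :
    ∏ i : Fin r, (-1 : ℝ) ^ (a.succAbove i).val = (-1) ^ a.val * ∏ k : Fin (r + 1), (-1 : ℝ) ^ k.val := by
  rw [Fin.prod_univ_succAbove _ a, ← mul_assoc, ← mul_pow]
  simp

/-- Without the signs the matrix of sines is the cosine matrix with row a and column b removed, so
its determinant is, up to sign, an entry of the adjugate. -/
lemma sinDet_gam_gam (r : ℕ) (x y : Fin r → ℝ) (a b : Fin (r + 1))
    (hx : ∀ j, x j = (r : ℝ) + 1 / 2 - (a.succAbove j).val)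
    (hy : ∀ j, y j = (r : ℝ) + 1 / 2 - (b.succAbove j).val) :
    sinDet (2 * r + 1) x y =
      (-1) ^ r * (cosMatrix r).det * (mult a * mult b * cosMatrix r a b) / (2 * r + 1) := by
  have h : (Matrix.of fun i j => Real.sin (2 * Real.pi * (x i * y j) / (2 * (r : ℝ) + 1))) =
      Matrix.of fun i j => ((-1 : ℝ) ^ r * (-1) ^ (a.succAbove i).val) *
        (Matrix.of fun i j => (-1 : ℝ) ^ (b.succAbove j).val *
          (cosMatrix r).submatrix a.succAbove b.succAbove i j) i j := by
    ext i j
    simp only [Matrix.of_apply, hx, hy, Matrix.submatrix_apply, cosMatrix]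
    exact sin_half_integers r _ _
  have hadj := Matrix.adjugate_fin_succ_eq_det_submatrix (cosMatrix r) b a
  rw [cosMatrix_adjugate] at hadj
  -- The signs of all rows and of all columns cancel; what remains is the sign of the omitted row
  -- and column, which is that of the cofactor.
  have hP : (∏ k : Fin (r + 1), (-1 : ℝ) ^ k.val) * ∏ k : Fin (r + 1), (-1 : ℝ) ^ k.val = 1 := by
    rw [← Finset.prod_mul_distrib]
    refine Finset.prod_eq_one fun k _ => ?_
    rw [← mul_pow]; simp
  have hr : ((-1 : ℝ) ^ r) ^ r = (-1) ^ r := by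
    rcases Nat.even_or_odd r with h | h
    · rw [h.neg_one_pow, one_pow]
    · rw [h.neg_one_pow, h.neg_one_pow]
  have hcomm : cosMatrix r b a = cosMatrix r a b := by
    simp only [cosMatrix, Matrix.of_apply]; rw [mul_comm (b.val : ℝ)]
  rw [sinDet, h, Matrix.det_mul_column, Matrix.det_mul_row, prod_neg_one_succAbove,
    Finset.prod_mul_distrib, prod_neg_one_succAbove, Finset.prod_const, Finset.card_univ,
    Fintype.card_fin, hr]
  rw [hcomm] at hadj
  calc _ = (-1 : ℝ) ^ r * ((∏ k : Fin (r + 1), (-1 : ℝ) ^ k.val) * ∏ k : Fin (r + 1), (-1 : ℝ) ^ k.val) *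
        ((-1) ^ (a.val + b.val) * ((cosMatrix r).submatrix a.succAbove b.succAbove).det) := by
        rw [pow_add]; ring
    _ = _ := by rw [hP, ← hadj]; ring

lemma sin_half_integer_integer (r k l : ℕ) :
    Real.sin (2 * Real.pi * (((r : ℝ) + 1 / 2 - k) * l) / (2 * r + 1)) =
      -(-1) ^ l * Real.sin (2 * Real.pi * (k * l) / (2 * r + 1)) := by
  have hn : (2 * (r : ℝ) + 1) ≠ 0 := by positivity
  have e : 2 * Real.pi * (((r : ℝ) + 1 / 2 - k) * l) / (2 * r + 1) =
      l * Real.pi - 2 * Real.pi * (k * l) / (2 * r + 1) := by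
    field_simp
  rw [e, Real.sin_nat_mul_pi_sub]; ring

/-- For a ≠ 0 the coordinate r + 1/2 = n/2 is present. Against the integer coordinates of the spinor
it gives sines of multiples of π, hence a zero row. -/
lemma sinDet_gam_spinor (r : ℕ) (x y : Fin r → ℝ) (a : Fin r)
    (hx : ∀ j, x j = (r : ℝ) + 1 / 2 - (a.succ.succAbove j).val)
    (hy : ∀ j, y j = (r : ℝ) - j.val) : sinDet (2 * r + 1) x y = 0 := by
  have hr : 0 < r := a.pos
  refine Matrix.det_eq_zero_of_row_eq_zero ⟨0, hr⟩ fun j => ?_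
  have h0 : (a.succ.succAbove ⟨0, hr⟩).val = 0 := by
    simp [Fin.succAbove]
  have := sin_half_integer_integer r 0 (r - j.val)
  rw [Matrix.of_apply, hx, hy, h0]
  rw [Nat.cast_sub j.is_lt.le] at this
  rw [this]; simp

/-- Reversing the order of decreasing nodes makes the Vandermonde determinant positive, so its
former sign is that of the reversal. -/
lemma sign_revPerm (m : ℕ) :
    (((Equiv.Perm.sign (Fin.revPerm (n := m)) : ℤˣ) : ℤ) : ℝ) = (-1) ^ (m * (m - 1) / 2) := by
  have h1 := vandermonde_sign (fun i : Fin m => -(i.val : ℝ)) (fun a b hab => by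
    have : (a.val : ℝ) < b.val := by exact_mod_cast hab
    simpa using this)
  have h2 : 0 < (Matrix.vandermonde (fun i : Fin m => -((Fin.revPerm i).val : ℝ))).det := by
    rw [Matrix.det_vandermonde]
    refine Finset.prod_pos fun i _ => Finset.prod_pos fun j hj => ?_
    have hij := Finset.mem_Ioi.1 hj
    have : (Fin.rev j).val < (Fin.rev i).val := by exact_mod_cast Fin.rev_lt_rev.2 hij
    have h3 : ((Fin.rev j).val : ℝ) < (Fin.rev i).val := by exact_mod_cast this
    simp only [Fin.revPerm_apply]
    linarith
  have h3 : Matrix.vandermonde (fun i : Fin m => -((Fin.revPerm i).val : ℝ)) =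
      (Matrix.vandermonde (fun i : Fin m => -(i.val : ℝ))).submatrix Fin.revPerm id := by
    ext i j; simp [Matrix.vandermonde]
  rw [h3, Matrix.det_permute] at h2
  have h4 : 0 < (((Equiv.Perm.sign (Fin.revPerm (n := m)) : ℤˣ) : ℤ) : ℝ) * (-1) ^ (m * (m - 1) / 2) := by
    have h5 := mul_pos h1 h2
    by_contra hc
    have : (0 : ℝ) < ((((Equiv.Perm.sign (Fin.revPerm (n := m)) : ℤˣ) : ℤ) : ℝ) * (-1) ^ (m * (m - 1) / 2)) *
      ((Matrix.vandermonde (fun i : Fin m => -(i.val : ℝ))).det) ^ 2 := by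
      refine lt_of_lt_of_eq h5 ?_; ring
    nlinarith [sq_nonneg (Matrix.vandermonde (fun i : Fin m => -(i.val : ℝ))).det]
  rcases Int.units_eq_one_or (Equiv.Perm.sign (Fin.revPerm (n := m))) with h | h <;>
  rcases neg_one_pow_eq_or ℝ (m * (m - 1) / 2) with h' | h' <;> rw [h, h'] at h4 ⊢ <;> norm_num at h4 <;> norm_num

lemma sinDet_zero_spinor (r : ℕ) (x y : Fin r → ℝ)
    (hx : ∀ j, x j = (r : ℝ) + 1 / 2 - (j.val + 1))
    (hy : ∀ j, y j = (r : ℝ) - j.val) :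
    sinDet (2 * r + 1) x y = (-1) ^ (r + (r + 1) * r / 2) * Real.sqrt (((2 * r + 1) / 4) ^ r) := by
  have h : (Matrix.of fun i j => Real.sin (2 * Real.pi * (x i * y j) / (2 * (r : ℝ) + 1))) =
      Matrix.of fun i j => (fun j : Fin r => -(-1 : ℝ) ^ (r - j.val)) j *
          (sinMatrix r).submatrix id Fin.revPerm i j := by
    ext i j
    have := sin_half_integer_integer r (i.val + 1) (r - j.val)
    have hj : (((Fin.rev j).val : ℕ) : ℝ) + 1 = (r : ℝ) - j.val := by
      rw [Fin.val_rev, Nat.cast_sub (by omega)]; push_cast; ring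
    rw [Nat.cast_sub j.is_lt.le] at this
    push_cast at this
    simp only [Matrix.of_apply, hx, hy, Matrix.submatrix_apply, sinMatrix, id, Fin.revPerm_apply, hj]
    exact this
  have hprod : ∏ j : Fin r, (-(-1 : ℝ) ^ (r - j.val)) = (-1) ^ (r + (r + 1) * r / 2) := by
    -- In this form the exponents sum to r(r - 1)/2 + 2r = r + r(r + 1)/2.
    have : ∀ j : Fin r, (-(-1 : ℝ) ^ (r - j.val)) = (-1) ^ (r - 1 - j.val + 2) := by
      intro j
      rw [show r - 1 - j.val + 2 = (r - j.val) + 1 by omega, pow_succ]; ring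
    simp_rw [this]
    rw [Finset.prod_pow_eq_pow_sum, Finset.sum_add_distrib,
      Fin.sum_univ_eq_sum_range (fun k => r - 1 - k), Finset.sum_range_reflect (fun k => k),
      Finset.sum_const, Finset.card_univ, Fintype.card_fin]
    congr 1
    have := Finset.sum_range_id_mul_two r
    have h2 := Finset.sum_range_id_mul_two (r + 1)
    rw [Finset.sum_range_succ] at h2
    simp only [Nat.add_sub_cancel, smul_eq_mul] at h2 ⊢
    omega
  have hss : ((-1 : ℝ) ^ (r * (r - 1) / 2)) * (-1) ^ (r * (r - 1) / 2) = 1 := by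
    rw [← mul_pow]; simp
  rw [sinDet, h, Matrix.det_mul_row, hprod, Matrix.det_permute', sign_revPerm, sinMatrix_det]
  linear_combination ((-1 : ℝ) ^ (r + (r + 1) * r / 2) * Real.sqrt (((2 * r + 1) / 4) ^ r)) * hss

/-- The coordinates are r, …, 1, so rows and columns of the sine matrix are both reversed and the
two signs cancel. -/
lemma sinDet_spinor_spinor (r : ℕ) (x : Fin r → ℝ) (hx : ∀ j, x j = (r : ℝ) - j.val) :
    sinDet (2 * r + 1) x x = (-1) ^ (r * (r - 1) / 2) * Real.sqrt (((2 * r + 1) / 4) ^ r) := by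
  have h : (Matrix.of fun i j => Real.sin (2 * Real.pi * (x i * x j) / (2 * (r : ℝ) + 1))) =
      (sinMatrix r).submatrix Fin.revPerm Fin.revPerm := by
    ext i j
    have hj : ∀ j : Fin r, (((Fin.rev j).val : ℕ) : ℝ) + 1 = (r : ℝ) - j.val := by
      intro j
      rw [Fin.val_rev, Nat.cast_sub (by omega)]; push_cast; ring
    simp only [Matrix.of_apply, hx, Matrix.submatrix_apply, sinMatrix, Fin.revPerm_apply, hj]
  rw [sinDet, h, Matrix.det_submatrix_equiv_self, sinMatrix_det]

/-- The powers of i combine, by i^(r² + r) = (-1)^(r(r + 1)/2), so the constant is real. Its sign is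
the one that cancels against the determinants and makes the vacuum row of S positive. -/
lemma kpConst_two (r : ℕ) : kpConst r 2 =
    (((-1) ^ (r + (r + 1) * r / 2) * 2 ^ r / (2 * Real.sqrt ((2 * r + 1) ^ r)) : ℝ) : ℂ) := by
  have h4 : Real.sqrt (4 * (2 * r + 1) ^ r) = 2 * Real.sqrt ((2 * r + 1) ^ r) := by
    rw [Real.sqrt_mul (by norm_num), show (4 : ℝ) = 2 ^ 2 by norm_num, Real.sqrt_sq (by norm_num)]
  have hI : Complex.I ^ (r ^ 2) * Complex.I ^ r = (-1) ^ ((r + 1) * r / 2) := by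
    rw [← pow_add, ← Complex.I_sq, ← pow_mul]
    congr 1
    have := Nat.div_mul_cancel (Nat.even_mul_succ_self r).two_dvd
    rw [mul_comm r] at this
    rw [mul_comm 2, this]; ring
  unfold kpConst
  rw [height_two, h4, neg_mul, neg_pow, mul_pow]
  push_cast
  rw [pow_add, ← hI]; ring

lemma kpS_gam_gam {r : ℕ} (hr : 3 ≤ r) (a b : Fin (r + 1)) : kpS r 2 (gam r a) (gam r b) =
    ((mult a * mult b * cosMatrix r a b / (2 * Real.sqrt (2 * r + 1)) : ℝ) : ℂ) := by
  rw [kpS_eq_sinDet, height_two, sinDet_gam_gam r _ _ a b (shifted_gam hr a) (shifted_gam hr b),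
    kpConst_two, ← Complex.ofReal_mul]
  congr 1
  have hn : (0 : ℝ) < 2 * r + 1 := by positivity
  have hs : Real.sqrt ((2 * (r : ℝ) + 1) ^ (r + 1) / 4 ^ r) =
      Real.sqrt ((2 * r + 1) ^ r) * Real.sqrt (2 * r + 1) / 2 ^ r := by
    rw [Real.sqrt_div (by positivity), pow_succ, Real.sqrt_mul (by positivity),
      show (4 : ℝ) ^ r = (2 ^ r) ^ 2 by rw [← pow_mul, mul_comm, pow_mul]; norm_num,
      Real.sqrt_sq (by positivity)]
  have hsq : Real.sqrt (2 * (r : ℝ) + 1) ^ 2 = 2 * r + 1 := Real.sq_sqrt hn.le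
  have hpos : 0 < Real.sqrt (2 * (r : ℝ) + 1) := Real.sqrt_pos.2 hn
  have hpos' : 0 < Real.sqrt ((2 * (r : ℝ) + 1) ^ r) := Real.sqrt_pos.2 (by positivity)
  have e1 : ((-1 : ℝ) ^ r) * (-1) ^ r = 1 := by rw [← mul_pow]; simp
  have e2 : ((-1 : ℝ) ^ ((r + 1) * r / 2)) * (-1) ^ ((r + 1) * r / 2) = 1 := by rw [← mul_pow]; simp
  rw [cosMatrix_det, hs, pow_add]
  set p := (-1 : ℝ) ^ r
  set q := (-1 : ℝ) ^ ((r + 1) * r / 2)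
  set s := Real.sqrt (2 * (r : ℝ) + 1)
  set u := Real.sqrt ((2 * (r : ℝ) + 1) ^ r)
  rw [← hsq]
  have : p * q * 2 ^ r / (2 * u) * (p * (q * (u * s / 2 ^ r)) * (mult a * mult b * cosMatrix r a b) / s ^ 2)
     = (p * p) * (q * q) * (mult a * mult b * cosMatrix r a b / (2 * s)) := by
    field_simp
  rw [this, e1, e2]; ring

lemma kpS_gam_spinor {r : ℕ} (hr : 3 ≤ r) (a : Fin r) : kpS r 2 (gam r a.succ) (spinor r) = 0 := by
  rw [kpS_eq_sinDet, height_two, sinDet_gam_spinor r _ _ a (shifted_gam hr _) (shifted_spinor hr)]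
  simp

lemma sqrt_quarter_pow (r : ℕ) : Real.sqrt (((2 * (r : ℝ) + 1) / 4) ^ r) = Real.sqrt ((2 * r + 1) ^ r) / 2 ^ r := by
  rw [div_pow, Real.sqrt_div (by positivity),
    show (4 : ℝ) ^ r = (2 ^ r) ^ 2 by rw [← pow_mul, mul_comm, pow_mul]; norm_num,
    Real.sqrt_sq (by positivity)]

lemma kpS_zero_spinor {r : ℕ} (hr : 3 ≤ r) : kpS r 2 (gam r 0) (spinor r) = ((1 / 2 : ℝ) : ℂ) := by
  rw [kpS_eq_sinDet, height_two, sinDet_zero_spinor r _ _ (fun j => by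
    rw [shifted_gam hr]; simp) (shifted_spinor hr), kpConst_two, ← Complex.ofReal_mul]
  congr 1
  rw [sqrt_quarter_pow]
  have hpos' : 0 < Real.sqrt ((2 * (r : ℝ) + 1) ^ r) := Real.sqrt_pos.2 (by positivity)
  have e2 : ((-1 : ℝ) ^ (r + (r + 1) * r / 2)) * (-1) ^ (r + (r + 1) * r / 2) = 1 := by
    rw [← mul_pow]; simp
  set q := (-1 : ℝ) ^ (r + (r + 1) * r / 2)
  set u := Real.sqrt ((2 * (r : ℝ) + 1) ^ r)
  have : q * 2 ^ r / (2 * u) * (q * (u / 2 ^ r)) = (q * q) * (1 / 2) := by field_simp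
  rw [this, e2, one_mul]

lemma kpS_spinor_spinor {r : ℕ} (hr : 3 ≤ r) : kpS r 2 (spinor r) (spinor r) = ((1 / 2 : ℝ) : ℂ) := by
  rw [kpS_eq_sinDet, height_two, sinDet_spinor_spinor r _ (shifted_spinor hr), kpConst_two,
    ← Complex.ofReal_mul]
  congr 1
  rw [sqrt_quarter_pow]
  have hpos' : 0 < Real.sqrt ((2 * (r : ℝ) + 1) ^ r) := Real.sqrt_pos.2 (by positivity)
  have e2 : ((-1 : ℝ) ^ (r + (r + 1) * r / 2)) * (-1) ^ (r * (r - 1) / 2) = 1 := by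
    rw [← pow_add]
    refine Even.neg_one_pow ?_
    have h1 := Finset.sum_range_id_mul_two r
    have h2 := Finset.sum_range_id_mul_two (r + 1)
    rw [Finset.sum_range_succ] at h2
    simp only [Nat.add_sub_cancel] at h2
    -- Half of the exponent, since r(r + 1)/2 = r + r(r - 1)/2.
    exact ⟨r + r * (r - 1) / 2, by omega⟩
  set q := (-1 : ℝ) ^ (r + (r + 1) * r / 2)
  set q' := (-1 : ℝ) ^ (r * (r - 1) / 2)
  set u := Real.sqrt ((2 * (r : ℝ) + 1) ^ r)
  have : q * 2 ^ r / (2 * u) * (q' * (u / 2 ^ r)) = (q * q') * (1 / 2) := by field_simp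
  rw [this, e2, one_mul]

/-- The sign `exp (2πi Q_J)` of the monodromy charge. -/
def chargeSign {r : ℕ} : Wt r → ℝ
  | .inr (.inr _) => -1
  | _ => 1

/-- The coordinates of `ν + ρ` are half-integers (`c = 1`) or integers (`c = -1`). -/
def HasCharge {r k : ℕ} (nu : PPlus r k) (c : ℝ) : Prop :=
  ∀ (j : Fin r) (t : ℝ), Real.sin (2 * Real.pi * shifted nu j - t) = c * Real.sin t

lemma hasCharge_gam {r : ℕ} (hr : 3 ≤ r) (b : Fin (r + 1)) : HasCharge (gam r b) 1 := by
  intro j t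
  rw [shifted_gam hr, show 2 * Real.pi * ((r : ℝ) + 1 / 2 - (b.succAbove j).val) - t =
      (Real.pi - t) + r * (2 * Real.pi) - (b.succAbove j).val * (2 * Real.pi) by ring,
      Real.sin_sub_nat_mul_two_pi, Real.sin_add_nat_mul_two_pi, Real.sin_pi_sub, one_mul]

lemma hasCharge_spinor {r : ℕ} (hr : 3 ≤ r) : HasCharge (spinor r) (-1) := by
  intro j t
  rw [shifted_spinor hr, show 2 * Real.pi * ((r : ℝ) - j.val) - t =
      (-t) + r * (2 * Real.pi) - j.val * (2 * Real.pi) by ring,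
      Real.sin_sub_nat_mul_two_pi, Real.sin_add_nat_mul_two_pi, Real.sin_neg, neg_one_mul]

lemma HasCharge.simpleCurrent {r : ℕ} (hr : 3 ≤ r) {nu : PPlus r 2} {c : ℝ} (h : HasCharge nu c) :
    HasCharge (simpleCurrent nu) c := by
  intro j t
  by_cases hj : j.val = 0
  · rw [shifted_simpleCurrent_zero hr nu j hj, height_two,
      show 2 * Real.pi * (2 * r + 1 - shifted nu j) - t =
        -(2 * Real.pi * shifted nu j - -t) + (2 * r + 1 : ℕ) * (2 * Real.pi) by push_cast; ring,
      Real.sin_add_nat_mul_two_pi, Real.sin_neg, h j, Real.sin_neg]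
    ring
  · rw [shifted_simpleCurrent_of_ne hr nu j hj, h j]

lemma hasCharge_wt {r : ℕ} (hr : 3 ≤ r) (y : Wt r) : HasCharge (wt r y) (chargeSign y) := by
  rcases y with (_ | _) | a | (_ | _)
  · exact hasCharge_gam hr 0
  · exact (hasCharge_gam hr 0).simpleCurrent hr
  · exact hasCharge_gam hr a.succ
  · exact hasCharge_spinor hr
  · exact (hasCharge_spinor hr).simpleCurrent hr

theorem kpS_wt {r : ℕ} (hr : 3 ≤ r) (x y : Wt r) : kpS r 2 (wt r x) (wt r y) = (smat r x y : ℂ) := by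
  have hJ : ∀ mu (y : Wt r), kpS r 2 (simpleCurrent mu) (wt r y) = chargeSign y * kpS r 2 mu (wt r y) :=
    fun mu y => kpS_simpleCurrent hr mu _ _ (hasCharge_wt hr y)
  -- reduction to the weights without a simple current
  have main : ∀ (x : Wt r), kpS r 2 (gam r 0) (wt r x) = (smat r (.inl false) x : ℂ) ∧
      kpS r 2 (spinor r) (wt r x) = (smat r (.inr (.inr false)) x : ℂ) ∧
      ∀ a : Fin r, kpS r 2 (gam r a.succ) (wt r x) = (smat r (.inr (.inl a)) x : ℂ) := by
    have h00 := kpS_gam_gam hr 0 0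
    have h0s := kpS_zero_spinor hr
    have hss := kpS_spinor_spinor hr
    have hs0 := h0s
    rw [kpS_comm] at hs0
    have hg := kpS_gam_gam hr
    have hgs := kpS_gam_spinor hr
    have hsg : ∀ a : Fin r, kpS r 2 (spinor r) (gam r a.succ) = 0 := fun a => by
      rw [kpS_comm]; exact hgs a
    have hJ' : ∀ mu (y : Wt r), kpS r 2 (wt r y) (simpleCurrent mu) = chargeSign y * kpS r 2 (wt r y) mu :=
      fun mu y => by rw [kpS_comm, hJ, kpS_comm]
    have j0 := fun mu => hJ' mu (.inl false)
    have js := fun mu => hJ' mu (.inr (.inr false))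
    have jg := fun mu (a : Fin r) => hJ' mu (.inr (.inl a))
    simp only [wt, chargeSign, Bool.false_eq_true, if_false] at j0 js jg
    intro x
    rcases x with (_ | _) | a | (_ | _)
    all_goals
      simp only [wt, Bool.false_eq_true, if_false, if_true, j0, js, jg, hg, h0s, hss, hs0, hgs, hsg, smat,
        mult, Fin.succ_ne_zero, cosMatrix, Matrix.of_apply, Fin.val_succ, Fin.val_zero]
      refine ⟨?_, ?_, fun b => ?_⟩ <;> push_cast <;> (try simp) <;> (try ring)
  rcases x with (_ | _) | a | (_ | _)
  · exact (main y).1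
  · have := hJ (gam r 0) y
    rw [(main y).1] at this
    refine this.trans ?_
    rw [← Complex.ofReal_mul]
    rcases y with (_ | _) | a | (_ | _) <;> simp [smat, chargeSign]
  · exact (main y).2.2 a
  · exact (main y).2.1
  · have := hJ (spinor r) y
    rw [(main y).2.1] at this
    refine this.trans ?_
    rw [← Complex.ofReal_mul]
    rcases y with (_ | _) | a | (_ | _) <;> simp [smat, chargeSign]

/-! ### The weights of level two -/

lemma gam_label_zero_one {r : ℕ} (hr : 3 ≤ r) (a : Fin r) :
    (gam r a.succ).1 0 = (gam r a.succ).1 1 := by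
  have h1l := fin_one_ne_last hr
  have h0l := fin_zero_ne_last hr
  have h01 : (0 : Fin (r + 1)) ≠ 1 := fun h => by
    have := congrArg Fin.val h; rw [fin_val_one hr] at this; simp at this
  unfold gam
  simp only [Fin.succ_ne_zero, if_false]
  split_ifs with h1 h2
  · simp [h01, h01.symm]
  · simp [h0l, h1l]
  · simp [Ne.symm h1, (Fin.succ_ne_zero a).symm]

lemma wt_injective {r : ℕ} (hr : 3 ≤ r) : Function.Injective (wt r) := by
  have h1l := fin_one_ne_last hr
  have h0l := fin_zero_ne_last hr
  have h01 : (0 : Fin (r + 1)) ≠ 1 := fun h => by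
    have := congrArg Fin.val h; rw [fin_val_one hr] at this; simp at this
  have hr0 : r ≠ 0 := by omega
  -- λ₀ - λ₁ separates 0, J0, the spinors and the γ^a with a ≥ 1; the latter are told apart by the
  -- omitted coordinate of the shifted weight.
  let δ : PPlus r 2 → ℤ := fun lam => (lam.1 0 : ℤ) - lam.1 1
  have hd : ∀ x, δ (wt r x) = match x with
      | .inl i => if i then -2 else 2
      | .inr (.inl _) => 0
      | .inr (.inr i) => if i then -1 else 1 := by
    intro x
    rcases x with (_ | _) | a | (_ | _)
    · simp [δ, wt, gam, h01.symm]
    · simp [δ, wt, gam, simpleCurrent, Pi.single_apply, h01.symm]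
    · simp only [δ, wt]; rw [gam_label_zero_one hr]; simp
    · simp [δ, wt, spinor, h01.symm, h0l, h1l]
    · simp [δ, wt, spinor, simpleCurrent, Pi.single_apply, h01.symm, h0l, h1l]
  have hgam : Function.Injective (gam r) := by
    intro a b hab
    apply Fin.succAbove_left_injective
    funext j
    have h1 := shifted_gam hr a j
    have h2 := shifted_gam hr b j
    rw [hab, h2] at h1
    apply Fin.ext
    have : ((b.succAbove j).val : ℝ) = (a.succAbove j).val := by linarith
    exact_mod_cast this.symm
  intro x y hxy
  have h := congrArg δ hxy
  rw [hd, hd] at h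
  rcases x with (_ | _) | a | (_ | _) <;> rcases y with (_ | _) | b | (_ | _) <;>
    first
    | rfl
    | (rw [Fin.succ_injective _ (hgam hxy)])
    | (exact absurd h (by norm_num))

/-- A nonzero label strictly between 1 and r has colabel 2 and uses up the whole level. Otherwise λ₀
+ λ₁ + λ_r = 2, which has six solutions. -/
lemma wt_surjective {r : ℕ} (hr : 3 ≤ r) : Function.Surjective (wt r) := by
  have h1l := fin_one_ne_last hr
  have h0l := fin_zero_ne_last hr
  have h01 : (0 : Fin (r + 1)) ≠ 1 := fun h => by
    have := congrArg Fin.val h; rw [fin_val_one hr] at this; simp at this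
  intro lam
  by_cases hmid : ∃ i, i ≠ 0 ∧ i ≠ 1 ∧ i ≠ Fin.last r ∧ lam.1 i ≠ 0
  · obtain ⟨i, hi0, hi1, hil, hi⟩ := hmid
    have hsum := lam.2
    rw [← Finset.add_sum_erase _ _ (Finset.mem_univ i)] at hsum
    have hc : colabel r i = 2 := by simp [colabel, hi0, hi1, hil]
    rw [hc] at hsum
    have hz : ∑ j ∈ Finset.univ.erase i, colabel r j * lam.1 j = 0 := by omega
    have hli : lam.1 i = 1 := by omega
    have hzero : ∀ j, j ≠ i → lam.1 j = 0 := by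
      intro j hj
      have := (Finset.sum_eq_zero_iff.1 hz) j (Finset.mem_erase.2 ⟨hj, Finset.mem_univ _⟩)
      rcases Nat.mul_eq_zero.1 this with h | h
      · exact absurd h (colabel_pos r j).ne'
      · exact h
    refine ⟨.inr (.inl (i.pred hi0)), ?_⟩
    apply Subtype.ext
    funext j
    simp only [wt, gam, Fin.succ_pred, hi0, hi1, hil, if_false]
    by_cases hj : j = i
    · subst hj; simp [hli]
    · simp [hj, hzero j hj]
  · push Not at hmid
    have hsum : lam.1 0 + lam.1 1 + lam.1 (Fin.last r) = 2 := by
      have h := lam.2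
      rw [← Finset.add_sum_erase _ _ (Finset.mem_univ (0 : Fin (r + 1))),
        ← Finset.add_sum_erase _ _ (Finset.mem_erase.2 ⟨h01.symm, Finset.mem_univ (1 : Fin (r + 1))⟩),
        ← Finset.add_sum_erase _ _ (Finset.mem_erase.2 ⟨h1l.symm, Finset.mem_erase.2 ⟨h0l.symm, Finset.mem_univ (Fin.last r)⟩⟩),
        Finset.sum_eq_zero] at h
      · simp [colabel] at h; omega
      · intro j hj
        simp only [Finset.mem_erase, Finset.mem_univ, and_true] at hj
        rw [hmid j hj.2.2 hj.2.1 hj.1, mul_zero]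
    have ext' : ∀ mu : PPlus r 2, mu.1 0 = lam.1 0 → mu.1 1 = lam.1 1 →
        mu.1 (Fin.last r) = lam.1 (Fin.last r) → (∀ j, j ≠ 0 → j ≠ 1 → j ≠ Fin.last r → mu.1 j = 0) →
        mu = lam := by
      intro mu m0 m1 ml mz
      apply Subtype.ext
      funext j
      by_cases j0 : j = 0
      · rw [j0, m0]
      by_cases j1 : j = 1
      · rw [j1, m1]
      by_cases jl : j = Fin.last r
      · rw [jl, ml]
      rw [mz j j0 j1 jl, hmid j j0 j1 jl]
    have e1 : (Fin.succ (⟨0, by omega⟩ : Fin r)) = (1 : Fin (r + 1)) := Fin.ext (by rw [fin_val_one hr]; rfl)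
    have el : (Fin.succ (⟨r - 1, by omega⟩ : Fin r)) = Fin.last r := Fin.ext (by simp; omega)
    have hz : ∀ j : Fin (r + 1), j ≠ 0 → j ≠ 1 → Equiv.swap 0 1 j = j :=
      fun j h0 h1 => Equiv.swap_apply_of_ne_of_ne h0 h1
    have hsl : Equiv.swap 0 1 (Fin.last r) = Fin.last r := hz _ h0l.symm h1l.symm
    have hcases : (lam.1 0 = 2 ∧ lam.1 1 = 0 ∧ lam.1 (Fin.last r) = 0) ∨
      (lam.1 0 = 0 ∧ lam.1 1 = 2 ∧ lam.1 (Fin.last r) = 0) ∨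
      (lam.1 0 = 0 ∧ lam.1 1 = 0 ∧ lam.1 (Fin.last r) = 2) ∨
      (lam.1 0 = 1 ∧ lam.1 1 = 1 ∧ lam.1 (Fin.last r) = 0) ∨
      (lam.1 0 = 1 ∧ lam.1 1 = 0 ∧ lam.1 (Fin.last r) = 1) ∨
      (lam.1 0 = 0 ∧ lam.1 1 = 1 ∧ lam.1 (Fin.last r) = 1) := by omega
    rcases hcases with ⟨c0, c1, cl⟩ | ⟨c0, c1, cl⟩ | ⟨c0, c1, cl⟩ | ⟨c0, c1, cl⟩ | ⟨c0, c1, cl⟩ | ⟨c0, c1, cl⟩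
    · refine ⟨.inl false, ext' _ ?_ ?_ ?_ ?_⟩
      · simp [wt, gam, c0]
      · simp [wt, gam, c1, h01.symm]
      · simp [wt, gam, cl, h0l.symm]
      · intro j j0 j1 jl; simp [wt, gam, j0]
    · refine ⟨.inl true, ext' _ ?_ ?_ ?_ ?_⟩
      · simp [wt, gam, simpleCurrent, c0, h01.symm]
      · simp [wt, gam, simpleCurrent, c1]
      · simp only [wt, gam, simpleCurrent, hsl, if_true]; simp [cl, h0l.symm]
      · intro j j0 j1 jl; simp only [wt, gam, simpleCurrent, hz j j0 j1, if_true]; simp [j0]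
    · refine ⟨.inr (.inl ⟨r - 1, by omega⟩), ext' _ ?_ ?_ ?_ ?_⟩
      all_goals simp only [wt, gam, el, h0l.symm, h1l.symm, if_false, if_true]
      · simp [h0l, c0]
      · simp [h1l, c1]
      · simp [cl]
      · intro j j0 j1 jl; simp [jl]
    · refine ⟨.inr (.inl ⟨0, by omega⟩), ext' _ ?_ ?_ ?_ ?_⟩
      all_goals simp only [wt, gam, e1, h01.symm, if_false, if_true, Pi.add_apply]
      · simp [h01, c0]
      · simp [h01.symm, c1]
      · simp [cl, h0l.symm, h1l.symm]
      · intro j j0 j1 jl; simp [j0, j1]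
    · refine ⟨.inr (.inr false), ext' _ ?_ ?_ ?_ ?_⟩
      all_goals simp only [wt, spinor, Bool.false_eq_true, if_false, Pi.add_apply]
      · simp [h0l, c0]
      · simp [h01.symm, h1l, c1]
      · simp [cl, h0l.symm]
      · intro j j0 j1 jl; simp [j0, jl]
    · refine ⟨.inr (.inr true), ext' _ ?_ ?_ ?_ ?_⟩
      all_goals simp only [wt, spinor, simpleCurrent, if_true, Pi.add_apply]
      · simp [h01.symm, h1l, c0]
      · simp [h0l, c1]
      · rw [hsl]; simp [cl, h0l.symm]
      · intro j j0 j1 jl; rw [hz j j0 j1]; simp [j0, jl]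

/-- The weights of level `2`. -/
noncomputable def wtEquiv {r : ℕ} (hr : 3 ≤ r) : Wt r ≃ PPlus r 2 :=
  Equiv.ofBijective (wt r) ⟨wt_injective hr, wt_surjective hr⟩

lemma sum_weights {r : ℕ} (hr : 3 ≤ r) {A : Type*} [AddCommMonoid A] (f : PPlus r 2 → A) :
    ∑ mu, f mu = ∑ x : Wt r, f (wt r x) :=
  (Equiv.sum_comp (wtEquiv hr) f).symm

lemma matrix_eq_iff {r : ℕ} (hr : 3 ≤ r) (A B : Matrix (PPlus r 2) (PPlus r 2) ℂ) :
    A = B ↔ ∀ x y, A (wt r x) (wt r y) = B (wt r x) (wt r y) := by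
  refine ⟨fun h x y => by rw [h], fun h => ?_⟩
  ext mu nu
  obtain ⟨x, rfl⟩ := wt_surjective hr mu
  obtain ⟨y, rfl⟩ := wt_surjective hr nu
  exact h x y

lemma vacuum_eq (r : ℕ) : vacuum r 2 = wt r (.inl false) := by
  simp [wt, gam, vacuum]

/-! ### Conformal weights -/

/-- The conformal weights at level `2`. -/
noncomputable def confWt {r : ℕ} : Wt r → ℝ
  | .inl i => if i then 1 else 0
  | .inr (.inl a) => (a.val + 1) * (2 * r + 1 - (a.val + 1)) / (2 * (2 * r + 1))
  | .inr (.inr i) => (r : ℝ) / 8 + if i then 1 / 2 else 0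

lemma norm_simpleCurrent {r : ℕ} (hr : 3 ≤ r) (mu : PPlus r 2) :
    (∑ j, shifted (simpleCurrent mu) j ^ 2) / (2 * (2 * r + 1)) =
      (∑ j, shifted mu j ^ 2) / (2 * (2 * r + 1)) + ((2 * r + 1) / 2 - shifted mu ⟨0, by omega⟩) := by
  have hn : (2 * (r : ℝ) + 1) ≠ 0 := by positivity
  have h : ∑ j, shifted (simpleCurrent mu) j ^ 2 - ∑ j, shifted mu j ^ 2 =
      (2 * r + 1) ^ 2 - 2 * (2 * r + 1) * shifted mu ⟨0, by omega⟩ := by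
    rw [← Finset.sum_sub_distrib, Finset.sum_eq_single (⟨0, by omega⟩ : Fin r)]
    · rw [shifted_simpleCurrent_zero hr mu _ rfl, height_two]; ring
    · intro j _ hj
      rw [shifted_simpleCurrent_of_ne hr mu j fun h => hj (Fin.ext h), sub_self]
    · intro h; exact absurd (Finset.mem_univ _) h
  have h' := sub_eq_iff_eq_add.1 h
  rw [h']
  field_simp; ring

/-- The sum of squares is that over all of 1/2, …, r + 1/2, minus the square of the omitted
coordinate. -/
lemma norm_gam {r : ℕ} (hr : 3 ≤ r) (a : Fin (r + 1)) :
    (∑ j, shifted (gam r a) j ^ 2) / (2 * (2 * r + 1)) =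
      (∑ j, shifted (gam r 0) j ^ 2) / (2 * (2 * r + 1)) + a.val * (2 * r + 1 - a.val) / (2 * (2 * r + 1)) := by
  have key : ∀ a : Fin (r + 1), ∑ j, shifted (gam r a) j ^ 2 =
      ∑ k : Fin (r + 1), ((r : ℝ) + 1 / 2 - k.val) ^ 2 - ((r : ℝ) + 1 / 2 - a.val) ^ 2 := by
    intro a
    rw [Fin.sum_univ_succAbove _ a, add_sub_cancel_left]
    exact Finset.sum_congr rfl fun j _ => by rw [shifted_gam hr]
  rw [key, key 0, Fin.val_zero, ← add_div]
  congr 1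
  push_cast; ring

lemma norm_spinor {r : ℕ} (hr : 3 ≤ r) :
    (∑ j, shifted (spinor r) j ^ 2) / (2 * (2 * r + 1)) =
      (∑ j, shifted (gam r 0) j ^ 2) / (2 * (2 * r + 1)) + (r : ℝ) / 8 := by
  have hn : (2 * (r : ℝ) + 1) ≠ 0 := by positivity
  have h : ∑ j, shifted (spinor r) j ^ 2 - ∑ j, shifted (gam r 0) j ^ 2 = r * (2 * r + 1) / 4 := by
    rw [← Finset.sum_sub_distrib]
    have e : ∀ j : Fin r, shifted (spinor r) j ^ 2 - shifted (gam r 0) j ^ 2 = (r : ℝ) - 1 / 4 - (j.val : ℝ) := by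
      intro j
      rw [shifted_spinor hr, shifted_gam hr]
      simp only [Fin.succAbove_zero, Fin.val_succ]
      push_cast; ring
    rw [Finset.sum_congr rfl fun j _ => e j, Finset.sum_sub_distrib,
      Fin.sum_univ_eq_sum_range (fun k => (k : ℝ))]
    have h2 := congrArg (Nat.cast : ℕ → ℝ) (Finset.sum_range_id_mul_two r)
    push_cast [Nat.cast_sub (show 1 ≤ r by omega)] at h2
    simp only [Finset.sum_const, Finset.card_univ, Fintype.card_fin, nsmul_eq_mul]
    linarith
  rw [sub_eq_iff_eq_add.1 h]
  field_simp; ring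

lemma norm_wt {r : ℕ} (hr : 3 ≤ r) (x : Wt r) :
    (∑ j, shifted (wt r x) j ^ 2) / (2 * (2 * r + 1)) =
      (∑ j, shifted (gam r 0) j ^ 2) / (2 * (2 * r + 1)) + confWt x := by
  rcases x with (_ | _) | a | (_ | _)
  · simp [wt, confWt]
  · simp only [wt, confWt, if_true]
    rw [norm_simpleCurrent hr, shifted_gam hr]; simp; ring
  · simp only [wt, confWt]
    rw [norm_gam hr]; simp
  · simp only [wt, confWt, Bool.false_eq_true, if_false]
    rw [norm_spinor hr, add_zero]
  · simp only [wt, confWt, if_true]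
    rw [norm_simpleCurrent hr, norm_spinor hr, shifted_spinor hr]; simp; ring

/-- The diagonal entry of `T`. -/
noncomputable def tval (r : ℕ) (mu : PPlus r 2) : ℂ :=
  Complex.exp (2 * Real.pi * Complex.I *
      (((∑ j, shifted mu j ^ 2) / (2 * height r 2)
        - (∑ j, weylVector r j ^ 2) / (2 * (2 * r - 1)) : ℝ) : ℂ))

lemma tval_eq_iff {r : ℕ} (hr : 3 ≤ r) (x y : Wt r) :
    tval r (wt r x) = tval r (wt r y) ↔ ∃ m : ℤ, confWt x = confWt y + m := by
  unfold tval
  rw [Complex.exp_eq_exp_iff_exists_int, height_two, norm_wt hr, norm_wt hr y]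
  refine exists_congr fun m => ?_
  have hpi : (2 * Real.pi * Complex.I : ℂ) ≠ 0 := by
    simp [Real.pi_ne_zero]
  constructor
  · intro h
    rw [mul_comm (m : ℂ), ← mul_add] at h
    have h2 := mul_left_cancel₀ hpi h
    have h3 : (((∑ j, shifted (gam r 0) j ^ 2) / (2 * (2 * r + 1)) + confWt x - (∑ j, weylVector r j ^ 2) / (2 * (2 * r - 1)) : ℝ)) =
      (((∑ j, shifted (gam r 0) j ^ 2) / (2 * (2 * r + 1)) + confWt y - (∑ j, weylVector r j ^ 2) / (2 * (2 * r - 1)) : ℝ)) + m := by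
      exact_mod_cast h2
    linarith
  · intro h
    rw [h]; push_cast; ring

lemma comm_kpT_iff {r : ℕ} (hr : 3 ≤ r) (M : Matrix (PPlus r 2) (PPlus r 2) ℂ) :
    M * kpT r 2 = kpT r 2 * M ↔
      ∀ x y : Wt r, M (wt r x) (wt r y) ≠ 0 → ∃ m : ℤ, confWt x = confWt y + m := by
  have hT : kpT r 2 = Matrix.diagonal (tval r) := rfl
  rw [hT, matrix_eq_iff hr]
  refine forall_congr' fun x => forall_congr' fun y => ?_
  rw [Matrix.mul_diagonal, Matrix.diagonal_mul, ← tval_eq_iff hr, mul_comm]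
  constructor
  · intro h h0
    exact (mul_right_cancel₀ h0 h).symm
  · intro h
    by_cases h0 : M (wt r x) (wt r y) = 0
    · rw [h0]; simp
    · rw [h h0]

lemma comm_kpS_iff {r : ℕ} (hr : 3 ≤ r) (M : Matrix (PPlus r 2) (PPlus r 2) ℂ) (m : Wt r → Wt r → ℝ)
    (h : ∀ x y, M (wt r x) (wt r y) = (m x y : ℂ)) :
    M * kpS r 2 = kpS r 2 * M ↔
      ∀ x y, ∑ z, m x z * smat r z y = ∑ z, smat r x z * m z y := by
  rw [matrix_eq_iff hr]
  refine forall_congr' fun x => forall_congr' fun y => ?_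
  rw [Matrix.mul_apply, Matrix.mul_apply, sum_weights hr, sum_weights hr]
  simp_rw [kpS_wt hr, h]
  constructor
  · intro h; exact_mod_cast h
  · intro h; exact_mod_cast h

/-! ### Invariants indexed by names, and the relation S² = 1 -/

/-- A physical invariant, as a matrix of natural numbers indexed by the names of the weights. -/
structure IsInvariant (r : ℕ) (m : Wt r → Wt r → ℕ) : Prop where
  comm_S : ∀ x y, ∑ z, (m x z : ℝ) * smat r z y = ∑ z, smat r x z * (m z y : ℝ)
  comm_T : ∀ x y, m x y ≠ 0 → ∃ k : ℤ, confWt x = confWt y + k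
  vacuum_one : m (.inl false) (.inl false) = 1

theorem isPhysicalInvariant_iff {r : ℕ} (hr : 3 ≤ r) (M : Matrix (PPlus r 2) (PPlus r 2) ℂ) :
    IsPhysicalInvariant M ↔
      ∃ m : Wt r → Wt r → ℕ, (∀ x y, M (wt r x) (wt r y) = (m x y : ℂ)) ∧ IsInvariant r m := by
  constructor
  · rintro ⟨hS, hT, hN, h0⟩
    choose m hm using hN
    refine ⟨fun x y => m (wt r x) (wt r y), fun x y => hm _ _, ⟨?_, ?_, ?_⟩⟩
    · exact (comm_kpS_iff hr M _ (fun x y => by rw [hm]; push_cast; rfl)).1 hS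
    · intro x y hxy
      refine (comm_kpT_iff hr M).1 hT x y ?_
      rw [hm]; exact_mod_cast hxy
    · rw [hm, vacuum_eq] at h0
      exact_mod_cast h0
  · rintro ⟨m, hm, hS, hT, h0⟩
    refine ⟨?_, ?_, ?_, ?_⟩
    · exact (comm_kpS_iff hr M (fun x y => m x y) (fun x y => by rw [hm]; push_cast; rfl)).2 hS
    · refine (comm_kpT_iff hr M).2 fun x y hxy => hT x y ?_
      rw [hm] at hxy; exact_mod_cast hxy
    · intro mu nu
      obtain ⟨x, rfl⟩ := wt_surjective hr mu
      obtain ⟨y, rfl⟩ := wt_surjective hr nu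
      exact ⟨_, hm x y⟩
    · rw [vacuum_eq, hm, h0]; simp

lemma sum_wt {r : ℕ} {A : Type*} [AddCommMonoid A] (f : Wt r → A) :
    ∑ z, f z = f (.inl true) + f (.inl false) + (∑ a, f (.inr (.inl a)) +
      (f (.inr (.inr true)) + f (.inr (.inr false)))) := by
  rw [Fintype.sum_sum_type, Fintype.sum_sum_type, Fintype.sum_bool, Fintype.sum_bool]

/-- The entries of `cosMatrix` with the zero row and column removed. -/
lemma cosMatrix_succ_succ (r : ℕ) (a b : Fin r) : cosMatrix r a.succ b.succ =
    Real.cos (2 * Real.pi * ((a.val + 1) * (b.val + 1)) / (2 * r + 1)) := by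
  simp [cosMatrix]

lemma cosMatrix_zero_left (r : ℕ) (b : Fin (r + 1)) : cosMatrix r 0 b = 1 := by simp [cosMatrix]

lemma cosMatrix_zero_right (r : ℕ) (b : Fin (r + 1)) : cosMatrix r b 0 = 1 := by simp [cosMatrix]

lemma smat_gg (r : ℕ) (a b : Fin r) : smat r (.inr (.inl a)) (.inr (.inl b)) =
    2 * cosMatrix r a.succ b.succ / Real.sqrt (2 * r + 1) := by
  rw [cosMatrix_succ_succ]; rfl

lemma mult_zero (r : ℕ) : mult (0 : Fin (r + 1)) = 1 := by simp [mult]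
lemma mult_succ {r : ℕ} (a : Fin r) : mult a.succ = 2 := by simp [mult]

/-- With S symmetric, commuting with S amounts to M = SMS, the form used for the charge arguments.
The γ block reduces to the orthogonality of the cosines. -/
theorem smat_mul_self {r : ℕ} (x y : Wt r) :
    ∑ z, smat r x z * smat r z y = if x = y then 1 else 0 := by
  have hn : (0 : ℝ) < 2 * r + 1 := by positivity
  have hsq : Real.sqrt (2 * (r : ℝ) + 1) * Real.sqrt (2 * r + 1) = 2 * r + 1 := Real.mul_self_sqrt hn.le
  have hs0 : Real.sqrt (2 * (r : ℝ) + 1) ≠ 0 := (Real.sqrt_pos.2 hn).ne'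
  have orth : ∀ a b : Fin (r + 1), cosMatrix r a 0 * cosMatrix r 0 b +
      ∑ k : Fin r, 2 * (cosMatrix r a k.succ * cosMatrix r k.succ b) =
      if a = b then (2 * r + 1) / mult a else 0 := by
    intro a b
    have := sum_mult_cos_mul_cos r a b
    rw [Fin.sum_univ_succ] at this
    simpa only [mult_zero, mult_succ, one_mul] using this
  have hVG : ∀ b : Fin r, ∑ k : Fin r, cosMatrix r k.succ b.succ = -1 / 2 := by
    intro b
    have := orth 0 b.succ
    rw [if_neg (Fin.succ_ne_zero b).symm] at this
    simp only [cosMatrix_zero_left, cosMatrix_zero_right, one_mul, ← Finset.mul_sum] at this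
    linarith
  have hGV : ∀ b : Fin r, ∑ k : Fin r, cosMatrix r b.succ k.succ = -1 / 2 := by
    intro b
    have := orth b.succ 0
    rw [if_neg (Fin.succ_ne_zero b)] at this
    simp only [cosMatrix_zero_right, mul_one, ← Finset.mul_sum] at this
    linarith
  rw [sum_wt]
  have hVV : ∀ i j : Bool, smat r (.inl i) (.inl j) = 1 / (2 * Real.sqrt (2 * r + 1)) := fun _ _ => rfl
  have hVg : ∀ (i : Bool) (a : Fin r), smat r (.inl i) (.inr (.inl a)) = 1 / Real.sqrt (2 * r + 1) := fun _ _ => rfl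
  have hgV : ∀ (i : Bool) (a : Fin r), smat r (.inr (.inl a)) (.inl i) = 1 / Real.sqrt (2 * r + 1) := fun _ _ => rfl
  have hVP : ∀ (i j : Bool), smat r (.inl i) (.inr (.inr j)) = if i then -(1 / 2) else 1 / 2 := fun _ _ => rfl
  have hPV : ∀ (i j : Bool), smat r (.inr (.inr j)) (.inl i) = if i then -(1 / 2) else 1 / 2 := fun _ _ => rfl
  have hPg : ∀ (i : Bool) (a : Fin r), smat r (.inr (.inr i)) (.inr (.inl a)) = 0 := fun _ _ => rfl
  have hgP : ∀ (i : Bool) (a : Fin r), smat r (.inr (.inl a)) (.inr (.inr i)) = 0 := fun _ _ => rfl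
  have hPP : ∀ (i j : Bool), smat r (.inr (.inr i)) (.inr (.inr j)) = if i = j then 1 / 2 else -(1 / 2) := fun _ _ => rfl
  set s := Real.sqrt (2 * (r : ℝ) + 1)
  rcases x with i | a | i <;> rcases y with j | b | j <;>
    simp only [hVV, hVg, hgV, hVP, hPV, hPg, hgP, hPP, smat_gg, mul_zero, zero_mul, Finset.sum_const_zero]
  · have : (1 / (2 * s) * (1 / (2 * s)) + 1 / (2 * s) * (1 / (2 * s)) + r * (1 / s * (1 / s))) = 1 / 2 := by
      field_simp; nlinarith
    simp only [Finset.sum_const, Finset.card_univ, Fintype.card_fin, nsmul_eq_mul]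
    rw [← add_assoc, this]
    cases i <;> cases j <;> norm_num
  · rw [← Finset.mul_sum, ← Finset.sum_div, ← Finset.mul_sum, hVG]
    simp; field_simp; ring
  · simp only [reduceCtorEq, if_false]; cases i <;> cases j <;> norm_num
  · rw [← Finset.sum_mul, ← Finset.sum_div, ← Finset.mul_sum, hGV]
    simp; field_simp; ring
  · have := orth a.succ b.succ
    simp only [cosMatrix_zero_left, cosMatrix_zero_right, one_mul, ← Finset.mul_sum, mult_succ,
      Fin.succ_inj] at this
    have e : ∀ k : Fin r, 2 * cosMatrix r a.succ k.succ / s * (2 * cosMatrix r k.succ b.succ / s) =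
      4 / (s * s) * (cosMatrix r a.succ k.succ * cosMatrix r k.succ b.succ) := by
      intro k; field_simp; ring
    rw [Finset.sum_congr rfl fun k _ => e k, ← Finset.mul_sum]
    have e2 : ∑ k : Fin r, cosMatrix r a.succ k.succ * cosMatrix r k.succ b.succ =
      ((if a = b then (2 * (r : ℝ) + 1) / 2 else 0) - 1) / 2 := by linarith
    rw [e2, ← hsq]
    by_cases hab : a = b
    · simp [hab]; field_simp; ring
    · simp [hab]; field_simp; ring
  · simp only [Sum.inr.injEq, reduceCtorEq, if_false]; cases j <;> norm_num
  · simp only [reduceCtorEq, if_false]; cases i <;> cases j <;> norm_num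
  · simp only [Sum.inr.injEq, reduceCtorEq, if_false]; cases i <;> norm_num
  · cases i <;> cases j <;> norm_num

/-! ### Charge conservation -/

/-- The action of the simple current on the names of the weights. -/
def jWt {r : ℕ} : Wt r → Wt r
  | .inl i => .inl (!i)
  | .inr (.inl a) => .inr (.inl a)
  | .inr (.inr i) => .inr (.inr (!i))

lemma smat_jWt {r : ℕ} (x y : Wt r) : smat r (jWt x) y = chargeSign y * smat r x y := by
  rcases x with (_ | _) | a | (_ | _) <;> rcases y with (_ | _) | b | (_ | _) <;>
    simp [smat, jWt, chargeSign]

lemma smat_vacuum_pos {r : ℕ} (x : Wt r) : 0 < smat r (.inl false) x := by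
  have hn : (0 : ℝ) < Real.sqrt (2 * r + 1) := Real.sqrt_pos.2 (by positivity)
  rcases x with i | a | i <;> simp [smat, hn]

namespace IsInvariant

variable {r : ℕ} {m : Wt r → Wt r → ℕ}

lemma eq_sum (h : IsInvariant r m) (x y : Wt r) :
    (m x y : ℝ) = ∑ z, ∑ w, smat r x z * (m z w : ℝ) * smat r w y := by
  have e : ∀ z, ∑ w, smat r x z * (m z w : ℝ) * smat r w y = smat r x z * ∑ w, smat r z w * (m w y : ℝ) := by
    intro z
    rw [← h.comm_S, Finset.mul_sum]
    exact Finset.sum_congr rfl fun w _ => by ring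
  simp_rw [e, Finset.mul_sum]
  rw [Finset.sum_comm]
  simp_rw [← mul_assoc]
  have e2 : ∀ w, ∑ z, smat r x z * smat r z w * (m w y : ℝ) = if x = w then (m w y : ℝ) else 0 := by
    intro w
    rw [← Finset.sum_mul, smat_mul_self]; split_ifs <;> simp
  simp_rw [e2]
  simp

lemma sum_weight_eq (h : IsInvariant r m) (x y : Wt r) (e : Wt r → Wt r → ℝ)
    (he : ∀ z w, m z w ≠ 0 → e z w = 1) :
    ∑ z, ∑ w, e z w * (smat r x z * (m z w : ℝ) * smat r w y) = m x y := by
  rw [h.eq_sum]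
  refine Finset.sum_congr rfl fun z _ => Finset.sum_congr rfl fun w _ => ?_
  by_cases h0 : m z w = 0
  · simp [h0]
  · rw [he z w h0, one_mul]

/-- M₀₀ = 1 is a sum of nonnegative terms S₀z M_zw S_w0, and factors at most 1 can only lower it.
With charge signs as factors the sum becomes an entry of M at (J0,0), (0,J0) or (J0,J0). -/
lemma weight_le_one (h : IsInvariant r m) (e : Wt r → Wt r → ℝ) (he : ∀ z w, e z w ≤ 1) :
    ∑ z, ∑ w, e z w * (smat r (.inl false) z * (m z w : ℝ) * smat r w (.inl false)) ≤ 1 := by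
  have h1 := h.eq_sum (.inl false) (.inl false)
  rw [h.vacuum_one, Nat.cast_one] at h1
  rw [h1]
  refine Finset.sum_le_sum fun z _ => Finset.sum_le_sum fun w _ => ?_
  have hz := smat_vacuum_pos z
  have hw := smat_vacuum_pos w
  rw [smat_comm r w]
  exact mul_le_of_le_one_left (by positivity) (he z w)

/-- Equality holds term by term, and every term with M_zw ≠ 0 is strictly positive. -/
lemma weight_eq_one (h : IsInvariant r m) (e : Wt r → Wt r → ℝ) (he : ∀ z w, e z w ≤ 1)
    (hsum : ∑ z, ∑ w, e z w * (smat r (.inl false) z * (m z w : ℝ) * smat r w (.inl false)) = 1)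
    (z w : Wt r) (h0 : m z w ≠ 0) : e z w = 1 := by
  have h1 := h.eq_sum (.inl false) (.inl false)
  rw [h.vacuum_one, Nat.cast_one, ← hsum] at h1
  have hle : ∀ z w, e z w * (smat r (.inl false) z * (m z w : ℝ) * smat r w (.inl false)) ≤
      smat r (.inl false) z * (m z w : ℝ) * smat r w (.inl false) := by
    intro z w
    have hz := smat_vacuum_pos z
    have hw := smat_vacuum_pos w
    rw [smat_comm r w]
    exact mul_le_of_le_one_left (by positivity) (he z w)
  have h2 := (Finset.sum_eq_sum_iff_of_le fun z _ => Finset.sum_le_sum fun w _ => hle z w).1 h1 z (Finset.mem_univ _)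
  have h3 := (Finset.sum_eq_sum_iff_of_le fun w _ => hle z w).1 h2 w (Finset.mem_univ _)
  have hpos : 0 < smat r (.inl false) z * (m z w : ℝ) * smat r w (.inl false) := by
    have hz := smat_vacuum_pos z
    have hw := smat_vacuum_pos w
    rw [smat_comm r w]
    have : (0 : ℝ) < m z w := by exact_mod_cast Nat.pos_of_ne_zero h0
    positivity
  exact mul_right_cancel₀ hpos.ne' (h3.trans (one_mul _).symm)

lemma eq_sum_left (h : IsInvariant r m) (x y : Wt r) :
    (m (jWt x) y : ℝ) = ∑ z, ∑ w, chargeSign z * (smat r x z * (m z w : ℝ) * smat r w y) := by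
  rw [h.eq_sum]
  refine Finset.sum_congr rfl fun z _ => Finset.sum_congr rfl fun w _ => ?_
  rw [smat_jWt]; ring

lemma eq_sum_right (h : IsInvariant r m) (x y : Wt r) :
    (m x (jWt y) : ℝ) = ∑ z, ∑ w, chargeSign w * (smat r x z * (m z w : ℝ) * smat r w y) := by
  rw [h.eq_sum]
  refine Finset.sum_congr rfl fun z _ => Finset.sum_congr rfl fun w _ => ?_
  rw [smat_comm r w, smat_jWt, smat_comm r y]; ring

lemma eq_sum_both (h : IsInvariant r m) (x y : Wt r) :
    (m (jWt x) (jWt y) : ℝ) =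
      ∑ z, ∑ w, (chargeSign z * chargeSign w) * (smat r x z * (m z w : ℝ) * smat r w y) := by
  rw [h.eq_sum]
  refine Finset.sum_congr rfl fun z _ => Finset.sum_congr rfl fun w _ => ?_
  rw [smat_comm r w, smat_jWt, smat_jWt, smat_comm r y]; ring

lemma chargeSign_le_one (x : Wt r) : chargeSign x ≤ 1 := by
  rcases x with i | a | i <;> simp [chargeSign]

lemma chargeSign_mul_le_one (x y : Wt r) : chargeSign x * chargeSign y ≤ 1 := by
  rcases x with i | a | i <;> rcases y with j | b | j <;> simp [chargeSign]

lemma current_left_le (h : IsInvariant r m) : m (.inl true) (.inl false) ≤ 1 := by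
  have := h.weight_le_one (fun z _ => chargeSign z) (fun z _ => chargeSign_le_one z)
  rw [← h.eq_sum_left] at this
  exact_mod_cast this

lemma current_right_le (h : IsInvariant r m) : m (.inl false) (.inl true) ≤ 1 := by
  have := h.weight_le_one (fun _ w => chargeSign w) (fun _ w => chargeSign_le_one w)
  rw [← h.eq_sum_right] at this
  exact_mod_cast this

lemma current_both_le (h : IsInvariant r m) : m (.inl true) (.inl true) ≤ 1 := by
  have := h.weight_le_one (fun z w => chargeSign z * chargeSign w) (fun z w => chargeSign_mul_le_one z w)
  rw [← h.eq_sum_both] at this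
  exact_mod_cast this

lemma charge_left (h : IsInvariant r m) (h1 : m (.inl true) (.inl false) = 1) {z w : Wt r}
    (h0 : m z w ≠ 0) : chargeSign z = 1 :=
  h.weight_eq_one (fun z _ => chargeSign z) (fun z _ => chargeSign_le_one z)
    (by rw [← h.eq_sum_left]; exact_mod_cast h1) z w h0

lemma charge_right (h : IsInvariant r m) (h1 : m (.inl false) (.inl true) = 1) {z w : Wt r}
    (h0 : m z w ≠ 0) : chargeSign w = 1 :=
  h.weight_eq_one (fun _ w => chargeSign w) (fun _ w => chargeSign_le_one w)
    (by rw [← h.eq_sum_right]; exact_mod_cast h1) z w h0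

lemma charge_both (h : IsInvariant r m) (h1 : m (.inl true) (.inl true) = 1) {z w : Wt r}
    (h0 : m z w ≠ 0) : chargeSign z * chargeSign w = 1 :=
  h.weight_eq_one (fun z w => chargeSign z * chargeSign w) (fun z w => chargeSign_mul_le_one z w)
    (by rw [← h.eq_sum_both]; exact_mod_cast h1) z w h0

/-- Charge conservation makes all the signs in the expansion of the translated entry equal to 1. -/
lemma jWt_left (h : IsInvariant r m) (h1 : m (.inl true) (.inl false) = 1) (x y : Wt r) :
    m (jWt x) y = m x y := by
  have := h.sum_weight_eq x y (fun z _ => chargeSign z) (fun z w h0 => h.charge_left h1 h0)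
  rw [← h.eq_sum_left] at this
  exact_mod_cast this

lemma jWt_right (h : IsInvariant r m) (h1 : m (.inl false) (.inl true) = 1) (x y : Wt r) :
    m x (jWt y) = m x y := by
  have := h.sum_weight_eq x y (fun _ w => chargeSign w) (fun z w h0 => h.charge_right h1 h0)
  rw [← h.eq_sum_right] at this
  exact_mod_cast this

lemma jWt_both (h : IsInvariant r m) (h1 : m (.inl true) (.inl true) = 1) (x y : Wt r) :
    m (jWt x) (jWt y) = m x y := by
  have := h.sum_weight_eq x y (fun z w => chargeSign z * chargeSign w) (fun z w h0 => h.charge_both h1 h0)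
  rw [← h.eq_sum_both] at this
  exact_mod_cast this

lemma transpose (h : IsInvariant r m) : IsInvariant r (fun x y => m y x) where
  comm_S x y := by
    have := h.comm_S y x
    calc _ = ∑ z, smat r y z * (m z x : ℝ) :=
          Finset.sum_congr rfl fun z _ => by rw [smat_comm r z y, mul_comm]
      _ = _ := by
          rw [← this]
          exact Finset.sum_congr rfl fun z _ => by rw [smat_comm r z x, mul_comm]
  comm_T x y h0 := by
    obtain ⟨k, hk⟩ := h.comm_T y x h0
    exact ⟨-k, by rw [hk]; push_cast; ring⟩
  vacuum_one := h.vacuum_one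

end IsInvariant

/-! ### Folding `ZMod (2 * r + 1)` onto the weights that are not spinors -/

/-- The representative in `{0, …, r}` of an element of `ZMod (2 * r + 1)` up to sign. -/
def fold (r : ℕ) (x : ZMod (2 * r + 1)) : Fin (r + 1) :=
  ⟨x.valMinAbs.natAbs, by have := ZMod.natAbs_valMinAbs_le x; omega⟩

lemma fold_natCast {r k : ℕ} (hk : k < r + 1) : fold r (k : ZMod (2 * r + 1)) = ⟨k, hk⟩ := by
  apply Fin.ext
  simp only [fold]
  rw [ZMod.valMinAbs_natCast_of_le_half (by omega)]; simp

lemma fold_zero (r : ℕ) : fold r 0 = 0 := by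
  have := fold_natCast (r := r) (k := 0) (by omega)
  simpa using this

lemma fold_neg {r : ℕ} (x : ZMod (2 * r + 1)) : fold r (-x) = fold r x := by
  apply Fin.ext
  exact ZMod.natAbs_valMinAbs_neg x

lemma eq_or_eq_neg_fold {r : ℕ} (x : ZMod (2 * r + 1)) :
    x = ((fold r x).val : ZMod (2 * r + 1)) ∨ x = -((fold r x).val : ZMod (2 * r + 1)) := by
  have h : ((x.valMinAbs : ℤ) : ZMod (2 * r + 1)) = x := ZMod.coe_valMinAbs x
  rcases Int.natAbs_eq x.valMinAbs with h' | h'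
  · left; conv_lhs => rw [← h, h']
    simp [fold]
  · right; conv_lhs => rw [← h, h']
    simp [fold]

/-- The Fourier transform of an even function on ℤ/n is a cosine transform with multiplicities. -/
lemma sum_fold_mul_stdAddChar (r : ℕ) (F : Fin (r + 1) → ℂ) (c : ZMod (2 * r + 1)) :
    ∑ y, F (fold r y) * ZMod.stdAddChar (y * c) =
      ∑ k, F k * (mult k * cosMatrix r k (fold r c) : ℝ) := by
  have main : ∀ c : ℕ, ∑ y, F (fold r y) * ZMod.stdAddChar (y * (c : ZMod (2 * r + 1))) =
      F 0 + ∑ k : Fin r, F k.succ * ((2 * Real.cos (2 * Real.pi * ((k.val + 1) * c) / (2 * r + 1)) : ℝ) : ℂ) := by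
    intro c
    rw [zmod_sum_fold]
    simp only [fold_zero, zero_mul, AddChar.map_zero_eq_one, mul_one]
    congr 1
    refine Finset.sum_congr rfl fun k _ => ?_
    have := stdAddChar_add_neg r ((k.val + 1) * c : ℕ)
    rw [fold_neg, fold_natCast (by omega), ← mul_add, neg_mul]
    have e : (⟨k.val + 1, by omega⟩ : Fin (r + 1)) = k.succ := rfl
    rw [e]
    push_cast at this ⊢
    rw [this]
  have hc : ∑ y, F (fold r y) * ZMod.stdAddChar (y * c) =
      ∑ y, F (fold r y) * ZMod.stdAddChar (y * ((fold r c).val : ZMod (2 * r + 1))) := by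
    rcases eq_or_eq_neg_fold c with h | h
    · conv_lhs => rw [h]
    · conv_lhs => rw [h]
      rw [← Equiv.sum_comp (Equiv.neg _)]
      refine Finset.sum_congr rfl fun y _ => ?_
      simp only [Equiv.neg_apply, fold_neg, neg_mul_neg]
  rw [hc, main, Fin.sum_univ_succ]
  simp [mult_zero, mult_succ, cosMatrix]

/-- Sum a function over the vacuum and the simple current, and restrict it to the other weights
that are not spinors. -/
def foldWt {r : ℕ} {A : Type*} [Add A] (f : Wt r → A) : Fin (r + 1) → A :=
  Fin.cases (f (.inl true) + f (.inl false)) fun a => f (.inr (.inl a))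

lemma foldWt_zero {r : ℕ} {A : Type*} [Add A] (f : Wt r → A) :
    foldWt f 0 = f (.inl true) + f (.inl false) := rfl

lemma foldWt_succ {r : ℕ} {A : Type*} [Add A] (f : Wt r → A) (a : Fin r) :
    foldWt f a.succ = f (.inr (.inl a)) := rfl

/-- The entries of a matrix at the weights that are not spinors, the vacuum and the simple current
being added up. -/
def foldMat {r : ℕ} {A : Type*} [Add A] (m : Wt r → Wt r → A) (a b : Fin (r + 1)) : A :=
  foldWt (fun x => foldWt (m x) b) a

/-- Folding turns S into the cosine transform. The spinors drop out: their entries of S at 0 and at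
J0 are opposite, and those at the γ's vanish. -/
lemma foldWt_smat (r : ℕ) (z : Wt r → ℝ) (c : Fin (r + 1)) :
    foldWt (fun y => ∑ x, z x * smat r x y) c =
      (∑ k, foldWt z k * (mult k * cosMatrix r k c)) / Real.sqrt (2 * r + 1) := by
  have hs0 : Real.sqrt (2 * (r : ℝ) + 1) ≠ 0 := (Real.sqrt_pos.2 (by positivity)).ne'
  rw [Fin.sum_univ_succ, foldWt_zero]
  simp only [foldWt_succ, mult_zero, mult_succ, cosMatrix_zero_left]
  refine Fin.cases ?_ (fun c => ?_) c
  · rw [foldWt_zero, sum_wt, sum_wt]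
    simp only [cosMatrix_zero_right, smat, ← Finset.sum_mul, Bool.false_eq_true, if_false, if_true]
    field_simp
    ring
  · rw [foldWt_succ, sum_wt]
    simp only [smat_gg]
    simp only [smat, add_div, Finset.sum_div]
    have : ∀ a : Fin r, z (.inr (.inl a)) * (2 * cosMatrix r a.succ c.succ / Real.sqrt (2 * r + 1)) =
      z (.inr (.inl a)) * (2 * cosMatrix r a.succ c.succ) / Real.sqrt (2 * r + 1) := fun a => by ring
    simp only [this]
    ring

lemma foldMat_swap {r : ℕ} (f : Wt r → Wt r → ℝ) (a c : Fin (r + 1)) :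
    foldMat f a c = foldMat (fun x y => f y x) c a := by
  unfold foldMat
  refine Fin.cases ?_ (fun a => ?_) a <;> refine Fin.cases ?_ (fun c => ?_) c <;>
    simp only [foldWt_zero, foldWt_succ]
  ring

lemma cosMatrix_comm (r : ℕ) (a b : Fin (r + 1)) : cosMatrix r a b = cosMatrix r b a := by
  simp only [cosMatrix, Matrix.of_apply]; rw [mul_comm (b.val : ℝ)]

lemma foldMat_comm_cosMatrix {r : ℕ} {m : Wt r → Wt r → ℝ}
    (h : ∀ x y, ∑ z, m x z * smat r z y = ∑ z, smat r x z * m z y) (a c : Fin (r + 1)) :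
    ∑ k, foldMat m a k * (mult k * cosMatrix r k c) =
      ∑ k, cosMatrix r a k * mult k * foldMat m k c := by
  have hs0 : Real.sqrt (2 * (r : ℝ) + 1) ≠ 0 := (Real.sqrt_pos.2 (by positivity)).ne'
  have divlin : ∀ (f : Wt r → ℝ) (t : ℝ) (a : Fin (r + 1)), foldWt (fun x => f x / t) a = foldWt f a / t := by
    intro f t a
    refine Fin.cases ?_ (fun a => ?_) a
    · simp only [foldWt_zero, add_div]
    · simp only [foldWt_succ]
  have key : ∀ (m : Wt r → Wt r → ℝ) a c, foldMat (fun x y => ∑ z, m x z * smat r z y) a c =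
      (∑ k, foldMat m a k * (mult k * cosMatrix r k c)) / Real.sqrt (2 * r + 1) := by
    intro m a c
    unfold foldMat
    simp only [foldWt_smat, divlin]
    congr 1
    refine Fin.cases ?_ (fun a => ?_) a
    · simp only [foldWt_zero, add_mul, Finset.sum_add_distrib]
    · simp only [foldWt_succ]
  have h1 := key m a c
  have h2 := key (fun x y => m y x) c a
  rw [foldMat_swap] at h2
  -- The same relation for the transpose describes SM; as MS = SM, the two folded expressions agree.
  have e : (fun x y => ∑ z, m z y * smat r z x) = fun x y => ∑ z, m x z * smat r z y := by
    funext x y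
    rw [h]
    exact Finset.sum_congr rfl fun z _ => by rw [smat_comm r z x, mul_comm]
  simp only [e] at h2
  rw [h1] at h2
  have h3 := (div_left_inj' hs0).1 h2
  rw [h3]
  refine Finset.sum_congr rfl fun k _ => ?_
  rw [foldMat_swap, cosMatrix_comm r k a]
  ring

/-! ### Couplings allowed by T -/

/-- The index `a` of the weight `γ^a` or `J γ^a`. -/
def lvl {r : ℕ} : Wt r → ℕ
  | .inr (.inl a) => a.val + 1
  | _ => 0

lemma confWt_eq {r : ℕ} (x : Wt r) (hx : chargeSign x = 1) :
    ∃ k : ℤ, confWt x = lvl x * (2 * r + 1 - lvl x) / (2 * (2 * r + 1)) + k := by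
  rcases x with (_ | _) | a | i
  · exact ⟨0, by simp [confWt, lvl]⟩
  · exact ⟨1, by simp [confWt, lvl]⟩
  · exact ⟨0, by simp [confWt, lvl]⟩
  · norm_num [chargeSign] at hx

/-- The difference of a(n - a)/(2n) and b(n - b)/(2n) is (a - b)(n - a - b)/(2n). Its numerator is
even and n is odd, so it is integral exactly when n ∣ a² - b². -/
lemma confWt_sub_iff {r : ℕ} (x y : Wt r) (hx : chargeSign x = 1) (hy : chargeSign y = 1) :
    (∃ k : ℤ, confWt x = confWt y + k) ↔
      ((2 * r + 1 : ℕ) : ℤ) ∣ ((lvl x : ℤ) - lvl y) * (lvl x + lvl y) := by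
  have hn : (2 * (r : ℝ) + 1) ≠ 0 := by positivity
  obtain ⟨kx, hkx⟩ := confWt_eq x hx
  obtain ⟨ky, hky⟩ := confWt_eq y hy
  rw [hkx, hky]
  set a := lvl x
  set b := lvl y
  obtain ⟨e, he⟩ : (2 : ℤ) ∣ ((a : ℤ) - b) * (2 * r + 1 - a - b) := by
    have h1 := Int.even_mul_succ_self ((a : ℤ) - b)
    have h2 : ((a : ℤ) - b) * (2 * r + 1 - a - b) =
      ((a : ℤ) - b) * ((a : ℤ) - b + 1) + 2 * (((a : ℤ) - b) * (r - a)) := by ring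
    rw [h2]
    exact dvd_add h1.two_dvd ⟨_, rfl⟩
  have heR : ((a : ℝ) - b) * (2 * r + 1 - a - b) = 2 * e := by exact_mod_cast he
  have hdiff : (a : ℝ) * (2 * r + 1 - a) / (2 * (2 * r + 1)) - b * (2 * r + 1 - b) / (2 * (2 * r + 1)) =
      e / (2 * r + 1) := by
    rw [div_sub_div_same, div_eq_div_iff (by positivity) hn]
    linear_combination (2 * (r : ℝ) + 1) * heR
  have hdvd : ((2 * r + 1 : ℕ) : ℤ) ∣ ((a : ℤ) - b) * (a + b) ↔ ((2 * r + 1 : ℕ) : ℤ) ∣ e := by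
    have hc : IsCoprime ((2 * r + 1 : ℕ) : ℤ) 2 := ⟨1, -r, by push_cast; ring⟩
    have h2 : 2 * e = -(((a : ℤ) - b) * (a + b)) + ((2 * r + 1 : ℕ) : ℤ) * (a - b) := by
      rw [← he]; push_cast; ring
    constructor
    · intro h
      refine hc.dvd_of_dvd_mul_left ?_
      rw [h2]
      exact dvd_add ((dvd_neg).2 h) (Dvd.intro _ rfl)
    · intro h
      have h3 := Dvd.dvd.mul_left h 2
      rw [h2, dvd_add_left (Dvd.intro _ rfl), dvd_neg] at h3
      exact h3
  rw [hdvd]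
  constructor
  · rintro ⟨k, hk⟩
    refine ⟨k + ky - kx, ?_⟩
    have : (e : ℝ) = (2 * r + 1) * (k + ky - kx) := by
      rw [mul_comm, ← div_eq_iff hn, ← hdiff]; linarith
    exact_mod_cast this
  · rintro ⟨k, hk⟩
    refine ⟨k + kx - ky, ?_⟩
    have hkR : (e : ℝ) = (2 * r + 1) * k := by exact_mod_cast hk
    rw [hkR, mul_div_cancel_left₀ _ hn] at hdiff
    push_cast; linarith

/-- The only spinor that can be coupled to the other weights, when `4 ∣ r`. -/
def kap (r : ℕ) : Bool := decide (¬ 8 ∣ r)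

/-- Clearing denominators gives 8e = n · (r + 8k), or the same with r + 4, for some integers e and
k. As n is odd, 8 divides r for the spinor Λ_r and r + 4 for JΛ_r. -/
lemma spinor_coupling {r : ℕ} {z : Wt r} (hz : chargeSign z = 1) {q : Bool}
    (h : ∃ k : ℤ, confWt z = confWt (r := r) (.inr (.inr q)) + k) : 4 ∣ r ∧ q = kap r := by
  have hn : (2 * (r : ℝ) + 1) ≠ 0 := by positivity
  obtain ⟨k, hk⟩ := h
  obtain ⟨kx, hkx⟩ := confWt_eq z hz
  rw [hkx] at hk
  set a := lvl z
  obtain ⟨e, he⟩ : (2 : ℤ) ∣ (a : ℤ) * (2 * r + 1 - a) := by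
    have h1 := Int.even_mul_succ_self (a : ℤ)
    have h2 : (a : ℤ) * (2 * r + 1 - a) = a * (a + 1) + 2 * (a * (r - a)) := by ring
    rw [h2]
    exact dvd_add h1.two_dvd ⟨_, rfl⟩
  have heR : (a : ℝ) * (2 * r + 1 - a) = 2 * e := by exact_mod_cast he
  rw [heR, mul_div_mul_left _ _ two_ne_zero] at hk
  have hk2 : (8 : ℝ) * e = (2 * r + 1) * (r + (if q then 4 else 0) + 8 * (k - kx)) := by
    have : (e : ℝ) / (2 * r + 1) = confWt (r := r) (.inr (.inr q)) + k - kx := by linarith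
    rw [div_eq_iff hn] at this
    rw [this]
    simp only [confWt]
    split_ifs <;> ring
  have hk3 : (8 : ℤ) * e = (2 * r + 1) * (r + (if q then 4 else 0) + 8 * (k - kx)) := by
    rcases q with _ | _
    · simp only [Bool.false_eq_true, if_false] at hk2 ⊢; exact_mod_cast hk2
    · simp only [if_true] at hk2 ⊢; exact_mod_cast hk2
  have hc : IsCoprime (8 : ℤ) (2 * r + 1) := by
    have h2 : IsCoprime (2 : ℤ) (2 * r + 1) := ⟨-r, 1, by ring⟩
    have := h2.pow_left (m := 3)
    norm_num at this; exact this
  have h8 := hc.dvd_of_dvd_mul_left (Dvd.intro _ hk3)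
  rcases q with _ | _
  · simp only [Bool.false_eq_true, if_false] at h8
    have : 8 ∣ r := by omega
    exact ⟨by omega, by simp [kap, this]⟩
  · simp only [if_true] at h8
    have : ¬ 8 ∣ r := by omega
    exact ⟨by omega, by simp [kap, this]⟩

lemma spinor_ne {r : ℕ} {p q : Bool}
    (h : ∃ k : ℤ, confWt (r := r) (.inr (.inr p)) = confWt (r := r) (.inr (.inr q)) + k) : p = q := by
  obtain ⟨k, hk⟩ := h
  rcases p with _ | _ <;> rcases q with _ | _ <;> simp only [confWt, Bool.false_eq_true, if_false, if_true] at hk ⊢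
  · have : (2 * k : ℝ) = -1 := by linarith
    have : 2 * k = -1 := by exact_mod_cast this
    omega
  · have : (2 * k : ℝ) = 1 := by linarith
    have : 2 * k = 1 := by exact_mod_cast this
    omega

/-! ### Classification of the folded matrix -/

lemma foldMat_natCast {r : ℕ} (m : Wt r → Wt r → ℕ) (a b : Fin (r + 1)) :
    foldMat (fun x y => (m x y : ℝ)) a b = ((foldMat m a b : ℕ) : ℝ) := by
  unfold foldMat
  refine Fin.cases ?_ (fun a => ?_) a <;> refine Fin.cases ?_ (fun b => ?_) b <;>
    simp only [foldWt_zero, foldWt_succ] <;> push_cast <;> rfl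

lemma foldMat_ne_zero {r : ℕ} {m : Wt r → Wt r → ℕ} {a b : Fin (r + 1)} (h : foldMat m a b ≠ 0) :
    ∃ x y : Wt r, chargeSign x = 1 ∧ chargeSign y = 1 ∧ lvl x = a.val ∧ lvl y = b.val ∧ m x y ≠ 0 := by
  have key : ∀ (f : Wt r → ℕ) (a : Fin (r + 1)), foldWt f a ≠ 0 →
      ∃ x : Wt r, chargeSign x = 1 ∧ lvl x = a.val ∧ f x ≠ 0 := by
    intro f a
    refine Fin.cases ?_ (fun a => ?_) a
    · intro h
      rw [foldWt_zero] at h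
      by_cases h1 : f (.inl true) = 0
      · exact ⟨.inl false, rfl, rfl, by omega⟩
      · exact ⟨.inl true, rfl, rfl, h1⟩
    · intro h
      exact ⟨.inr (.inl a), rfl, rfl, h⟩
  obtain ⟨x, hx, hxa, h1⟩ := key _ _ h
  obtain ⟨y, hy, hyb, h2⟩ := key _ _ h1
  exact ⟨x, y, hx, hy, hxa, hyb, h2⟩

/-- Unfolded along `fold`, the folded matrix is an even function on (ℤ/n)², and S and T supply the
two hypotheses of `nat_invariant_classification`. -/
theorem IsInvariant.foldMat_classification {r : ℕ} {m : Wt r → Wt r → ℕ} (h : IsInvariant r m) :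
    (foldMat m 0 0 = 1 → ∃ i, i * i = 2 * r + 1 ∧ ∀ a b : Fin (r + 1),
      foldMat m a b = if (i : ℤ) ∣ a.val - b.val ∧ (i : ℤ) ∣ a.val + b.val then 1 else 0) ∧
    (foldMat m 0 0 = 2 → ∃ i j, i * j = 2 * r + 1 ∧ ∀ a b : Fin (r + 1),
      foldMat m a b = pairCount i j a.val b.val) ∧
    (foldMat m 0 0 = 4 → ∃ i j i' j', i * j = 2 * r + 1 ∧ i' * j' = 2 * r + 1 ∧ ∀ a b : Fin (r + 1),
      foldMat m a b = pairCount i j a.val b.val + pairCount i' j' a.val b.val) := by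
  have hN := nat_invariant_classification (n := 2 * r + 1) ⟨r, rfl⟩
    (fun a b => foldMat m (fold r a) (fold r b)) (fun a b => by rw [fold_neg]) (by
      intro a c
      have h1 := sum_fold_mul_stdAddChar r (fun k => ((foldMat m (fold r a) k : ℕ) : ℂ)) c
      have h2 := sum_fold_mul_stdAddChar r (fun k => ((foldMat m k (fold r c) : ℕ) : ℂ)) a
      rw [h1]
      have e : ∀ y : ZMod (2 * r + 1), ZMod.stdAddChar (a * y) * ((foldMat m (fold r y) (fold r c) : ℕ) : ℂ) =
        ((foldMat m (fold r y) (fold r c) : ℕ) : ℂ) * ZMod.stdAddChar (y * a) := fun y => by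
          rw [mul_comm, mul_comm a]
      rw [Finset.sum_congr rfl fun y _ => e y, h2]
      have h3 := foldMat_comm_cosMatrix (m := fun x y => (m x y : ℝ)) h.comm_S (fold r a) (fold r c)
      simp only [foldMat_natCast] at h3
      have h4 : ∀ k, cosMatrix r (fold r a) k * mult k * ((foldMat m k (fold r c) : ℕ) : ℝ) =
        ((foldMat m k (fold r c) : ℕ) : ℝ) * (mult k * cosMatrix r k (fold r a)) := fun k => by
          rw [cosMatrix_comm r _ k]; ring
      rw [Finset.sum_congr rfl fun k _ => h4 k] at h3
      exact_mod_cast h3)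
    (by
      intro a b hab
      by_contra h0
      obtain ⟨x, y, hx, hy, hxa, hyb, hxy⟩ := foldMat_ne_zero h0
      have h1 := (confWt_sub_iff x y hx hy).1 (h.comm_T x y hxy)
      rw [hxa, hyb] at h1
      have h2 := (ZMod.intCast_zmod_eq_zero_iff_dvd _ _).2 h1
      push_cast at h2
      apply hab
      rcases eq_or_eq_neg_fold a with ha | ha <;> rcases eq_or_eq_neg_fold b with hb | hb <;>
        rw [ha, hb] <;> linear_combination h2)
  have hf : ∀ a : Fin (r + 1), fold r ((a.val : ℕ) : ZMod (2 * r + 1)) = a := fun a => fold_natCast a.is_lt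
  simp only [fold_zero] at hN
  obtain ⟨h1, h2, h3⟩ := hN
  refine ⟨fun h0 => ?_, fun h0 => ?_, fun h0 => ?_⟩
  · obtain ⟨i, hi, h⟩ := h1 h0
    refine ⟨i, hi, fun a b => ?_⟩
    have := h a.val b.val
    push_cast [hf] at this
    exact this
  · obtain ⟨i, j, hij, h⟩ := h2 h0
    refine ⟨i, j, hij, fun a b => ?_⟩
    have := h a.val b.val
    push_cast [hf] at this
    exact this
  · obtain ⟨i, j, i', j', hij, hij', h⟩ := h3 h0
    refine ⟨i, j, i', j', hij, hij', fun a b => ?_⟩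
    have := h a.val b.val
    push_cast [hf] at this
    exact this

/-- Of the g multiples of d modulo gd one is 0, and the others come in pairs ±b with 1 ≤ b ≤ r. -/
lemma sum_indicator_dvd {r g d : ℕ} (h : g * d = 2 * r + 1) :
    1 + 2 * ∑ b : Fin r, (if d ∣ b.val + 1 then 1 else 0) = g := by
  rw [Fin.sum_univ_eq_sum_range (fun b => if d ∣ b + 1 then 1 else 0), ← Finset.card_filter,
    Nat.card_multiples]
  have hd : 0 < d := Nat.pos_of_ne_zero (by rintro rfl; omega)
  have hodd : Odd (g * d) := by rw [h]; exact ⟨r, rfl⟩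
  obtain ⟨⟨u, hu⟩, ⟨v, hv⟩⟩ := Nat.odd_mul.1 hodd
  have : r / d = u := by
    rw [Nat.div_eq_iff hd]
    subst hu
    have : u * d + u * d + d = 2 * r + 1 := by rw [← h]; ring
    constructor <;> omega
  rw [this]; omega

/-! ### The invariants on the names of the weights -/

/-- The indicator of the indices divisible by both `i` and `j`. -/
def dvdBoth {r : ℕ} (i j : ℕ) (b : Fin r) : ℕ := if i ∣ b.val + 1 ∧ j ∣ b.val + 1 then 1 else 0

lemma dvdBoth_comm {r : ℕ} (i j : ℕ) (b : Fin r) : dvdBoth j i b = dvdBoth i j b := by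
  simp only [dvdBoth, and_comm]

lemma pairCount_swap (i j : ℕ) (a b : ℤ) : pairCount i j b a = pairCount i j a b := by
  have h : ∀ k : ℕ, (k : ℤ) ∣ b - a ↔ (k : ℤ) ∣ a - b := fun k => dvd_sub_comm
  simp only [pairCount, h, add_comm b a]

lemma pairCount_zero_left {r : ℕ} (i j : ℕ) (b : Fin r) :
    pairCount i j 0 ((b.val : ℤ) + 1) = 2 * dvdBoth i j b := by
  have h : ∀ k : ℕ, (k : ℤ) ∣ (b.val : ℤ) + 1 ↔ k ∣ b.val + 1 := fun k => by exact_mod_cast Int.natCast_dvd_natCast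
  simp only [pairCount, zero_sub, zero_add, dvd_neg, h, dvdBoth, and_comm (a := j ∣ b.val + 1)]
  ring

lemma pairCount_zero_right {r : ℕ} (i j : ℕ) (b : Fin r) :
    pairCount i j ((b.val : ℤ) + 1) 0 = 2 * dvdBoth i j b := by
  rw [pairCount_swap, pairCount_zero_left]

lemma pairCount_zero_zero (i j : ℕ) : pairCount i j 0 0 = 2 := by simp [pairCount]

/-- The matrix attached to a factorization `i * j = 2 * r + 1`. -/
def pairMat (r i j : ℕ) : Wt r → Wt r → ℕ
  | .inl p, .inl q => if p = q then 1 else 0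
  | .inl _, .inr (.inl b) => dvdBoth i j b
  | .inr (.inl a), .inl _ => dvdBoth i j a
  | .inr (.inl a), .inr (.inl b) => pairCount i j ((a.val : ℤ) + 1) ((b.val : ℤ) + 1)
  | .inr (.inr p), .inr (.inr q) => if p = q then 1 else 0
  | _, _ => 0

lemma pairMat_comm (r i j : ℕ) : pairMat r j i = pairMat r i j := by
  funext x y
  rcases x with _ | _ | _ <;> rcases y with _ | _ | _ <;> simp only [pairMat, pairCount_comm i j, dvdBoth_comm i j]

/-- The matrix attached to two factorizations of `2 * r + 1`. -/
def twoPairMat (r i j i' j' : ℕ) : Wt r → Wt r → ℕ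
  | .inl _, .inl _ => 1
  | .inl _, .inr (.inl b) => dvdBoth i j b + dvdBoth i' j' b
  | .inr (.inl a), .inl _ => dvdBoth i j a + dvdBoth i' j' a
  | .inr (.inl a), .inr (.inl b) => pairCount i j ((a.val : ℤ) + 1) ((b.val : ℤ) + 1) +
      pairCount i' j' ((a.val : ℤ) + 1) ((b.val : ℤ) + 1)
  | _, _ => 0

/-- The simple current invariant. -/
def currentMat (r : ℕ) : Wt r → Wt r → ℕ
  | .inl _, .inl _ => 1
  | .inr (.inl a), .inr (.inl b) => if a = b then 2 else 0
  | _, _ => 0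

/-- The vector of the weights that extend the vacuum in the matrix `B^{ii}`. -/
def extVec (r s : ℕ) : Wt r → ℕ
  | .inl i => if i then 0 else 1
  | .inr (.inl a) => if s ∣ a.val + 1 then 1 else 0
  | .inr (.inr q) => if q = kap r then 1 else 0

/-- The matrix `B^{ii}`, with `s = √n`. -/
def matBii (r s : ℕ) : Wt r → Wt r → ℕ := fun x y => extVec r s x * extVec r s y

/-- The matrix `B^i`, with `s = √n`. -/
def matBi (r s : ℕ) : Wt r → Wt r → ℕ
  | .inl p, .inl q => if p = false ∧ q = false then 1 else 0
  | .inl p, .inr (.inl b) => if p then 0 else if s ∣ b.val + 1 then 1 else 0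
  | .inr (.inl a), .inl p => if p then 0 else if s ∣ a.val + 1 then 1 else 0
  | .inr (.inl a), .inr (.inl b) =>
      (if s ∣ a.val + 1 then 1 else 0) * (if s ∣ b.val + 1 then 1 else 0)
  | .inr (.inr q), .inr (.inl b) => if q = kap r then if s ∣ b.val + 1 then 1 else 0 else 0
  | .inr (.inl a), .inr (.inr q) => if q = kap r then if s ∣ a.val + 1 then 1 else 0 else 0
  | .inr (.inr p), .inr (.inr q) => if p = kap r ∨ q = kap r then 0 else 1
  | .inr (.inr q), .inl p => if p = true ∧ q = kap r then 1 else 0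
  | .inl p, .inr (.inr q) => if p = true ∧ q = kap r then 1 else 0

/-- The matrix `B^{iii}`, with `s = √n`. -/
def matBiii (r s : ℕ) : Wt r → Wt r → ℕ
  | .inl p, .inl _ => if p then 0 else 1
  | .inl p, .inr (.inl b) => if p then 0 else if s ∣ b.val + 1 then 2 else 0
  | .inr (.inl a), .inl _ => if s ∣ a.val + 1 then 1 else 0
  | .inr (.inl a), .inr (.inl b) =>
      (if s ∣ a.val + 1 then 1 else 0) * (if s ∣ b.val + 1 then 2 else 0)
  | .inr (.inr q), .inr (.inl b) => if q = kap r then if s ∣ b.val + 1 then 2 else 0 else 0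
  | .inr (.inr q), .inl _ => if q = kap r then 1 else 0
  | _, .inr (.inr _) => 0

/-! ### Classification according to the entries at (0,J0), (J0,0) and (J0,J0) -/

namespace IsInvariant

variable {r : ℕ} {m : Wt r → Wt r → ℕ}

lemma eq_zero_of_chargeSign (h : IsInvariant r m) {z : Wt r} {q : Bool} (hz : chargeSign z = 1)
    (hq : ¬ (4 ∣ r ∧ q = kap r)) : m z (.inr (.inr q)) = 0 := by
  by_contra h0
  exact hq (spinor_coupling hz (h.comm_T _ _ h0))

lemma eq_zero_of_chargeSign' (h : IsInvariant r m) {z : Wt r} {q : Bool} (hz : chargeSign z = 1)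
    (hq : ¬ (4 ∣ r ∧ q = kap r)) : m (.inr (.inr q)) z = 0 :=
  h.transpose.eq_zero_of_chargeSign hz hq

lemma eq_zero_of_spinor_ne (h : IsInvariant r m) {p q : Bool} (hpq : p ≠ q) :
    m (.inr (.inr p)) (.inr (.inr q)) = 0 := by
  by_contra h0
  exact hpq (spinor_ne (h.comm_T _ _ h0))

/-- The equation `M S = S M` in a row indexed by a spinor and a column indexed by a simple
current. -/
lemma spinor_current_eq (h : IsInvariant r m) (p i : Bool) :
    ((m (.inr (.inr p)) (.inl true) + m (.inr (.inr p)) (.inl false)) / 2 +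
        ∑ b, (m (.inr (.inr p)) (.inr (.inl b)) : ℝ)) / Real.sqrt (2 * r + 1) +
      (if i then -1 else 1) * (m (.inr (.inr p)) (.inr (.inr true)) +
        m (.inr (.inr p)) (.inr (.inr false))) / 2 =
    (m (.inl false) (.inl i) - m (.inl true) (.inl i) +
      (m (.inr (.inr p)) (.inl i) - m (.inr (.inr (!p))) (.inl i)) : ℝ) / 2 := by
  have h1 := h.comm_S (.inr (.inr p)) (.inl i)
  rw [sum_wt, sum_wt] at h1
  cases p <;> cases i <;> simp [smat, ← Finset.sum_mul] at h1 ⊢ <;> linear_combination h1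

lemma spinor_gamma_eq (h : IsInvariant r m) (p : Bool) (c : Fin r) :
    ((m (.inr (.inr p)) (.inl true) + m (.inr (.inr p)) (.inl false)) +
        ∑ b : Fin r, (m (.inr (.inr p)) (.inr (.inl b)) : ℝ) * (2 * cosMatrix r b.succ c.succ)) / Real.sqrt (2 * r + 1) =
    (m (.inl false) (.inr (.inl c)) - m (.inl true) (.inr (.inl c)) +
      (m (.inr (.inr p)) (.inr (.inl c)) - m (.inr (.inr (!p))) (.inr (.inl c))) : ℝ) / 2 := by
  have h1 := h.comm_S (.inr (.inr p)) (.inr (.inl c))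
  rw [sum_wt, sum_wt] at h1
  simp only [smat_gg, ← mul_div_assoc, ← Finset.sum_div] at h1
  cases p <;> simp [smat] at h1 ⊢ <;> linear_combination h1

lemma spinor_spinor_eq (h : IsInvariant r m) (p q : Bool) :
    (m (.inr (.inr p)) (.inl false) - m (.inr (.inr p)) (.inl true) +
      (m (.inr (.inr p)) (.inr (.inr q)) - m (.inr (.inr p)) (.inr (.inr (!q)))) : ℝ) =
    (m (.inl false) (.inr (.inr q)) - m (.inl true) (.inr (.inr q)) +
      (m (.inr (.inr p)) (.inr (.inr q)) - m (.inr (.inr (!p))) (.inr (.inr q))) : ℝ) := by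
  have h1 := h.comm_S (.inr (.inr p)) (.inr (.inr q))
  rw [sum_wt, sum_wt] at h1
  cases p <;> cases q <;> simp [smat] at h1 ⊢ <;> linear_combination 2 * h1

end IsInvariant

lemma dvd_sub_add_iff {s : ℕ} (hs : Odd s) (a b : ℕ) :
    ((s : ℤ) ∣ (a : ℤ) - b ∧ (s : ℤ) ∣ (a : ℤ) + b) ↔ s ∣ a ∧ s ∣ b := by
  have hc : IsCoprime (s : ℤ) 2 := by
    obtain ⟨k, rfl⟩ := hs
    exact ⟨1, -k, by push_cast; ring⟩
  rw [← Int.natCast_dvd_natCast, ← Int.natCast_dvd_natCast]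
  constructor
  · rintro ⟨h1, h2⟩
    constructor
    · refine hc.dvd_of_dvd_mul_left ?_
      have := dvd_add h1 h2
      rwa [show (a : ℤ) - b + (a + b) = 2 * a by ring] at this
    · refine hc.dvd_of_dvd_mul_left ?_
      have := dvd_sub h2 h1
      rwa [show (a : ℤ) + b - (a - b) = 2 * b by ring] at this
  · rintro ⟨h1, h2⟩
    exact ⟨dvd_sub h1 h2, dvd_add h1 h2⟩

namespace IsInvariant

variable {r : ℕ} {m : Wt r → Wt r → ℕ}

/-- Invariance under J on both sides at once makes the rows of 0 and J0 agree on the γ's, so each is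
half of the folded row. Spinors couple only to spinors, and MS = SM gives them diagonal entry 1. -/
lemma exists_eq_pairMat (h : IsInvariant r m) (hJJ : m (.inl true) (.inl true) = 1)
    (h0J : m (.inl false) (.inl true) = 0) (hJ0 : m (.inl true) (.inl false) = 0) :
    ∃ i j, i * j = 2 * r + 1 ∧ m = pairMat r i j := by
  have h00 := h.vacuum_one
  obtain ⟨i, j, hij, hf⟩ := h.foldMat_classification.2.1 (by
    change m (.inl true) (.inl true) + m (.inl true) (.inl false) +
      (m (.inl false) (.inl true) + m (.inl false) (.inl false)) = 2
    omega)
  refine ⟨i, j, hij, ?_⟩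
  have hGG : ∀ a b : Fin r, m (.inr (.inl a)) (.inr (.inl b)) =
      pairCount i j ((a.val : ℤ) + 1) ((b.val : ℤ) + 1) := fun a b => by
    have := hf a.succ b.succ
    push_cast [Fin.val_succ] at this
    exact this
  have hVG : ∀ (p : Bool) (b : Fin r), m (.inl p) (.inr (.inl b)) = dvdBoth i j b := fun p b => by
    have h1 := hf 0 b.succ
    push_cast [Fin.val_succ, Fin.val_zero] at h1
    rw [pairCount_zero_left] at h1
    have h2 : m (.inl true) (.inr (.inl b)) = m (.inl false) (.inr (.inl b)) :=
      h.jWt_both hJJ (.inl false) (.inr (.inl b))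
    have h3 : m (.inl true) (.inr (.inl b)) + m (.inl false) (.inr (.inl b)) = 2 * dvdBoth i j b := h1
    cases p <;> omega
  have hGV : ∀ (p : Bool) (b : Fin r), m (.inr (.inl b)) (.inl p) = dvdBoth i j b := fun p b => by
    have h1 := hf b.succ 0
    push_cast [Fin.val_succ, Fin.val_zero] at h1
    rw [pairCount_zero_right] at h1
    have h2 : m (.inr (.inl b)) (.inl true) = m (.inr (.inl b)) (.inl false) :=
      h.jWt_both hJJ (.inr (.inl b)) (.inl false)
    have h3 : m (.inr (.inl b)) (.inl true) + m (.inr (.inl b)) (.inl false) = 2 * dvdBoth i j b := h1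
    cases p <;> omega
  have hP : ∀ x y, chargeSign x * chargeSign y ≠ 1 → m x y = 0 := fun x y hxy => by
    by_contra h0; exact hxy (h.charge_both hJJ h0)
  have hPV : ∀ p q, m (.inr (.inr p)) (.inl q) = 0 := fun p q => hP _ _ (by norm_num [chargeSign])
  have hPG : ∀ p a, m (.inr (.inr p)) (.inr (.inl a)) = 0 := fun p q => hP _ _ (by norm_num [chargeSign])
  have hVP : ∀ p q, m (.inl q) (.inr (.inr p)) = 0 := fun p q => hP _ _ (by norm_num [chargeSign])
  have hGP : ∀ p a, m (.inr (.inl a)) (.inr (.inr p)) = 0 := fun p q => hP _ _ (by norm_num [chargeSign])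
  have htf : m (.inr (.inr true)) (.inr (.inr false)) = 0 := h.eq_zero_of_spinor_ne (by simp)
  have hft : m (.inr (.inr false)) (.inr (.inr true)) = 0 := h.eq_zero_of_spinor_ne (by simp)
  have hPP : ∀ p, m (.inr (.inr p)) (.inr (.inr p)) = 1 := fun p => by
    have h1 := h.spinor_current_eq p false
    have h2 : (m (.inr (.inr p)) (.inr (.inr p)) : ℝ) = 1 := by
      cases p <;> simp [hPV, hPG, htf, hft, h00, hJ0] at h1 <;> linarith
    exact_mod_cast h2
  funext x y
  rcases x with p | a | p <;> rcases y with q | b | q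
  · cases p <;> cases q <;> simp [pairMat, h00, h0J, hJ0, hJJ]
  · exact hVG p b
  · exact hVP q p
  · exact hGV q a
  · exact hGG a b
  · exact hGP q a
  · exact hPV p q
  · exact hPG p b
  · cases p <;> cases q <;> simp [pairMat, hPP, htf, hft]

/-- Both charges are trivial on the support of M, so spinor rows and columns vanish and the folded
matrix contains all the information. -/
lemma exists_eq_twoPairMat (h : IsInvariant r m) (hJJ : m (.inl true) (.inl true) = 1)
    (h0J : m (.inl false) (.inl true) = 1) (hJ0 : m (.inl true) (.inl false) = 1) :
    ∃ i j i' j', i * j = 2 * r + 1 ∧ i' * j' = 2 * r + 1 ∧ m = twoPairMat r i j i' j' := by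
  have h00 := h.vacuum_one
  obtain ⟨i, j, i', j', hij, hij', hf⟩ := h.foldMat_classification.2.2 (by
    change m (.inl true) (.inl true) + m (.inl true) (.inl false) +
      (m (.inl false) (.inl true) + m (.inl false) (.inl false)) = 4
    omega)
  refine ⟨i, j, i', j', hij, hij', ?_⟩
  have hVG : ∀ (p : Bool) (b : Fin r), m (.inl p) (.inr (.inl b)) = dvdBoth i j b + dvdBoth i' j' b := fun p b => by
    have h1 := hf 0 b.succ
    push_cast [Fin.val_succ, Fin.val_zero] at h1
    rw [pairCount_zero_left, pairCount_zero_left] at h1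
    have h2 : m (.inl true) (.inr (.inl b)) = m (.inl false) (.inr (.inl b)) :=
      h.jWt_both hJJ (.inl false) (.inr (.inl b))
    have h3 : m (.inl true) (.inr (.inl b)) + m (.inl false) (.inr (.inl b)) =
      2 * dvdBoth i j b + 2 * dvdBoth i' j' b := h1
    cases p <;> omega
  have hGV : ∀ (p : Bool) (b : Fin r), m (.inr (.inl b)) (.inl p) = dvdBoth i j b + dvdBoth i' j' b := fun p b => by
    have h1 := hf b.succ 0
    push_cast [Fin.val_succ, Fin.val_zero] at h1
    rw [pairCount_zero_right, pairCount_zero_right] at h1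
    have h2 : m (.inr (.inl b)) (.inl true) = m (.inr (.inl b)) (.inl false) :=
      h.jWt_both hJJ (.inr (.inl b)) (.inl false)
    have h3 : m (.inr (.inl b)) (.inl true) + m (.inr (.inl b)) (.inl false) =
      2 * dvdBoth i j b + 2 * dvdBoth i' j' b := h1
    cases p <;> omega
  have hPl : ∀ p y, m (.inr (.inr p)) y = 0 := fun p y => by
    by_contra h0
    have := h.charge_left hJ0 h0
    norm_num [chargeSign] at this
  have hPr : ∀ x p, m x (.inr (.inr p)) = 0 := fun x p => by
    by_contra h0
    have := h.charge_right h0J h0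
    norm_num [chargeSign] at this
  funext x y
  rcases x with p | a | p <;> rcases y with q | b | q
  · cases p <;> cases q <;> simp [twoPairMat, h00, h0J, hJ0, hJJ]
  · exact hVG p b
  · exact hPr _ _
  · exact hGV q a
  · have := hf a.succ b.succ
    push_cast [Fin.val_succ] at this
    exact this
  · exact hPr _ _
  · exact hPl _ _
  · exact hPl _ _
  · exact hPl _ _

/-- Write λ and μ for the spinors named by `kap r` and its negation. Spinor columns vanish by charge
conservation, and the row of μ vanishes by T. The equations in the rows of μ and λ then force n to
be a square and i = j = √n. -/
lemma exists_eq_matBiii (h : IsInvariant r m) (hJJ : m (.inl true) (.inl true) = 0)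
    (h0J : m (.inl false) (.inl true) = 1) (hJ0 : m (.inl true) (.inl false) = 0) :
    ∃ s, s * s = 2 * r + 1 ∧ m = matBiii r s := by
  have h00 := h.vacuum_one
  have hn : (0 : ℝ) < 2 * r + 1 := by positivity
  obtain ⟨i, j, hij, hf⟩ := h.foldMat_classification.2.1 (by
    change m (.inl true) (.inl true) + m (.inl true) (.inl false) +
      (m (.inl false) (.inl true) + m (.inl false) (.inl false)) = 2
    omega)
  have hVG : ∀ (b : Fin r), m (.inl true) (.inr (.inl b)) + m (.inl false) (.inr (.inl b)) =
      2 * dvdBoth i j b := fun b => by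
    have h1 := hf 0 b.succ
    push_cast [Fin.val_succ, Fin.val_zero] at h1
    rw [pairCount_zero_left] at h1
    exact h1
  have hPr : ∀ x p, m x (.inr (.inr p)) = 0 := fun x p => by
    by_contra h0
    have := h.charge_right h0J h0
    norm_num [chargeSign] at this
  have hVr : ∀ x, m x (.inl true) = m x (.inl false) := fun x => h.jWt_right h0J x (.inl false)
  have hGV : ∀ (p : Bool) (b : Fin r), m (.inr (.inl b)) (.inl p) = dvdBoth i j b := fun p b => by
    have h1 := hf b.succ 0
    push_cast [Fin.val_succ, Fin.val_zero] at h1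
    rw [pairCount_zero_right] at h1
    have h2 := hVr (.inr (.inl b))
    have h3 : m (.inr (.inl b)) (.inl true) + m (.inr (.inl b)) (.inl false) = 2 * dvdBoth i j b := h1
    cases p <;> omega
  -- Otherwise all spinor rows vanish, and the equation in a spinor row and the vacuum column would
  -- read 0 = 1/2.
  have h4 : 4 ∣ r := by
    by_contra h4
    have hz : ∀ z : Wt r, chargeSign z = 1 → ∀ p, m (.inr (.inr p)) z = 0 := fun z hz p =>
      h.eq_zero_of_chargeSign' hz fun hc => h4 hc.1
    have h1 := h.spinor_current_eq true false
    simp [hz _ (show chargeSign (r := r) (.inl false) = 1 from rfl),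
      hz _ (show chargeSign (r := r) (.inl true) = 1 from rfl),
      fun a => hz _ (show chargeSign (r := r) (.inr (.inl a)) = 1 from rfl), hPr, h00, hJ0] at h1
  have hmu : ∀ y, m (.inr (.inr (!kap r))) y = 0 := by
    intro y
    have hk : ¬ (4 ∣ r ∧ (!kap r) = kap r) := fun hc => by simpa using hc.2
    rcases y with q | b | q
    · exact h.eq_zero_of_chargeSign' rfl hk
    · exact h.eq_zero_of_chargeSign' rfl hk
    · exact hPr _ _
  have hlam0 : m (.inr (.inr (kap r))) (.inl false) = 1 := by
    have h1 := h.spinor_current_eq (!kap r) false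
    simp [hmu, h00, hJ0] at h1
    have : (m (.inr (.inr (kap r))) (.inl false) : ℝ) = 1 := by linarith
    exact_mod_cast this
  have hlam1 : m (.inr (.inr (kap r))) (.inl true) = 1 := by rw [hVr, hlam0]
  have hx : ∀ c : Fin r, m (.inl true) (.inr (.inl c)) + m (.inr (.inr (kap r))) (.inr (.inl c)) =
      m (.inl false) (.inr (.inl c)) := fun c => by
    have h1 := h.spinor_gamma_eq (!kap r) c
    simp only [hmu, Bool.not_not, Nat.cast_zero, zero_mul, Finset.sum_const_zero, add_zero, zero_div] at h1
    have : (m (.inl true) (.inr (.inl c)) + m (.inr (.inr (kap r))) (.inr (.inl c)) : ℝ) =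
      m (.inl false) (.inr (.inl c)) := by linarith
    exact_mod_cast this
  -- The row of λ against the vacuum column gives 1 + ∑ M_{λγ} = √n, so √n is an integer.
  have hsum : 1 + ∑ b, m (.inr (.inr (kap r))) (.inr (.inl b)) = Nat.sqrt (2 * r + 1) ∧
      IsSquare (2 * r + 1) := by
    have h1 := h.spinor_current_eq (kap r) false
    simp only [hlam0, hlam1, hPr, hmu, h00, hJ0] at h1
    have hs : Real.sqrt (2 * (r : ℝ) + 1) ≠ 0 := (Real.sqrt_pos.2 hn).ne'
    have h2 : ((1 + ∑ b, m (.inr (.inr (kap r))) (.inr (.inl b)) : ℕ) : ℝ) = Real.sqrt (2 * r + 1) := by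
      push_cast
      field_simp at h1
      norm_num at h1
      linarith
    have h3 : (1 + ∑ b, m (.inr (.inr (kap r))) (.inr (.inl b))) *
        (1 + ∑ b, m (.inr (.inr (kap r))) (.inr (.inl b))) = 2 * r + 1 := by
      have h4 := Real.mul_self_sqrt hn.le
      rw [← h2] at h4
      exact_mod_cast h4
    exact ⟨by rw [← h3, Nat.sqrt_eq], ⟨_, h3.symm⟩⟩
  obtain ⟨hsum, s, hs⟩ := hsum
  rw [hs, Nat.sqrt_eq] at hsum
  set g := Nat.gcd i j with hg
  set d := Nat.lcm i j with hd
  have hgd : g * d = 2 * r + 1 := by rw [hg, hd, Nat.gcd_mul_lcm, hij]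
  have hdvd : ∀ b : Fin r, dvdBoth i j b = if d ∣ b.val + 1 then 1 else 0 := fun b => by
    simp only [dvdBoth, hd, Nat.lcm_dvd_iff]
  have hg_sum : 1 + ∑ b : Fin r, 2 * dvdBoth i j b = g := by
    simp only [hdvd, ← Finset.mul_sum]
    exact sum_indicator_dvd hgd
  have hle : ∀ b : Fin r, m (.inr (.inr (kap r))) (.inr (.inl b)) ≤ 2 * dvdBoth i j b := fun b => by
    have := hx b; have := hVG b; omega
  have hsg : s ≤ g := by
    rw [← hsum, ← hg_sum]
    exact Nat.add_le_add_left (Finset.sum_le_sum fun b _ => hle b) 1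
  have hg0 : 0 < g := Nat.pos_of_ne_zero (by intro h0; rw [h0] at hgd; omega)
  have hgd_le : g ≤ d := Nat.le_of_dvd (Nat.pos_of_ne_zero (by intro h0; rw [h0] at hgd; omega))
    ((Nat.gcd_dvd_left i j).trans (Nat.dvd_lcm_left i j))
  -- Here M_{λγ} ≤ 2 · `dvdBoth` gives s ≤ g, while g ∣ d and gd = s² give g ≤ s. With gcd and lcm
  -- both equal to s, also i = j = s.
  have hgs : g = s := by
    refine le_antisymm ?_ hsg
    by_contra hc
    have : s * s < g * d := Nat.mul_lt_mul'' (by omega) (by omega)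
    omega
  have hds : d = s := by
    have : g * d = g * s := by rw [hgd, hs, hgs]
    exact Nat.eq_of_mul_eq_mul_left hg0 this
  have hi : i = s := Nat.dvd_antisymm (by rw [← hds]; exact Nat.dvd_lcm_left i j)
    (by rw [← hgs]; exact Nat.gcd_dvd_left i j)
  have hj : j = s := Nat.dvd_antisymm (by rw [← hds]; exact Nat.dvd_lcm_right i j)
    (by rw [← hgs]; exact Nat.gcd_dvd_right i j)
  have hodd : Odd s := by
    have : Odd (s * s) := by rw [← hs]; exact ⟨r, rfl⟩
    exact (Nat.odd_mul.1 this).1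
  have heq : ∀ b : Fin r, m (.inr (.inr (kap r))) (.inr (.inl b)) = 2 * dvdBoth i j b := by
    have h1 : ∑ b, m (.inr (.inr (kap r))) (.inr (.inl b)) = ∑ b : Fin r, 2 * dvdBoth i j b := by omega
    intro b
    exact (Finset.sum_eq_sum_iff_of_le fun b _ => hle b).1 h1 b (Finset.mem_univ _)
  refine ⟨s, hs.symm, ?_⟩
  have hdvd2 : ∀ b : Fin r, 2 * dvdBoth i j b = if s ∣ b.val + 1 then 2 else 0 := fun b => by
    rw [hdvd, hds]; split_ifs <;> rfl
  funext x y
  rcases x with p | a | p <;> rcases y with q | b | q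
  · cases p <;> cases q <;> simp [matBiii, h00, h0J, hJ0, hJJ]
  · have h1 := hx b
    have h2 := hVG b
    have h3 := heq b
    rw [hdvd2] at h2 h3
    cases p <;> simp only [matBiii, Bool.false_eq_true, if_false, if_true] <;> omega
  · exact hPr _ _
  · rw [hGV, hdvd, hds]; rfl
  · have h1 := hf a.succ b.succ
    simp only [hi, hj, pairCount, dvd_sub_add_iff hodd] at h1
    refine (show m (.inr (.inl a)) (.inr (.inl b)) = _ from h1).trans ?_
    simp only [Fin.val_succ, matBiii]
    by_cases ha : s ∣ a.val + 1 <;> by_cases hb : s ∣ b.val + 1 <;> simp [ha, hb]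
  · exact hPr _ _
  · by_cases hp : p = kap r
    · subst hp; cases q <;> simp [matBiii, hlam0, hlam1]
    · obtain rfl : p = !kap r := by revert hp; generalize kap r = k; revert p k; decide
      simp [matBiii, hmu]
  · by_cases hp : p = kap r
    · subst hp; rw [heq, hdvd2]; simp [matBiii]
    · obtain rfl : p = !kap r := by revert hp; generalize kap r = k; revert p k; decide
      simp [matBiii, hmu]
  · exact hPr _ _

/-- The rows of an exceptional invariant indexed by the spinors. -/
lemma spinor_rows (h : IsInvariant r m) (hJJ : m (.inl true) (.inl true) = 0)
    (h0J : m (.inl false) (.inl true) = 0) (hJ0 : m (.inl true) (.inl false) = 0) :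
    m (.inr (.inr (!kap r))) (.inr (.inr (!kap r))) + m (.inr (.inr (kap r))) (.inl false) = 1 ∧
    m (.inr (.inr (kap r))) (.inl true) = m (.inr (.inr (!kap r))) (.inr (.inr (!kap r))) ∧
    ∀ c : Fin r, m (.inl true) (.inr (.inl c)) + m (.inr (.inr (kap r))) (.inr (.inl c)) =
      m (.inl false) (.inr (.inl c)) := by
  have h00 := h.vacuum_one
  have hk : ¬ (4 ∣ r ∧ (!kap r) = kap r) := fun hc => by simpa using hc.2
  have hz : ∀ z : Wt r, chargeSign z = 1 → m (.inr (.inr (!kap r))) z = 0 := fun z hz =>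
    h.eq_zero_of_chargeSign' hz hk
  have hzV : ∀ i, m (.inr (.inr (!kap r))) (.inl i) = 0 := fun i => hz _ rfl
  have hzG : ∀ i, m (.inr (.inr (!kap r))) (.inr (.inl i)) = 0 := fun i => hz _ rfl
  have hzP : m (.inr (.inr (!kap r))) (.inr (.inr (kap r))) = 0 := h.eq_zero_of_spinor_ne (by simp)
  have hsum : ((m (.inr (.inr (!kap r))) (.inr (.inr true)) : ℝ) +
      m (.inr (.inr (!kap r))) (.inr (.inr false))) = m (.inr (.inr (!kap r))) (.inr (.inr (!kap r))) := by
    revert hzP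
    cases kap r <;> intro hzP <;> simp at hzP <;> simp [hzP]
  refine ⟨?_, ?_, fun c => ?_⟩
  · have h1 := h.spinor_current_eq (!kap r) false
    rw [hsum] at h1
    simp [hzV, hzG, h00, hJ0] at h1
    have : (m (.inr (.inr (!kap r))) (.inr (.inr (!kap r))) + m (.inr (.inr (kap r))) (.inl false) : ℝ) = 1 := by
      linarith
    exact_mod_cast this
  · have h1 := h.spinor_current_eq (!kap r) true
    rw [hsum] at h1
    simp only [hzV, hzG, h0J, hJJ, Bool.not_not, if_true, Nat.cast_zero, Finset.sum_const_zero, add_zero,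
      zero_div, zero_sub, sub_zero, zero_add] at h1
    have : (m (.inr (.inr (kap r))) (.inl true) : ℝ) = m (.inr (.inr (!kap r))) (.inr (.inr (!kap r))) := by
      linarith
    exact_mod_cast this
  · have h1 := h.spinor_gamma_eq (!kap r) c
    simp [hzV, hzG] at h1
    have : (m (.inl true) (.inr (.inl c)) + m (.inr (.inr (kap r))) (.inr (.inl c)) : ℝ) =
      m (.inl false) (.inr (.inl c)) := by linarith
    exact_mod_cast this

/-- The folded entry 1 at the origin forces n = s². Everything else is then determined by the
diagonal entry at the spinor μ named by `!kap r`: it is 1 for B^i and 0 for B^ii. -/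
lemma exists_eq_matBi_or (h : IsInvariant r m) (hJJ : m (.inl true) (.inl true) = 0)
    (h0J : m (.inl false) (.inl true) = 0) (hJ0 : m (.inl true) (.inl false) = 0) :
    ∃ s, s * s = 2 * r + 1 ∧ (m = matBi r s ∨ m = matBii r s) := by
  have h00 := h.vacuum_one
  obtain ⟨s, hs, hf⟩ := h.foldMat_classification.1 (by
    change m (.inl true) (.inl true) + m (.inl true) (.inl false) +
      (m (.inl false) (.inl true) + m (.inl false) (.inl false)) = 1
    omega)
  refine ⟨s, hs, ?_⟩
  have hodd : Odd s := by
    have : Odd (s * s) := by rw [hs]; exact ⟨r, rfl⟩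
    exact (Nat.odd_mul.1 this).1
  -- An odd square is 1 modulo 8.
  have h4 : 4 ∣ r := by
    obtain ⟨k, hk⟩ := hodd
    have h1 := (Nat.even_mul_succ_self k).two_dvd
    have h2 : s * s = 4 * (k * (k + 1)) + 1 := by rw [hk]; ring
    omega
  have hGG : ∀ a b : Fin r, m (.inr (.inl a)) (.inr (.inl b)) =
      (if s ∣ a.val + 1 then 1 else 0) * (if s ∣ b.val + 1 then 1 else 0) := fun a b => by
    have h1 := hf a.succ b.succ
    simp only [dvd_sub_add_iff hodd] at h1
    refine (show m (.inr (.inl a)) (.inr (.inl b)) = _ from h1).trans ?_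
    simp only [Fin.val_succ]
    by_cases ha : s ∣ a.val + 1 <;> by_cases hb : s ∣ b.val + 1 <;> simp [ha, hb]
  have hVG : ∀ b : Fin r, m (.inl true) (.inr (.inl b)) + m (.inl false) (.inr (.inl b)) =
      if s ∣ b.val + 1 then 1 else 0 := fun b => by
    have h1 := hf 0 b.succ
    simp only [dvd_sub_add_iff hodd] at h1
    refine (show _ + _ = _ from h1).trans ?_
    simp
  have hGV : ∀ b : Fin r, m (.inr (.inl b)) (.inl true) + m (.inr (.inl b)) (.inl false) =
      if s ∣ b.val + 1 then 1 else 0 := fun b => by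
    have h1 := hf b.succ 0
    simp only [dvd_sub_add_iff hodd] at h1
    refine (show _ + _ = _ from h1).trans ?_
    simp
  obtain ⟨hr1, hr2, hr3⟩ := h.spinor_rows hJJ h0J hJ0
  obtain ⟨hc1, hc2, hc3⟩ := h.transpose.spinor_rows hJJ hJ0 h0J
  have hk : ¬ (4 ∣ r ∧ (!kap r) = kap r) := fun hc => by simpa using hc.2
  have hzr : ∀ z : Wt r, chargeSign z = 1 → m (.inr (.inr (!kap r))) z = 0 := fun z hz =>
    h.eq_zero_of_chargeSign' hz hk
  have hzc : ∀ z : Wt r, chargeSign z = 1 → m z (.inr (.inr (!kap r))) = 0 := fun z hz =>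
    h.eq_zero_of_chargeSign hz hk
  have hzP : m (.inr (.inr (!kap r))) (.inr (.inr (kap r))) = 0 := h.eq_zero_of_spinor_ne (by simp)
  have hzP' : m (.inr (.inr (kap r))) (.inr (.inr (!kap r))) = 0 := h.eq_zero_of_spinor_ne (by simp)
  -- The row of μ against the column of λ, combined with the column relations `hc1` and `hc2`.
  have hy : m (.inr (.inr (kap r))) (.inr (.inr (kap r))) +
      m (.inr (.inr (!kap r))) (.inr (.inr (!kap r))) = 1 := by
    have h1 := h.spinor_spinor_eq (!kap r) (kap r)
    simp only [hzr (.inl _) rfl, hzP, Bool.not_not] at h1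
    have h2 : (m (.inl true) (.inr (.inr (kap r))) + m (.inr (.inr (kap r))) (.inr (.inr (kap r))) : ℝ) =
      m (.inr (.inr (!kap r))) (.inr (.inr (!kap r))) + m (.inl false) (.inr (.inr (kap r))) := by
      push_cast at h1; linarith
    have h3 : m (.inl true) (.inr (.inr (kap r))) + m (.inr (.inr (kap r))) (.inr (.inr (kap r))) =
      m (.inr (.inr (!kap r))) (.inr (.inr (!kap r))) + m (.inl false) (.inr (.inr (kap r))) := by
      exact_mod_cast h2
    omega
  have hbool : ∀ p : Bool, p = kap r ∨ p = !kap r := by generalize kap r = k; revert k; decide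
  have hne : (!kap r) ≠ kap r := by simp
  have hM : m (.inr (.inr (!kap r))) (.inr (.inr (!kap r))) = 1 ∨
      m (.inr (.inr (!kap r))) (.inr (.inr (!kap r))) = 0 := by omega
  refine hM.imp (fun hM => ?_) fun hM => ?_
  · rw [hM] at hr1 hr2 hc1 hc2 hy
    funext x y
    rcases x with p | a | p <;> rcases y with q | b | q
    · cases p <;> cases q <;> simp [matBi, h00, h0J, hJ0, hJJ]
    · have h1 := hr3 b
      have h2 := hVG b
      cases p <;> simp only [matBi, Bool.false_eq_true, if_false, if_true] <;> split_ifs at h2 ⊢ <;> omega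
    · rcases hbool q with rfl | rfl
      · cases p
        · simp only [matBi]; simp; omega
        · simp only [matBi]; simp; omega
      · simp only [matBi, hne, and_false, if_false]; exact hzc _ rfl
    · have h1 := hc3 a
      have h2 := hGV a
      cases q <;> simp only [matBi, Bool.false_eq_true, if_false, if_true] <;> split_ifs at h2 ⊢ <;> omega
    · exact hGG a b
    · rcases hbool q with rfl | rfl
      · have h1 := hc3 a
        have h2 := hGV a
        simp only [matBi, if_true]; split_ifs at h2 ⊢ <;> omega
      · simp only [matBi, hne, if_false]; exact hzc _ rfl
    · rcases hbool p with rfl | rfl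
      · cases q
        · simp only [matBi]; simp; omega
        · simp only [matBi]; simp; omega
      · simp only [matBi, hne, and_false, if_false]; exact hzr _ rfl
    · rcases hbool p with rfl | rfl
      · have h1 := hr3 b
        have h2 := hVG b
        simp only [matBi, if_true]; split_ifs at h2 ⊢ <;> omega
      · simp only [matBi, hne, if_false]; exact hzr _ rfl
    · rcases hbool p with rfl | rfl <;> rcases hbool q with rfl | rfl <;> simp [matBi, hM, hzP, hzP']
      omega
  · rw [hM] at hr1 hr2 hc1 hc2 hy
    funext x y
    rcases x with p | a | p <;> rcases y with q | b | q
    · cases p <;> cases q <;> simp [matBii, extVec, h00, h0J, hJ0, hJJ]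
    · have h1 := hr3 b
      have h2 := hVG b
      cases p <;> simp only [matBii, extVec, Bool.false_eq_true, if_false, if_true, zero_mul, one_mul] <;>
        split_ifs at h2 ⊢ <;> omega
    · rcases hbool q with rfl | rfl
      · cases p <;> simp [matBii, extVec] <;> omega
      · simp only [matBii, extVec, hne, if_false, mul_zero]; exact hzc _ rfl
    · have h1 := hc3 a
      have h2 := hGV a
      cases q <;> simp only [matBii, extVec, Bool.false_eq_true, if_false, if_true, mul_zero, mul_one] <;>
        split_ifs at h2 ⊢ <;> omega
    · exact hGG a b
    · rcases hbool q with rfl | rfl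
      · have h1 := hc3 a
        have h2 := hGV a
        simp only [matBii, extVec, if_true, mul_one]; split_ifs at h2 ⊢ <;> omega
      · simp only [matBii, extVec, hne, if_false, mul_zero]; exact hzc _ rfl
    · rcases hbool p with rfl | rfl
      · cases q <;> simp [matBii, extVec] <;> omega
      · simp only [matBii, extVec, hne, if_false, zero_mul]; exact hzr _ rfl
    · rcases hbool p with rfl | rfl
      · have h1 := hr3 b
        have h2 := hVG b
        simp only [matBii, extVec, if_true, one_mul]; split_ifs at h2 ⊢ <;> omega
      · simp only [matBii, extVec, hne, if_false, zero_mul]; exact hzr _ rfl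
    · rcases hbool p with rfl | rfl <;> rcases hbool q with rfl | rfl <;>
        simp [matBii, extVec, hM, hzP, hzP']
      omega

/-- If two of the three entries are 1, J-invariance makes the third one 1, which leaves five cases;
the two off-diagonal ones are exchanged by transposition. -/
theorem classification (h : IsInvariant r m) :
    (∃ i j, i * j = 2 * r + 1 ∧ m = pairMat r i j) ∨
    (∃ i j i' j', i * j = 2 * r + 1 ∧ i' * j' = 2 * r + 1 ∧ m = twoPairMat r i j i' j') ∨
    ∃ s, s * s = 2 * r + 1 ∧ (m = matBi r s ∨ m = matBii r s ∨ m = matBiii r s ∨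
      m = fun x y => matBiii r s y x) := by
  have hl := h.current_left_le
  have hr := h.current_right_le
  have hb := h.current_both_le
  have h1 : m (.inl true) (.inl false) = 1 → m (.inl true) (.inl true) = m (.inl false) (.inl true) :=
    fun h1 => h.jWt_left h1 (.inl false) (.inl true)
  have h2 : m (.inl false) (.inl true) = 1 → m (.inl true) (.inl true) = m (.inl true) (.inl false) :=
    fun h1 => h.jWt_right h1 (.inl true) (.inl false)
  have h3 : m (.inl true) (.inl true) = 1 → m (.inl true) (.inl false) = m (.inl false) (.inl true) :=
    fun h1 => h.jWt_both h1 (.inl false) (.inl true)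
  rcases Nat.le_one_iff_eq_zero_or_eq_one.1 hb with hJJ | hJJ
  · rcases Nat.le_one_iff_eq_zero_or_eq_one.1 hl with hJ0 | hJ0
    · rcases Nat.le_one_iff_eq_zero_or_eq_one.1 hr with h0J | h0J
      · obtain ⟨s, hs, h⟩ := h.exists_eq_matBi_or hJJ h0J hJ0
        exact .inr (.inr ⟨s, hs, by tauto⟩)
      · obtain ⟨s, hs, h⟩ := h.exists_eq_matBiii hJJ h0J hJ0
        exact .inr (.inr ⟨s, hs, by tauto⟩)
    · have h0J : m (.inl false) (.inl true) = 0 := by rw [← h1 hJ0, hJJ]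
      obtain ⟨s, hs, h⟩ := h.transpose.exists_eq_matBiii hJJ hJ0 h0J
      refine .inr (.inr ⟨s, hs, .inr (.inr (.inr ?_))⟩)
      funext x y
      exact congrFun (congrFun h y) x
  · rcases Nat.le_one_iff_eq_zero_or_eq_one.1 hl with hJ0 | hJ0
    · exact .inl (h.exists_eq_pairMat hJJ (by rw [← h3 hJJ, hJ0]) hJ0)
    · exact .inr (.inl (h.exists_eq_twoPairMat hJJ (by rw [← h3 hJJ, hJ0]) hJ0))

end IsInvariant

/-! ### The entries of the matrices in the list -/

lemma simpleCurrent_simpleCurrent {r k : ℕ} (mu : PPlus r k) : simpleCurrent (simpleCurrent mu) = mu := by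
  apply Subtype.ext
  funext i
  simp only [simpleCurrent, Equiv.swap_apply_self]

lemma simpleCurrent_gam_succ {r : ℕ} (hr : 3 ≤ r) (a : Fin r) :
    simpleCurrent (gam r a.succ) = gam r a.succ := by
  apply Subtype.ext
  funext i
  have h := gam_label_zero_one hr a
  simp only [simpleCurrent]
  by_cases h0 : i = 0
  · rw [h0, Equiv.swap_apply_left, h]
  · by_cases h1 : i = 1
    · rw [h1, Equiv.swap_apply_right, h]
    · rw [Equiv.swap_apply_of_ne_of_ne h0 h1]

lemma simpleCurrent_wt {r : ℕ} (hr : 3 ≤ r) (x : Wt r) : simpleCurrent (wt r x) = wt r (jWt x) := by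
  rcases x with (_ | _) | a | (_ | _)
  · rfl
  · exact simpleCurrent_simpleCurrent _
  · exact simpleCurrent_gam_succ hr a
  · rfl
  · exact simpleCurrent_simpleCurrent _

/-- The name of the weight `J^i γ^a`. -/
def gamWt {r : ℕ} (i : Fin 2) : Fin (r + 1) → Wt r :=
  Fin.cases (.inl (i = 1)) fun a => .inr (.inl a)

lemma iterate_simpleCurrent_gam {r : ℕ} (hr : 3 ≤ r) (i : Fin 2) (a : Fin (r + 1)) :
    simpleCurrent^[i.val] (gam r a) = wt r (gamWt i a) := by
  refine Fin.cases ?_ (fun a => ?_) a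
  · fin_cases i <;> rfl
  · fin_cases i
    · rfl
    · exact simpleCurrent_gam_succ hr a

lemma iterate_simpleCurrent_spinor {r : ℕ} (i : Fin 2) :
    simpleCurrent^[i.val] (spinor r) = wt r (.inr (.inr (i = 1))) := by
  fin_cases i <;> rfl

/-- `P a b` for some `i`, `a` and `b` such that the weights are `J^i γ^a` and `J^i γ^b`. -/
def GamRel {r : ℕ} (P : Fin (r + 1) → Fin (r + 1) → Prop) : Wt r → Wt r → Prop
  | .inl p, .inl q => p = q ∧ P 0 0
  | .inl _, .inr (.inl b) => P 0 b.succ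
  | .inr (.inl a), .inl _ => P a.succ 0
  | .inr (.inl a), .inr (.inl b) => P a.succ b.succ
  | _, _ => False

/-- For a ≥ 1 the weight γ^a is fixed by J, so the existential over J^i matters only when both
weights are 0 or J0. -/
lemma exists_gam_iff {r : ℕ} (hr : 3 ≤ r) (P : Fin (r + 1) → Fin (r + 1) → Prop) (x y : Wt r) :
    (∃ (i : Fin 2) (a b : Fin (r + 1)), wt r x = simpleCurrent^[i.val] (gam r a) ∧
      wt r y = simpleCurrent^[i.val] (gam r b) ∧ P a b) ↔ GamRel P x y := by
  simp only [iterate_simpleCurrent_gam hr, (wt_injective hr).eq_iff]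
  rcases x with p | a | p <;> rcases y with q | b | q <;>
    simp [Fin.exists_fin_succ, gamWt, GamRel]
  cases p <;> cases q <;> simp

lemma exists_spinor_iff {r : ℕ} (hr : 3 ≤ r) (x y : Wt r) :
    (∃ i : Fin 2, wt r x = simpleCurrent^[i.val] (spinor r) ∧
      wt r y = simpleCurrent^[i.val] (spinor r)) ↔ ∃ p, x = .inr (.inr p) ∧ y = .inr (.inr p) := by
  simp only [iterate_simpleCurrent_spinor, (wt_injective hr).eq_iff]
  constructor
  · rintro ⟨i, h⟩; exact ⟨_, h⟩
  · rintro ⟨p, h⟩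
    cases p
    · exact ⟨0, h⟩
    · exact ⟨1, h⟩

/-- Away from index 0 this is `Matched.pairCount_eq`. When a or b is 0 the clause with value 2 is
excluded by definition and the clause with value 1 applies, in accordance with `dvdBoth`. -/
theorem calB_wt {r d l i j : ℕ} (hr : 3 ≤ r) (h : Matched (2 * r + 1) d l i j) (x y : Wt r) :
    calB r d l (wt r x) (wt r y) = (pairMat r i j x y : ℂ) := by
  have hpc := h.pairCount_eq ⟨r, rfl⟩
  have hd : ∀ b : Fin r, dvdBoth i j b = if d ∣ b.val + 1 then 1 else 0 := fun b => by
    have := h.2.2.1 ((b.val + 1 : ℕ) : ℤ)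
    simp only [Int.natCast_dvd_natCast] at this
    simp only [dvdBoth, this]
  have hn : ∀ a : ℕ, ((2 * r + 1 : ℕ) : ℤ) ∣ (d : ℤ) * a ↔ 2 * r + 1 ∣ d * a := fun a => by
    rw [← Int.natCast_mul, Int.natCast_dvd_natCast]
  have e1 := exists_gam_iff hr (fun a b => d ∣ a.val ∧ d ∣ b.val ∧ a ≠ 0 ∧ b ≠ 0) x y
  have e2 := exists_gam_iff hr (fun a b => (2 * r + 1) ∣ d * a.val ∧
        ((b.val : ℤ) ≡ a.val * l [ZMOD d] ∨ (b.val : ℤ) ≡ -(a.val * l) [ZMOD d])) x y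
  classical
  refine (if_congr e1 rfl (if_congr e2 rfl (if_congr (exists_spinor_iff hr x y) rfl rfl))).trans ?_
  rcases x with p | a | p <;> rcases y with q | b | q
  · cases p <;> cases q <;> simp [GamRel, pairMat, Int.ModEq.refl]
  · have hz : ((b.val : ℤ) + 1 ≡ 0 [ZMOD d]) ↔ d ∣ b.val + 1 := by
      rw [Int.modEq_zero_iff_dvd]; exact_mod_cast Int.natCast_dvd_natCast
    simp [GamRel, pairMat, hd, hz]
  · simp [GamRel, pairMat]
  · have h1 := hpc ((a.val : ℤ) + 1) 0
    rw [pairCount_zero_right, hd] at h1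
    have h2 : (d : ℤ) ∣ (a.val : ℤ) + 1 ↔ d ∣ a.val + 1 := by exact_mod_cast Int.natCast_dvd_natCast
    have h3 := hn (a.val + 1)
    push_cast at h3
    simp only [h2, dvd_zero, and_true] at h1
    by_cases hda : d ∣ a.val + 1
    · have h4 : 2 * r + 1 ∣ d * (a.val + 1) := by
        have h5 : (2 * r + 1) ∣ d * d := h.2.1
        exact h5.trans (Nat.mul_dvd_mul_left d hda)
      have h6 : (0 : ℤ) ≡ ((a.val : ℤ) + 1) * l [ZMOD d] :=
        (Int.modEq_zero_iff_dvd.2 (Dvd.dvd.mul_right (h2.2 hda) _)).symm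
      simp [GamRel, pairMat, hd, hda, h4, h6]
    · simp only [hda, if_false, mul_zero] at h1
      have h7 : ¬ (2 * r + 1 ∣ d * (a.val + 1) ∧ ((0 : ℤ) ≡ ((a.val : ℤ) + 1) * l [ZMOD d] ∨
          (0 : ℤ) ≡ -(((a.val : ℤ) + 1) * l) [ZMOD d])) := by
        intro h7
        rw [if_pos] at h1
        · simp at h1
        · exact ⟨by push_cast; exact h3.2 h7.1, h7.2⟩
      have h8 : ¬ GamRel (fun a b => (2 * r + 1) ∣ d * a.val ∧
        ((b.val : ℤ) ≡ a.val * l [ZMOD d] ∨ (b.val : ℤ) ≡ -(a.val * l) [ZMOD d]))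
        (.inr (.inl a)) (.inl q) := by
        intro h8
        apply h7
        simpa [GamRel] using h8
      simp [h8, pairMat, hd, hda]
      simp [GamRel]
  · have h1 := hpc ((a.val : ℤ) + 1) ((b.val : ℤ) + 1)
    have h2 : ∀ a : Fin r, (d : ℤ) ∣ (a.val : ℤ) + 1 ↔ d ∣ a.val + 1 := fun a => by
      exact_mod_cast Int.natCast_dvd_natCast
    have h3 := hn (a.val + 1)
    push_cast at h3
    push_cast at h1
    simp only [h2, h3] at h1
    simp only [GamRel, pairMat, h1, Fin.val_succ, ne_eq, Fin.succ_ne_zero, not_false_eq_true, and_true]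
    push_cast
    simp
  · simp [GamRel, pairMat]
  · simp [GamRel, pairMat]
  · simp [GamRel, pairMat]
  · simp [GamRel, pairMat, eq_comm]

lemma label_last {r : ℕ} (hr : 3 ≤ r) (x : Wt r) :
    (∃ k : ℤ, (((wt r x).1 (Fin.last r) : ℕ) : ℚ) / 2 = k) ↔ chargeSign x = 1 := by
  have h1l := fin_one_ne_last hr
  have h0l := fin_zero_ne_last hr
  have hsw : Equiv.swap 0 1 (Fin.last r) = Fin.last r :=
    Equiv.swap_apply_of_ne_of_ne h0l.symm h1l.symm
  have hhalf : ¬ ∃ k : ℤ, (1 / 2 : ℚ) = k := by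
    rintro ⟨k, hk⟩
    have : (2 * k : ℚ) = 1 := by rw [← hk]; norm_num
    have : 2 * k = 1 := by exact_mod_cast this
    omega
  rcases x with (_ | _) | a | (_ | _)
  · simp [wt, gam, chargeSign, h0l]
    exact ⟨0, by simp⟩
  · simp [wt, gam, simpleCurrent, chargeSign, hsw]
    exact ⟨0, by simp [h0l.symm]⟩
  · simp only [wt, gam, chargeSign, Fin.succ_ne_zero, if_false, iff_true]
    split_ifs with h1 h2
    · exact ⟨0, by simp [h0l.symm, h1l.symm]⟩
    · exact ⟨1, by simp⟩
    · exact ⟨0, by simp [Ne.symm h2]⟩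
  · have : (wt r (.inr (.inr false))).1 (Fin.last r) = 1 := by
      simp [wt, spinor, h0l.symm]
    rw [this]
    simp only [Nat.cast_one, hhalf, chargeSign, false_iff]; norm_num
  · have : (wt r (.inr (.inr true))).1 (Fin.last r) = 1 := by
      simp [wt, spinor, simpleCurrent, hsw, h0l.symm]
    rw [this]
    simp only [Nat.cast_one, hhalf, chargeSign, false_iff]; norm_num

theorem currentInvariant_wt {r : ℕ} (hr : 3 ≤ r) (x y : Wt r) :
    currentInvariant r 2 (wt r x) (wt r y) = (currentMat r x y : ℂ) := by
  have hI : (Finset.Icc 1 2 : Finset ℕ) = {1, 2} := rfl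
  -- At level 2 the term ℓR/(2N) equals the integer ℓ, so only the charge λ_r/2 matters.
  have hq : ∀ l : ℕ, (∃ k : ℤ, (((wt r x).1 (Fin.last r) : ℕ) : ℚ) / 2 + (l : ℚ) / (2 * 2) * (2 * (2 : ℕ)) = k) ↔
      chargeSign x = 1 := by
    intro l
    rw [← label_last hr]
    have e : (l : ℚ) / (2 * 2) * (2 * (2 : ℕ)) = l := by push_cast; ring
    rw [e]
    constructor
    · rintro ⟨k, hk⟩; exact ⟨k - l, by push_cast; linarith⟩
    · rintro ⟨k, hk⟩; exact ⟨k + l, by push_cast; linarith⟩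
  have hne : (-1 : ℝ) ≠ 1 := by norm_num
  unfold currentInvariant
  simp only [hq]
  rw [hI, Finset.sum_pair (by norm_num)]
  simp only [Function.iterate_succ, Function.iterate_zero, Function.comp_apply, id,
    simpleCurrent_wt hr, (wt_injective hr).eq_iff]
  rcases x with (_ | _) | a | (_ | _) <;> rcases y with (_ | _) | b | (_ | _) <;>
    simp [jWt, chargeSign, currentMat, hne]
  split_ifs <;> norm_num

lemma lamSpinor_eq (r : ℕ) : lamSpinor r = wt r (.inr (.inr (kap r))) := by
  by_cases h : 8 ∣ r <;> simp [lamSpinor, wt, kap, h]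

lemma muSpinor_eq (r : ℕ) : muSpinor r = wt r (.inr (.inr (!kap r))) := by
  by_cases h : 8 ∣ r <;> simp [muSpinor, wt, kap, h]

lemma wt_mem_calC_iff {r s : ℕ} (hr : 3 ≤ r) (hs : s * s = 2 * r + 1) (x : Wt r) :
    wt r x ∈ calC r ↔ ∃ a : Fin r, s ∣ a.val + 1 ∧ x = .inr (.inl a) := by
  rw [calC, Set.mem_ofPred_eq, ← hs, Nat.sqrt_eq]
  simp only [Fin.exists_fin_succ]
  have : ∀ a : Fin r, gam r a.succ = wt r (.inr (.inl a)) := fun _ => rfl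
  simp [this, (wt_injective hr).eq_iff]

lemma ite_eq_natCast {c : Prop} {_ : Decidable c} {k : ℕ} (h : c ∧ k = 1 ∨ ¬ c ∧ k = 0) :
    (if c then 1 else 0) = (k : ℂ) := by
  rcases h with ⟨hc, rfl⟩ | ⟨hc, rfl⟩ <;> simp [hc]

theorem calBi_wt {r s : ℕ} (hr : 3 ≤ r) (hs : s * s = 2 * r + 1) (x y : Wt r) :
    calBi r (wt r x) (wt r y) = (matBi r s x y : ℂ) := by
  refine ite_eq_natCast ?_
  simp only [wt_mem_calC_iff hr hs, vacuum_eq, lamSpinor_eq, muSpinor_eq, simpleCurrent_wt hr,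
    (wt_injective hr).eq_iff, jWt]
  generalize hk : kap r = k
  rcases x with p | a | p <;> rcases y with q | b | q <;> simp [matBi, hk] <;>
    first | grind | (cases p <;> cases q <;> cases k <;> simp)

theorem calBii_wt {r s : ℕ} (hr : 3 ≤ r) (hs : s * s = 2 * r + 1) (x y : Wt r) :
    calBii r (wt r x) (wt r y) = (matBii r s x y : ℂ) := by
  refine ite_eq_natCast ?_
  simp only [wt_mem_calC_iff hr hs, vacuum_eq, lamSpinor_eq,
    (wt_injective hr).eq_iff]
  generalize hk : kap r = k
  rcases x with p | a | p <;> rcases y with q | b | q <;> simp [matBii, extVec, hk] <;> grind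

/-! ### The matrices in the list commute with `S` -/

lemma sum_indicator_multiples {r i j : ℕ} (hij : i * j = 2 * r + 1) :
    ∑ z : ZMod (2 * r + 1), (if (i : ZMod (2 * r + 1)) ∣ z then (1 : ℂ) else 0) = j := by
  have hi : i ∣ 2 * r + 1 := ⟨j, hij.symm⟩
  have h1 : ∀ k : Fin r, ((i : ZMod (2 * r + 1)) ∣ ((k.val + 1 : ℕ) : ZMod (2 * r + 1))) ↔ i ∣ k.val + 1 := by
    intro k
    have := zmod_natCast_dvd_intCast hi ((k.val + 1 : ℕ) : ℤ)
    rw [Int.cast_natCast] at this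
    rw [this, Int.natCast_dvd_natCast]
  rw [zmod_sum_fold]
  simp only [dvd_neg, h1, dvd_zero, if_true]
  rw [← sum_indicator_dvd (r := r) (g := j) (d := i) (by rw [mul_comm, hij])]
  push_cast
  rw [Finset.mul_sum]
  congr 1
  exact Finset.sum_congr rfl fun k _ => by ring

/-- The indicators of the multiples of i and of j are Fourier transforms of each other up to a
factor. Expanding both, the sum over y forces t = s - c, and the substitution y = 2s - c, allowed
since n is odd, gives the right side. -/
lemma indicator_dft {r i j : ℕ} (hij : i * j = 2 * r + 1) (a c : ZMod (2 * r + 1)) :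
    ∑ y : ZMod (2 * r + 1), (if (i : ZMod (2 * r + 1)) ∣ a - y ∧ (j : ZMod (2 * r + 1)) ∣ a + y
        then (1 : ℂ) else 0) * ZMod.stdAddChar (y * c) =
      ∑ y : ZMod (2 * r + 1), (if (i : ZMod (2 * r + 1)) ∣ y - c ∧ (j : ZMod (2 * r + 1)) ∣ y + c
        then (1 : ℂ) else 0) * ZMod.stdAddChar (y * a) := by
  have hi0 : 0 < i := Nat.pos_of_ne_zero (by rintro rfl; omega)
  have hj0 : 0 < j := Nat.pos_of_ne_zero (by rintro rfl; omega)
  let χ : ℕ → ZMod (2 * r + 1) → ℂ := fun k z => if (k : ZMod (2 * r + 1)) ∣ z then 1 else 0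
  have hand : ∀ u v : ZMod (2 * r + 1), (if (i : ZMod (2 * r + 1)) ∣ u ∧ (j : ZMod (2 * r + 1)) ∣ v
      then (1 : ℂ) else 0) = χ i u * χ j v := fun u v => by
    simp only [χ]
    by_cases h1 : (i : ZMod (2 * r + 1)) ∣ u <;> by_cases h2 : (j : ZMod (2 * r + 1)) ∣ v <;> simp [h1, h2]
  simp only [hand]
  have ft : ∀ (k l : ℕ), k * l = 2 * r + 1 → ∀ v, ∑ z, χ k z * ZMod.stdAddChar (v * z) = χ l v * l := by
    intro k l hkl v
    have hk0 : 0 < k := Nat.pos_of_ne_zero (by rintro rfl; omega)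
    have := sum_addChar_over_multiples (n := 2 * r + 1) (i := k) ⟨l, hkl.symm⟩ 1 v isUnit_one
    rw [sum_indicator_multiples hkl, show (2 * r + 1) / k = l by
      rw [← hkl]; exact Nat.mul_div_cancel_left _ hk0] at this
    simp only [one_mul] at this
    simp only [χ, ite_mul, one_mul, zero_mul]
    exact this
  have hi' : (i : ℂ) ≠ 0 := by exact_mod_cast hi0.ne'
  have hj' : (j : ℂ) ≠ 0 := by exact_mod_cast hj0.ne'
  have orth : ∀ x : ZMod (2 * r + 1), ∑ y : ZMod (2 * r + 1), ZMod.stdAddChar (y * x) =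
      if x = 0 then (2 * r + 1 : ℂ) else 0 := by
    intro x
    have := AddChar.sum_mulShift x (ZMod.isPrimitive_stdAddChar (2 * r + 1))
    rw [this, ZMod.card]; push_cast; rfl
  have e1 : (∑ y, χ i (a - y) * χ j (a + y) * ZMod.stdAddChar (y * c)) * (i * j) =
      ∑ y, ∑ s, ∑ t, χ j s * χ i t * ZMod.stdAddChar (a * (s + t)) * ZMod.stdAddChar (y * (c - s + t)) := by
    rw [Finset.sum_mul]
    refine Finset.sum_congr rfl fun y _ => ?_
    have h1 := ft j i (by rw [mul_comm, hij]) (a - y)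
    have h2 := ft i j hij (a + y)
    calc _ = (χ i (a - y) * i) * (χ j (a + y) * j) * ZMod.stdAddChar (y * c) := by ring
      _ = _ := by
        rw [← h1, ← h2, Finset.sum_mul_sum, Finset.sum_mul]
        refine Finset.sum_congr rfl fun s _ => ?_
        rw [Finset.sum_mul]
        refine Finset.sum_congr rfl fun t _ => ?_
        have : ZMod.stdAddChar ((a - y) * s) * ZMod.stdAddChar ((a + y) * t) * ZMod.stdAddChar (y * c) =
            ZMod.stdAddChar (a * (s + t)) * ZMod.stdAddChar (y * (c - s + t)) := by
          rw [← AddChar.map_add_eq_mul, ← AddChar.map_add_eq_mul, ← AddChar.map_add_eq_mul]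
          congr 1; ring
        linear_combination χ j s * χ i t * this
  have e2 : ∑ y, ∑ s, ∑ t, χ j s * χ i t * ZMod.stdAddChar (a * (s + t)) * ZMod.stdAddChar (y * (c - s + t)) =
      (2 * r + 1) * ∑ s, χ j s * χ i (s - c) * ZMod.stdAddChar (a * (2 * s - c)) := by
    rw [Finset.sum_comm, Finset.mul_sum]
    refine Finset.sum_congr rfl fun s _ => ?_
    rw [Finset.sum_comm]
    simp only [← Finset.mul_sum, orth]
    rw [Finset.sum_eq_single (s - c)]
    · rw [if_pos (by ring), show s + (s - c) = 2 * s - c by ring]; ring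
    · intro t _ ht
      rw [if_neg (fun h => ht (by linear_combination h)), mul_zero]
    · intro h; exact absurd (Finset.mem_univ _) h
  have h2u : IsUnit (2 : ZMod (2 * r + 1)) := by
    have := (ZMod.isUnit_iff_coprime 2 (2 * r + 1)).2 (by simp)
    exact_mod_cast this
  have e3 : ∑ y, χ i (y - c) * χ j (y + c) * ZMod.stdAddChar (y * a) =
      ∑ s, χ j s * χ i (s - c) * ZMod.stdAddChar (a * (2 * s - c)) := by
    have hbij : Function.Bijective fun s : ZMod (2 * r + 1) => 2 * s - c := by
      rw [← Finite.injective_iff_bijective]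
      intro s t hst
      exact h2u.mul_left_cancel (sub_left_injective hst)
    rw [← hbij.sum_comp]
    refine Finset.sum_congr rfl fun s _ => ?_
    have hχ : ∀ k z, χ k (2 * z) = χ k z := fun k z => by
      simp only [χ, h2u.dvd_mul_left]
    rw [show 2 * s - c - c = 2 * (s - c) by ring, show 2 * s - c + c = 2 * s by ring, hχ, hχ, mul_comm a]
    ring
  rw [e2, ← e3] at e1
  have hij' : (i : ℂ) * j = 2 * r + 1 := by exact_mod_cast hij
  rw [hij', mul_comm] at e1
  exact mul_left_cancel₀ (by rw [← hij']; exact mul_ne_zero hi' hj') e1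

/-- Changing the sign of y exchanges the two indicators, so their sum is well defined on folded
indices. -/
lemma pairCount_fold {r i j : ℕ} (hij : i * j = 2 * r + 1) (a : ℕ) (y : ZMod (2 * r + 1)) :
    ((pairCount i j a (fold r y).val : ℕ) : ℂ) =
      (if (i : ZMod (2 * r + 1)) ∣ (a : ZMod (2 * r + 1)) - y ∧ (j : ZMod (2 * r + 1)) ∣ (a : ZMod (2 * r + 1)) + y
        then (1 : ℂ) else 0) +
      (if (j : ZMod (2 * r + 1)) ∣ (a : ZMod (2 * r + 1)) - y ∧ (i : ZMod (2 * r + 1)) ∣ (a : ZMod (2 * r + 1)) + y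
        then (1 : ℂ) else 0) := by
  have hi : i ∣ 2 * r + 1 := ⟨j, hij.symm⟩
  have hj : j ∣ 2 * r + 1 := ⟨i, ((mul_comm j i).trans hij).symm⟩
  have h1 : ∀ k, k ∣ 2 * r + 1 → (((k : ℤ) ∣ (a : ℤ) - (fold r y).val ↔
      (k : ZMod (2 * r + 1)) ∣ (a : ZMod (2 * r + 1)) - ((fold r y).val : ZMod (2 * r + 1))) ∧
      ((k : ℤ) ∣ (a : ℤ) + (fold r y).val ↔
      (k : ZMod (2 * r + 1)) ∣ (a : ZMod (2 * r + 1)) + ((fold r y).val : ZMod (2 * r + 1)))) := by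
    intro k hk
    rw [← zmod_natCast_dvd_intCast hk, ← zmod_natCast_dvd_intCast hk]
    push_cast
    exact ⟨Iff.rfl, Iff.rfl⟩
  simp only [pairCount, (h1 i hi).1, (h1 i hi).2, (h1 j hj).1, (h1 j hj).2]
  push_cast
  rcases eq_or_eq_neg_fold y with h | h
  · rw [← h]
  · have h' : ((fold r y).val : ZMod (2 * r + 1)) = -y := neg_eq_iff_eq_neg.2 h |>.symm
    simp only [h', sub_neg_eq_add, ← sub_eq_add_neg]
    rw [add_comm]
    simp only [and_comm]

lemma pairCount_comm_cosMatrix {r i j : ℕ} (hij : i * j = 2 * r + 1) (a c : Fin (r + 1)) :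
    ∑ k : Fin (r + 1), (pairCount i j a.val k.val : ℝ) * (mult k * cosMatrix r k c) =
      ∑ k : Fin (r + 1), (pairCount i j k.val c.val : ℝ) * (mult k * cosMatrix r k a) := by
  have hf : ∀ a : Fin (r + 1), fold r ((a.val : ℕ) : ZMod (2 * r + 1)) = a := fun a => fold_natCast a.is_lt
  have h1 := sum_fold_mul_stdAddChar r (fun k => ((pairCount i j a.val k.val : ℕ) : ℂ)) (c.val : ZMod (2 * r + 1))
  have h2 := sum_fold_mul_stdAddChar r (fun k => ((pairCount i j c.val k.val : ℕ) : ℂ)) (a.val : ZMod (2 * r + 1))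
  simp only [pairCount_fold hij, hf, add_mul, Finset.sum_add_distrib] at h1 h2
  have h3 := indicator_dft hij a.val c.val
  have h4 := indicator_dft (r := r) (i := j) (j := i) (by rw [mul_comm, hij]) a.val c.val
  rw [h3, h4] at h1
  have h5 : ∀ k : ℕ, ∀ y : ZMod (2 * r + 1), (k : ZMod (2 * r + 1)) ∣ y - (c.val : ZMod (2 * r + 1)) ↔
    (k : ZMod (2 * r + 1)) ∣ (c.val : ZMod (2 * r + 1)) - y := fun k y => dvd_sub_comm
  simp only [h5, add_comm _ ((c.val : ℕ) : ZMod (2 * r + 1))] at h1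
  rw [h1] at h2
  simp only [pairCount_swap i j c.val]
  exact_mod_cast h2

/-- The case a = 0 of the previous identity, divided by 2. -/
lemma one_add_sum_dvdBoth {r i j : ℕ} (hij : i * j = 2 * r + 1) (c : Fin r) :
    1 + ∑ k : Fin r, 2 * (dvdBoth i j k : ℝ) * cosMatrix r k.succ c.succ =
      dvdBoth i j c + ∑ k : Fin r, (pairCount i j ((k.val : ℤ) + 1) ((c.val : ℤ) + 1) : ℝ) := by
  have h := pairCount_comm_cosMatrix hij 0 c.succ
  rw [Fin.sum_univ_succ, Fin.sum_univ_succ] at h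
  push_cast [Fin.val_succ, Fin.val_zero, pairCount_zero_zero, pairCount_zero_left, mult_zero, mult_succ,
    cosMatrix_zero_left, cosMatrix_zero_right] at h
  have e : ∀ k : Fin r, 2 * (dvdBoth i j k : ℝ) * (2 * cosMatrix r k.succ c.succ) =
    2 * (2 * (dvdBoth i j k : ℝ) * cosMatrix r k.succ c.succ) := fun k => by ring
  simp only [e, mul_one, ← Finset.mul_sum, ← Finset.sum_mul] at h
  linarith

/-- Block by block: entries between γ's and the simple currents reduce to
`pairCount_comm_cosMatrix`, and the other blocks follow directly from the entries of S. -/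
theorem pairMat_comm_smat {r i j : ℕ} (hij : i * j = 2 * r + 1) (x y : Wt r) :
    ∑ z, (pairMat r i j x z : ℝ) * smat r z y = ∑ z, smat r x z * (pairMat r i j z y : ℝ) := by
  have hs0 : Real.sqrt (2 * (r : ℝ) + 1) ≠ 0 := (Real.sqrt_pos.2 (by positivity)).ne'
  have hVG := fun c : Fin r => one_add_sum_dvdBoth hij c
  have hGG : ∀ a c : Fin r, 2 * (dvdBoth i j a : ℝ) +
        ∑ k : Fin r, 2 * (pairCount i j ((a.val : ℤ) + 1) ((k.val : ℤ) + 1) : ℝ) * cosMatrix r k.succ c.succ =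
      2 * dvdBoth i j c + ∑ k : Fin r, 2 * cosMatrix r a.succ k.succ *
        (pairCount i j ((k.val : ℤ) + 1) ((c.val : ℤ) + 1) : ℝ) := by
    intro a c
    have h := pairCount_comm_cosMatrix hij a.succ c.succ
    rw [Fin.sum_univ_succ, Fin.sum_univ_succ] at h
    push_cast [Fin.val_succ, Fin.val_zero, pairCount_zero_right, pairCount_zero_left, mult_zero, mult_succ,
      cosMatrix_zero_left] at h
    have e : ∀ k : Fin r, (pairCount i j ((a.val : ℤ) + 1) ((k.val : ℤ) + 1) : ℝ) * (2 * cosMatrix r k.succ c.succ) =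
      2 * (pairCount i j ((a.val : ℤ) + 1) ((k.val : ℤ) + 1) : ℝ) * cosMatrix r k.succ c.succ := fun k => by ring
    simp only [e, mul_one] at h
    rw [h]
    congr 1
    exact Finset.sum_congr rfl fun k _ => by rw [cosMatrix_comm r a.succ]; ring
  rw [sum_wt, sum_wt]
  rcases x with p | a | p <;> rcases y with q | b | q <;> try simp only [smat_gg]
  · cases p <;> cases q <;> simp [pairMat, smat, mul_comm] 
  · have := hVG b
    simp only [← mul_div_assoc, ← Finset.sum_div]
    cases p <;> simp [pairMat, smat, ← Finset.mul_sum] <;> field_simp <;> linarith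
  · cases p <;> cases q <;> simp [pairMat, smat] 
  · have := hVG a
    simp only [div_mul_eq_mul_div, ← Finset.sum_div]
    have e1 : ∀ k : Fin r, 2 * cosMatrix r a.succ k.succ * (dvdBoth i j k : ℝ) =
      2 * dvdBoth i j k * cosMatrix r k.succ a.succ := fun k => by rw [cosMatrix_comm r a.succ]; ring
    have e2 : ∀ k : Fin r, pairCount i j ((k.val : ℤ) + 1) ((a.val : ℤ) + 1) =
      pairCount i j ((a.val : ℤ) + 1) ((k.val : ℤ) + 1) := fun k => pairCount_swap _ _ _ _
    simp only [e2] at this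
    cases q <;> simp [pairMat, smat, ← Finset.sum_mul, e1] <;> field_simp <;> linarith
  · have := hGG a b
    simp only [← mul_div_assoc, div_mul_eq_mul_div, ← Finset.sum_div]
    simp [pairMat, smat]; field_simp; linarith
  · simp [pairMat, smat]
  · cases p <;> cases q <;> simp [pairMat, smat]
  · simp [pairMat, smat]
  · cases p <;> cases q <;> simp [pairMat, smat]

lemma currentMat_comm_smat {r : ℕ} (x y : Wt r) :
    ∑ z, (currentMat r x z : ℝ) * smat r z y = ∑ z, smat r x z * (currentMat r z y : ℝ) := by
  rw [sum_wt, sum_wt]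
  rcases x with p | a | p <;> rcases y with q | b | q <;> simp [currentMat, smat] <;> ring

lemma four_dvd_of_sq {r s : ℕ} (hs : s * s = 2 * r + 1) : 4 ∣ r := by
  have hodd : Odd s := by
    have : Odd (s * s) := by rw [hs]; exact ⟨r, rfl⟩
    exact (Nat.odd_mul.1 this).1
  obtain ⟨k, hk⟩ := hodd
  have h1 := (Nat.even_mul_succ_self k).two_dvd
  have h2 : s * s = 4 * (k * (k + 1)) + 1 := by rw [hk]; ring
  omega

lemma sqrt_eq_of_sq {r s : ℕ} (hs : s * s = 2 * r + 1) : Real.sqrt (2 * r + 1) = s := by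
  have : (2 * (r : ℝ) + 1) = (s : ℝ) * s := by exact_mod_cast hs.symm
  rw [this, Real.sqrt_mul_self (Nat.cast_nonneg s)]

/-- When i = j = √n the subgroup indicator factors as a product, and each factor is its own Fourier
transform after normalization. The spinor entry corrects the 0 and J0 components, which differ. -/
theorem smat_mul_extVec {r s : ℕ} (hs : s * s = 2 * r + 1) (x : Wt r) :
    ∑ z, smat r x z * (extVec r s z : ℝ) = extVec r s x := by
  have hs0 : (s : ℝ) ≠ 0 := by
    have : s ≠ 0 := by rintro rfl; omega
    exact_mod_cast this
  have hodd : Odd s := by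
    have : Odd (s * s) := by rw [hs]; exact ⟨r, rfl⟩
    exact (Nat.odd_mul.1 this).1
  have h1 : (1 : ℝ) + 2 * ∑ b : Fin r, (if s ∣ b.val + 1 then 1 else 0) = s := by
    exact_mod_cast sum_indicator_dvd hs
  have h2 : ∀ a : Fin r, 1 + ∑ b : Fin r, 2 * cosMatrix r a.succ b.succ * (if s ∣ b.val + 1 then 1 else 0) =
      (if s ∣ a.val + 1 then 1 else 0) * (s : ℝ) := by
    intro a
    have h := one_add_sum_dvdBoth hs a
    have e1 : ∀ b : Fin r, (dvdBoth s s b : ℝ) = if s ∣ b.val + 1 then 1 else 0 := fun b => by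
      simp [dvdBoth]
    have e2 : ∀ k : Fin r, (pairCount s s ((k.val : ℤ) + 1) ((a.val : ℤ) + 1) : ℝ) =
        2 * (if s ∣ k.val + 1 then 1 else 0) * (if s ∣ a.val + 1 then 1 else 0) := fun k => by
      have := dvd_sub_add_iff hodd (k.val + 1) (a.val + 1)
      push_cast at this
      simp only [pairCount, this]
      by_cases hk : s ∣ k.val + 1 <;> by_cases ha : s ∣ a.val + 1 <;> simp [hk, ha]
    simp only [e1, e2, ← Finset.sum_mul, ← Finset.mul_sum] at h
    have e3 : ∀ b : Fin r, 2 * cosMatrix r a.succ b.succ * (if s ∣ b.val + 1 then (1 : ℝ) else 0) =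
        2 * (if s ∣ b.val + 1 then 1 else 0) * cosMatrix r b.succ a.succ := fun b => by
      rw [cosMatrix_comm r a.succ]; ring
    rw [Finset.sum_congr rfl fun b _ => e3 b, h, ← h1]
    ring
  rw [sum_wt]
  rcases x with p | a | p
  · simp only [smat, extVec, sqrt_eq_of_sq hs, Bool.false_eq_true, if_false, if_true, Nat.cast_zero, mul_zero, Nat.cast_one,
      mul_one, zero_add, Nat.cast_ite, ← Finset.mul_sum]
    have h3 : 1 / (2 * (s : ℝ)) + 1 / (s : ℝ) * ∑ b : Fin r, (if s ∣ b.val + 1 then (1 : ℝ) else 0) = 1 / 2 := by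
      field_simp; linarith
    rw [← add_assoc, h3]
    cases p <;> cases kap r <;> norm_num
  · have := h2 a
    simp only [smat_gg, div_mul_eq_mul_div, ← Finset.sum_div]
    simp only [smat, extVec, sqrt_eq_of_sq hs, Bool.false_eq_true, if_false, if_true, Nat.cast_zero, mul_zero, Nat.cast_one,
      mul_one, zero_add, Nat.cast_ite, zero_mul, add_zero]
    rw [← add_div, this, mul_div_cancel_right₀ _ hs0]
  · cases p <;> cases hk : kap r <;> simp [smat, extVec, hk] <;> norm_num

/-- The vector `0 - J0 + 2 λ^r`, fixed by `S`. -/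
def fixVec (r : ℕ) : Wt r → ℝ
  | .inl i => if i then -1 else 1
  | .inr (.inl _) => 0
  | .inr (.inr q) => if q = kap r then 2 else 0

lemma smat_mul_fixVec {r : ℕ} (x : Wt r) : ∑ z, smat r x z * fixVec r z = fixVec r x := by
  rw [sum_wt]
  rcases x with p | a | p
  · cases p <;> cases hk : kap r <;> simp [smat, fixVec, hk]
  · cases hk : kap r <;> simp [smat, fixVec, hk]
  · cases p <;> cases hk : kap r <;> simp [smat, fixVec, hk] <;> norm_num

lemma outer_comm_smat {r : ℕ} {v : Wt r → ℝ} (hv : ∀ x, ∑ z, smat r x z * v z = v x) (x y : Wt r) :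
    ∑ z, v x * v z * smat r z y = ∑ z, smat r x z * (v z * v y) := by
  have e1 : ∀ z, v x * v z * smat r z y = v x * (smat r y z * v z) := fun z => by rw [smat_comm r y]; ring
  simp only [e1, ← mul_assoc (smat r x _), ← Finset.mul_sum, ← Finset.sum_mul, hv]

lemma matBii_comm_smat {r s : ℕ} (hs : s * s = 2 * r + 1) (x y : Wt r) :
    ∑ z, (matBii r s x z : ℝ) * smat r z y = ∑ z, smat r x z * (matBii r s z y : ℝ) := by
  simp only [matBii, Nat.cast_mul]
  exact outer_comm_smat (smat_mul_extVec hs) x y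

/-- B^i is a combination of B^ii, the identity, the simple current invariant and the outer square of
a vector fixed by S, so it commutes with S because each of these does. -/
lemma matBi_eq {r s : ℕ} (x y : Wt r) : (matBi r s x y : ℝ) = matBii r s x y + (if x = y then 1 else 0) -
    currentMat r x y / 2 - fixVec r x * fixVec r y / 2 := by
  generalize hk : kap r = k
  rcases x with p | a | p <;> rcases y with q | b | q <;>
    simp [matBi, matBii, extVec, currentMat, fixVec, hk]
  · cases p <;> cases q <;> norm_num
  · cases p <;> simp
  · cases p <;> cases q <;> cases k <;> norm_num
  · split_ifs <;> norm_num
  · cases p <;> cases q <;> cases k <;> norm_num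
  · split_ifs <;> rfl
  · cases p <;> cases q <;> cases k <;> norm_num

lemma matBi_comm_smat {r s : ℕ} (hs : s * s = 2 * r + 1) (x y : Wt r) :
    ∑ z, (matBi r s x z : ℝ) * smat r z y = ∑ z, smat r x z * (matBi r s z y : ℝ) := by
  have h1 := matBii_comm_smat hs x y
  have h2 := currentMat_comm_smat x y
  have h3 := outer_comm_smat (v := fixVec r) smat_mul_fixVec x y
  have h4 : ∑ z, (if x = z then (1 : ℝ) else 0) * smat r z y = ∑ z, smat r x z * (if z = y then (1 : ℝ) else 0) := by
    simp
  simp only [matBi_eq, sub_mul, add_mul, mul_sub, mul_add, Finset.sum_add_distrib, Finset.sum_sub_distrib,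
    div_mul_eq_mul_div, mul_div_assoc', ← Finset.sum_div, h1, h2, h3, h4]

/-! ### The matrices in the list commute with T -/

lemma confWt_kap {r : ℕ} (h : 4 ∣ r) : ∃ k : ℤ, confWt (r := r) (.inr (.inr (kap r))) = k := by
  by_cases h8 : 8 ∣ r
  · obtain ⟨k, rfl⟩ := h8
    exact ⟨k, by simp [confWt, kap]⟩
  · have h9 : ∃ k, r = 8 * k + 4 := ⟨r / 8, by omega⟩
    obtain ⟨k, hk⟩ := h9
    have : kap r = true := by simp [kap, h8]
    refine ⟨k + 1, ?_⟩
    simp only [confWt, this, if_true]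
    rw [hk]; push_cast; ring

/-- Weights in the support of `extVec` have integral conformal weight: s ∣ a gives n = s² ∣ a², and
the spinor included is the one with integral r/8 or r/8 + 1/2. -/
lemma confWt_extVec {r s : ℕ} (hs : s * s = 2 * r + 1) {x : Wt r} (hx : extVec r s x ≠ 0) :
    ∃ k : ℤ, confWt x = k := by
  rcases x with p | a | p
  · cases p
    · exact ⟨0, by simp [confWt]⟩
    · simp [extVec] at hx
  · have ha : s ∣ a.val + 1 := by by_contra h; simp [extVec, h] at hx
    have h1 := (confWt_sub_iff (r := r) (.inr (.inl a)) (.inl false) rfl rfl).2 (by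
      rw [← hs]; push_cast
      have : (s : ℤ) ∣ ((a.val + 1 : ℕ) : ℤ) := Int.natCast_dvd_natCast.2 ha
      simpa [lvl] using mul_dvd_mul this this)
    simpa [confWt] using h1
  · by_cases hp : p = kap r
    · subst hp; exact confWt_kap (four_dvd_of_sq hs)
    · simp [extVec, hp] at hx

lemma matBi_conf {r s : ℕ} (hs : s * s = 2 * r + 1) {x y : Wt r} (h : matBi r s x y ≠ 0) :
    ((∃ k : ℤ, confWt x = k) ∧ ∃ k : ℤ, confWt y = k) ∨ x = y := by
  have hV : ∀ p : Bool, ∃ k : ℤ, confWt (r := r) (.inl p) = k := fun p => by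
    cases p
    · exact ⟨0, by simp [confWt]⟩
    · exact ⟨1, by simp [confWt]⟩
  have hG : ∀ a : Fin r, s ∣ a.val + 1 → ∃ k : ℤ, confWt (r := r) (.inr (.inl a)) = k := fun a ha =>
    confWt_extVec hs (by simp [extVec, ha])
  have hP := confWt_kap (four_dvd_of_sq hs)
  rcases x with p | a | p <;> rcases y with q | b | q <;> simp [matBi] at h
  · exact .inl ⟨hV _, hV _⟩
  · exact .inl ⟨hV _, hG _ h.2⟩
  · obtain ⟨-, rfl⟩ := h; exact .inl ⟨hV _, hP⟩
  · exact .inl ⟨hG _ h.2, hV _⟩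
  · exact .inl ⟨hG _ h.2, hG _ h.1⟩
  · obtain ⟨rfl, h⟩ := h; exact .inl ⟨hG _ h, hP⟩
  · obtain ⟨-, rfl⟩ := h; exact .inl ⟨hP, hV _⟩
  · obtain ⟨rfl, h⟩ := h; exact .inl ⟨hP, hG _ h⟩
  · right
    obtain ⟨h1, h2⟩ := h
    rw [Bool.eq_not.2 h1, Bool.eq_not.2 h2]

lemma pairMat_conf {r i j : ℕ} (hij : i * j = 2 * r + 1) {x y : Wt r} (h : pairMat r i j x y ≠ 0) :
    ∃ k : ℤ, confWt x = confWt y + k := by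
  have hn : ((2 * r + 1 : ℕ) : ℤ) = (i : ℤ) * j := by exact_mod_cast hij.symm
  have hd : ∀ b : Fin r, dvdBoth i j b ≠ 0 → ((2 * r + 1 : ℕ) : ℤ) ∣ ((b.val : ℤ) + 1) * ((b.val : ℤ) + 1) := by
    intro b hb
    have hb' : i ∣ b.val + 1 ∧ j ∣ b.val + 1 := by by_contra h; simp [dvdBoth, h] at hb
    rw [hn]
    have h1 : (i : ℤ) ∣ ((b.val + 1 : ℕ) : ℤ) := Int.natCast_dvd_natCast.2 hb'.1
    have h2 : (j : ℤ) ∣ ((b.val + 1 : ℕ) : ℤ) := Int.natCast_dvd_natCast.2 hb'.2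
    simpa using mul_dvd_mul h1 h2
  rcases x with p | a | p <;> rcases y with q | b | q
  · exact (confWt_sub_iff _ _ rfl rfl).2 (by simp [lvl])
  · exact (confWt_sub_iff _ _ rfl rfl).2 (by
      have h' := (dvd_neg (a := ((2 * r + 1 : ℕ) : ℤ))).2 (hd b h)
      rw [← neg_mul] at h'
      simpa [lvl] using h')
  · exact absurd rfl h
  · exact (confWt_sub_iff _ _ rfl rfl).2 (by simpa [lvl] using hd a h)
  · refine (confWt_sub_iff _ _ rfl rfl).2 ?_
    have h' : pairCount i j ((a.val : ℤ) + 1) ((b.val : ℤ) + 1) ≠ 0 := h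
    simp only [lvl]
    push_cast at hn ⊢
    rw [hn]
    by_cases h1 : (i : ℤ) ∣ (a.val : ℤ) + 1 - (b.val + 1) ∧ (j : ℤ) ∣ (a.val : ℤ) + 1 + (b.val + 1)
    · exact mul_dvd_mul h1.1 h1.2
    · by_cases h2 : (j : ℤ) ∣ (a.val : ℤ) + 1 - (b.val + 1) ∧ (i : ℤ) ∣ (a.val : ℤ) + 1 + (b.val + 1)
      · rw [mul_comm]; exact mul_dvd_mul h2.1 h2.2
      · exact absurd (by simp only [pairCount, h1, h2, if_false]) h'
  · exact absurd rfl h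
  · exact absurd rfl h
  · exact absurd rfl h
  · have : p = q := by by_contra h'; simp [pairMat, h'] at h
    exact ⟨0, by rw [this]; simp⟩

/-! ### The list consists of physical invariants -/

lemma mul_wt {r : ℕ} (hr : 3 ≤ r) {A B : Matrix (PPlus r 2) (PPlus r 2) ℂ} {a b : Wt r → Wt r → ℕ}
    (hA : ∀ x y, A (wt r x) (wt r y) = (a x y : ℂ)) (hB : ∀ x y, B (wt r x) (wt r y) = (b x y : ℂ))
    (x y : Wt r) : (A * B) (wt r x) (wt r y) = ((∑ z, a x z * b z y : ℕ) : ℂ) := by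
  rw [Matrix.mul_apply, sum_weights hr]
  simp only [hA, hB]
  push_cast; rfl

/-- Multiplication by the simple current invariant removes the spinors and doubles the other entries
of the pair matrices after identification of 0 with J0; the factor 1/2 undoes the doubling. -/
lemma calBPair_wt {r d₁ l₁ d₂ l₂ i j i' j' : ℕ} (hr : 3 ≤ r) (h₁ : Matched (2 * r + 1) d₁ l₁ i j)
    (h₂ : Matched (2 * r + 1) d₂ l₂ i' j') (x y : Wt r) :
    calBPair r d₁ l₁ d₂ l₂ (wt r x) (wt r y) = (twoPairMat r i j i' j' x y : ℂ) := by
  have hadd : ∀ x y, (calB r d₁ l₁ + calB r d₂ l₂) (wt r x) (wt r y) =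
      ((pairMat r i j x y + pairMat r i' j' x y : ℕ) : ℂ) := fun x y => by
    rw [Matrix.add_apply, calB_wt hr h₁, calB_wt hr h₂]; push_cast; rfl
  have hsum : ∑ z, (pairMat r i j x z + pairMat r i' j' x z) * currentMat r z y =
      2 * twoPairMat r i j i' j' x y := by
    rw [sum_wt]
    rcases x with p | a | p <;> rcases y with q | b | q <;> simp [pairMat, currentMat, twoPairMat]
    · cases p <;> simp
    · ring
    · ring
    · ring
  rw [calBPair, Matrix.smul_apply, mul_wt hr hadd (currentInvariant_wt hr), hsum]
  push_cast
  rw [smul_eq_mul, ← mul_assoc]; norm_num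

lemma calBiii_wt {r s : ℕ} (hr : 3 ≤ r) (hs : s * s = 2 * r + 1) (x y : Wt r) :
    calBiii r (wt r x) (wt r y) = (matBiii r s x y : ℂ) := by
  have hsum : ∑ z, matBi r s x z * currentMat r z y = matBiii r s x y := by
    rw [sum_wt]
    rcases x with p | a | p <;> rcases y with q | b | q <;> simp [matBi, matBiii, currentMat]
    cases p <;> simp
  rw [calBiii, mul_wt hr (calBi_wt hr hs) (currentInvariant_wt hr), hsum]

lemma calBiv_wt {r s : ℕ} (hr : 3 ≤ r) (hs : s * s = 2 * r + 1) (x y : Wt r) :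
    calBiv r (wt r x) (wt r y) = (matBiii r s y x : ℂ) := by
  have hsum : ∑ z, currentMat r x z * matBi r s z y = matBiii r s y x := by
    have e : ∀ a : Fin r, (∑ x : Fin r, if s ∣ x.val + 1 then if a = x then 2 else 0 else 0) =
        if s ∣ a.val + 1 then 2 else 0 := fun a => by
      rw [Finset.sum_eq_single a (fun b _ hb => by simp [hb.symm]) (by simp)]; simp
    rw [sum_wt]
    rcases x with p | a | p <;> rcases y with q | b | q <;> simp [matBi, matBiii, currentMat, e]
    · cases q <;> simp
    · split_ifs <;> rfl
  rw [calBiv, mul_wt hr (currentInvariant_wt hr) (calBi_wt hr hs), hsum]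

lemma isPhysicalInvariant_of_wt {r : ℕ} (hr : 3 ≤ r) {M : Matrix (PPlus r 2) (PPlus r 2) ℂ}
    {m : Wt r → Wt r → ℕ} (hm : ∀ x y, M (wt r x) (wt r y) = (m x y : ℂ))
    (hS : Commute M (kpS r 2)) (hT : Commute M (kpT r 2)) (h0 : m (.inl false) (.inl false) = 1) :
    IsPhysicalInvariant M := by
  refine ⟨hS, hT, fun mu nu => ?_, ?_⟩
  · obtain ⟨x, rfl⟩ := wt_surjective hr mu
    obtain ⟨y, rfl⟩ := wt_surjective hr nu
    exact ⟨_, hm x y⟩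
  · rw [vacuum_eq, hm, h0, Nat.cast_one]

lemma commute_kpS_of_wt {r : ℕ} (hr : 3 ≤ r) {M : Matrix (PPlus r 2) (PPlus r 2) ℂ}
    {m : Wt r → Wt r → ℕ} (hm : ∀ x y, M (wt r x) (wt r y) = (m x y : ℂ))
    (h : ∀ x y, ∑ z, (m x z : ℝ) * smat r z y = ∑ z, smat r x z * (m z y : ℝ)) :
    Commute M (kpS r 2) :=
  (comm_kpS_iff hr M (fun x y => m x y) fun x y => by rw [hm]; push_cast; rfl).2 h

lemma commute_kpT_of_wt {r : ℕ} (hr : 3 ≤ r) {M : Matrix (PPlus r 2) (PPlus r 2) ℂ}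
    {m : Wt r → Wt r → ℕ} (hm : ∀ x y, M (wt r x) (wt r y) = (m x y : ℂ))
    (h : ∀ x y, m x y ≠ 0 → ∃ k : ℤ, confWt x = confWt y + k) : Commute M (kpT r 2) :=
  (comm_kpT_iff hr M).2 fun x y hxy => h x y fun h0 => hxy (by rw [hm, h0, Nat.cast_zero])

lemma commute_currentInvariant_kpS {r : ℕ} (hr : 3 ≤ r) : Commute (currentInvariant r 2) (kpS r 2) :=
  commute_kpS_of_wt hr (currentInvariant_wt hr) currentMat_comm_smat

lemma commute_currentInvariant_kpT {r : ℕ} (hr : 3 ≤ r) : Commute (currentInvariant r 2) (kpT r 2) := by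
  refine commute_kpT_of_wt hr (currentInvariant_wt hr) fun x y h => ?_
  rcases x with p | a | p <;> rcases y with q | b | q <;> simp [currentMat] at h
  · exact (confWt_sub_iff _ _ rfl rfl).2 (by simp [lvl])
  · rw [h]; exact ⟨0, by simp⟩

lemma commute_calB {r d l i j : ℕ} (hr : 3 ≤ r) (h : Matched (2 * r + 1) d l i j) :
    Commute (calB r d l) (kpS r 2) ∧ Commute (calB r d l) (kpT r 2) :=
  ⟨commute_kpS_of_wt hr (calB_wt hr h) (pairMat_comm_smat h.1),
    commute_kpT_of_wt hr (calB_wt hr h) fun _ _ => pairMat_conf h.1⟩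

lemma commute_calBi {r s : ℕ} (hr : 3 ≤ r) (hs : s * s = 2 * r + 1) :
    Commute (calBi r) (kpS r 2) ∧ Commute (calBi r) (kpT r 2) := by
  refine ⟨commute_kpS_of_wt hr (calBi_wt hr hs) (matBi_comm_smat hs),
    commute_kpT_of_wt hr (calBi_wt hr hs) fun x y h => ?_⟩
  rcases matBi_conf hs h with ⟨⟨k, hk⟩, k', hk'⟩ | rfl
  · exact ⟨k - k', by rw [hk, hk']; push_cast; ring⟩
  · exact ⟨0, by simp⟩

lemma isPhysicalInvariant_calB {r d l : ℕ} (hr : 3 ≤ r) (h : Admissible r d l) :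
    IsPhysicalInvariant (calB r d l) := by
  obtain ⟨i, j, h⟩ := h.exists_matched
  exact isPhysicalInvariant_of_wt hr (calB_wt hr h) (commute_calB hr h).1 (commute_calB hr h).2 rfl

lemma isPhysicalInvariant_calBPair {r d₁ l₁ d₂ l₂ : ℕ} (hr : 3 ≤ r) (h₁ : Admissible r d₁ l₁)
    (h₂ : Admissible r d₂ l₂) : IsPhysicalInvariant (calBPair r d₁ l₁ d₂ l₂) := by
  obtain ⟨i, j, h₁⟩ := h₁.exists_matched
  obtain ⟨i', j', h₂⟩ := h₂.exists_matched
  have c₁ := commute_calB hr h₁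
  have c₂ := commute_calB hr h₂
  exact isPhysicalInvariant_of_wt hr (calBPair_wt hr h₁ h₂)
    (((c₁.1.add_left c₂.1).mul_left (commute_currentInvariant_kpS hr)).smul_left _)
    (((c₁.2.add_left c₂.2).mul_left (commute_currentInvariant_kpT hr)).smul_left _) rfl

lemma isPhysicalInvariant_calBi {r s : ℕ} (hr : 3 ≤ r) (hs : s * s = 2 * r + 1) :
    IsPhysicalInvariant (calBi r) :=
  isPhysicalInvariant_of_wt hr (calBi_wt hr hs) (commute_calBi hr hs).1 (commute_calBi hr hs).2 rfl

lemma isPhysicalInvariant_calBii {r s : ℕ} (hr : 3 ≤ r) (hs : s * s = 2 * r + 1) :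
    IsPhysicalInvariant (calBii r) := by
  refine isPhysicalInvariant_of_wt hr (calBii_wt hr hs)
    (commute_kpS_of_wt hr (calBii_wt hr hs) (matBii_comm_smat hs))
    (commute_kpT_of_wt hr (calBii_wt hr hs) fun x y h => ?_) rfl
  obtain ⟨k, hk⟩ := confWt_extVec hs (left_ne_zero_of_mul h)
  obtain ⟨k', hk'⟩ := confWt_extVec hs (right_ne_zero_of_mul h)
  exact ⟨k - k', by rw [hk, hk']; push_cast; ring⟩

lemma isPhysicalInvariant_calBiii {r s : ℕ} (hr : 3 ≤ r) (hs : s * s = 2 * r + 1) :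
    IsPhysicalInvariant (calBiii r) :=
  isPhysicalInvariant_of_wt hr (calBiii_wt hr hs)
    ((commute_calBi hr hs).1.mul_left (commute_currentInvariant_kpS hr))
    ((commute_calBi hr hs).2.mul_left (commute_currentInvariant_kpT hr)) rfl

lemma isPhysicalInvariant_calBiv {r s : ℕ} (hr : 3 ≤ r) (hs : s * s = 2 * r + 1) :
    IsPhysicalInvariant (calBiv r) :=
  isPhysicalInvariant_of_wt hr (calBiv_wt hr hs)
    ((commute_currentInvariant_kpS hr).mul_left (commute_calBi hr hs).1)
    ((commute_currentInvariant_kpT hr).mul_left (commute_calBi hr hs).2) rfl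

/-! ### Every physical invariant is in the list -/

lemma twoPairMat_swap_left (r i j i' j' : ℕ) : twoPairMat r j i i' j' = twoPairMat r i j i' j' := by
  funext x y
  rcases x with _ | _ | _ <;> rcases y with _ | _ | _ <;>
    simp only [twoPairMat, pairCount_comm i j, dvdBoth_comm i j]

lemma twoPairMat_swap_right (r i j i' j' : ℕ) : twoPairMat r i j j' i' = twoPairMat r i j i' j' := by
  funext x y
  rcases x with _ | _ | _ <;> rcases y with _ | _ | _ <;>
    simp only [twoPairMat, pairCount_comm i' j', dvdBoth_comm i' j']

/-- Admissible parameters fix a factorization only up to the order of its factors, which the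
matrices do not see. -/
theorem mem_list_of_isPhysicalInvariant {r : ℕ} (hr : 3 ≤ r) {M : Matrix (PPlus r 2) (PPlus r 2) ℂ}
    (h : IsPhysicalInvariant M) : M ∈ familyA r ∨ M ∈ familyB r ∨ (IsSquare (2 * r + 1) ∧
      (M = calBi r ∨ M = calBii r ∨ M = calBiii r ∨ M = calBiv r)) := by
  obtain ⟨m, hM, hm⟩ := (isPhysicalInvariant_iff hr M).1 h
  have heq : ∀ {A : Matrix (PPlus r 2) (PPlus r 2) ℂ} {a : Wt r → Wt r → ℕ},
      (∀ x y, A (wt r x) (wt r y) = (a x y : ℂ)) → m = a → M = A := fun hA hma =>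
    (matrix_eq_iff hr _ _).2 fun x y => by rw [hM, hA, hma]
  rcases hm.classification with ⟨i, j, hij, e⟩ | ⟨i, j, i', j', hij, hij', e⟩ | ⟨s, hs, e⟩
  · obtain ⟨d, l, hadm, h | h⟩ := exists_admissible_matched hij
    · exact .inl ⟨d, l, hadm, heq (calB_wt hr h) e⟩
    · exact .inl ⟨d, l, hadm, heq (calB_wt hr h) (e.trans (pairMat_comm r i j).symm)⟩
  · obtain ⟨d, l, hadm, h⟩ := exists_admissible_matched hij
    obtain ⟨d', l', hadm', h'⟩ := exists_admissible_matched hij'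
    refine .inr (.inl ⟨d, l, d', l', hadm, hadm', ?_⟩)
    rcases h with h | h <;> rcases h' with h' | h'
    · exact heq (calBPair_wt hr h h') e
    · exact heq (calBPair_wt hr h h') (e.trans (twoPairMat_swap_right r i j i' j').symm)
    · exact heq (calBPair_wt hr h h') (e.trans (twoPairMat_swap_left r i j i' j').symm)
    · exact heq (calBPair_wt hr h h')
        (e.trans ((twoPairMat_swap_left r i j j' i').trans (twoPairMat_swap_right r i j i' j')).symm)
  · refine .inr (.inr ⟨⟨s, hs.symm⟩, ?_⟩)
    rcases e with e | e | e | e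
    · exact .inl (heq (calBi_wt hr hs) e)
    · exact .inr (.inl (heq (calBii_wt hr hs) e))
    · exact .inr (.inr (.inl (heq (calBiii_wt hr hs) e)))
    · exact .inr (.inr (.inr (heq (calBiv_wt hr hs) e)))

/-! ### The exceptional invariants are new -/

lemma current_current_familyA {r : ℕ} (hr : 3 ≤ r) {M : Matrix (PPlus r 2) (PPlus r 2) ℂ}
    (h : M ∈ familyA r) : M (wt r (.inl true)) (wt r (.inl true)) = 1 := by
  obtain ⟨d, l, hadm, rfl⟩ := h
  obtain ⟨i, j, h⟩ := hadm.exists_matched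
  rw [calB_wt hr h]; simp [pairMat]

lemma current_current_familyB {r : ℕ} (hr : 3 ≤ r) {M : Matrix (PPlus r 2) (PPlus r 2) ℂ}
    (h : M ∈ familyB r) : M (wt r (.inl true)) (wt r (.inl true)) = 1 := by
  obtain ⟨d, l, d', l', hadm, hadm', rfl⟩ := h
  obtain ⟨i, j, h⟩ := hadm.exists_matched
  obtain ⟨i', j', h'⟩ := hadm'.exists_matched
  rw [calBPair_wt hr h h']; simp [twoPairMat]

/-- The (0,J0) entry is nonzero only for B^iii and the (J0,0) entry only for B^iv; the entry at J0
and λ^r tells B^i from B^ii. -/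
lemma exceptional_nodup {r s : ℕ} (hr : 3 ≤ r) (hs : s * s = 2 * r + 1) :
    [calBi r, calBii r, calBiii r, calBiv r].Nodup := by
  have key : ∀ {A B : Matrix (PPlus r 2) (PPlus r 2) ℂ} {a b : Wt r → Wt r → ℕ},
      (∀ x y, A (wt r x) (wt r y) = (a x y : ℂ)) → (∀ x y, B (wt r x) (wt r y) = (b x y : ℂ)) →
      (∃ x y, a x y ≠ b x y) → A ≠ B := by
    rintro A B a b hA hB ⟨x, y, hxy⟩ rfl
    exact hxy (by exact_mod_cast (hA x y).symm.trans (hB x y))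
  have h1 := calBi_wt hr hs
  have h2 := calBii_wt hr hs
  have h3 := calBiii_wt hr hs
  have h4 := calBiv_wt hr hs
  have n12 := key h1 h2 ⟨.inl true, .inr (.inr (kap r)), by simp [matBi, matBii, extVec]⟩
  have n13 := key h1 h3 ⟨.inl false, .inl true, by simp [matBi, matBiii]⟩
  have n23 := key h2 h3 ⟨.inl false, .inl true, by simp [matBii, extVec, matBiii]⟩
  have n14 := key h1 h4 ⟨.inl true, .inl false, by simp [matBi, matBiii]⟩
  have n24 := key h2 h4 ⟨.inl true, .inl false, by simp [matBii, extVec, matBiii]⟩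
  have n34 := key h3 h4 ⟨.inl true, .inl false, by simp [matBiii]⟩
  simp [n12, n13, n14, n23, n24, n34]

lemma current_current_exceptional {r s : ℕ} (hr : 3 ≤ r) (hs : s * s = 2 * r + 1)
    {M : Matrix (PPlus r 2) (PPlus r 2) ℂ} (h : M ∈ [calBi r, calBii r, calBiii r, calBiv r]) :
    M (wt r (.inl true)) (wt r (.inl true)) = 0 := by
  simp only [List.mem_cons, List.not_mem_nil, or_false] at h
  rcases h with rfl | rfl | rfl | rfl
  · rw [calBi_wt hr hs]; simp [matBi]
  · rw [calBii_wt hr hs]; simp [matBii, extVec]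
  · rw [calBiii_wt hr hs]; simp [matBiii]
  · rw [calBiv_wt hr hs]; simp [matBiii]

end AffineB

theorem theorem2p1 (r : ℕ) (hr : 3 ≤ r) :
    (∀ M : Matrix (AffineB.PPlus r 2) (AffineB.PPlus r 2) ℂ,
      AffineB.IsPhysicalInvariant M ↔
        M ∈ AffineB.familyA r ∨ M ∈ AffineB.familyB r ∨
        (IsSquare (2 * r + 1) ∧
          (M = AffineB.calBi r ∨ M = AffineB.calBii r ∨
            M = AffineB.calBiii r ∨ M = AffineB.calBiv r))) ∧
    (IsSquare (2 * r + 1) →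
      [AffineB.calBi r, AffineB.calBii r, AffineB.calBiii r, AffineB.calBiv r].Nodup ∧
      ∀ M ∈ [AffineB.calBi r, AffineB.calBii r, AffineB.calBiii r, AffineB.calBiv r],
        M ∉ AffineB.familyA r ∧ M ∉ AffineB.familyB r) := by
  constructor
  · intro M
    refine ⟨AffineB.mem_list_of_isPhysicalInvariant hr, ?_⟩
    rintro (⟨d, l, h, rfl⟩ | ⟨d, l, d', l', h, h', rfl⟩ | ⟨⟨s, hs⟩, rfl | rfl | rfl | rfl⟩)
    · exact AffineB.isPhysicalInvariant_calB hr h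
    · exact AffineB.isPhysicalInvariant_calBPair hr h h'
    · exact AffineB.isPhysicalInvariant_calBi hr hs.symm
    · exact AffineB.isPhysicalInvariant_calBii hr hs.symm
    · exact AffineB.isPhysicalInvariant_calBiii hr hs.symm
    · exact AffineB.isPhysicalInvariant_calBiv hr hs.symm
  · rintro ⟨s, hs⟩
    refine ⟨AffineB.exceptional_nodup hr hs.symm, fun M hM => ⟨fun h => ?_, fun h => ?_⟩⟩
    · have := AffineB.current_current_familyA hr h
      rw [AffineB.current_current_exceptional hr hs.symm hM] at this
      exact zero_ne_one this
    · have := AffineB.current_current_familyB hr h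
      rw [AffineB.current_current_exceptional hr hs.symm hM] at this
      exact zero_ne_one this
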